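/- **Setting.** All sets lie in the plane $\mathbb R^2$. A *p.c.f. self-similar set* is a compact connected set $K$ with more than one point, together with finitely many continuous injections $F_1,\dots,F_N:K\to K$ and a continuous surjection $\pi:\{1,\dots,N\}^{\mathbb N}\to K$ with $\pi(i\omega)=F_i(\pi(\omega))$, such that the post-critical set $P=\bigcup_{n\ge1}\sigma^n\big(\pi^{-1}(\bigcup_{i\ne j}F_i(K)\cap F_j(K))\big)$ is finite ($\sigma$ the shift); its boundary is $\partial K=\pi(P)$. A *harmonic structure* $(D,\rho)$ on $K$ consists of a Laplacian matrix $D$ on $\partial K$ (symmetric, non-negative off-diagonal entries, zero row sums, kernel the constants) and weights $\rho_i>0$ such that, with $$\mathcal E_n(u,v)=\sum_{|w|=n}\frac1{\rho_w}\,\mathcal E_0(u\circ F_w,v\circ F_w),\qquad \mathcal E_0(f,g)=-f^{T}Dg ,$$ one has $\mathcal E_0(f,f)=\min\{\mathcal E_1(u,u): u|_{\partial K}=f\}$ for all $f$; it is *regular* if all $\rho_i<1$, and then it gives the form $\mathcal E^K(u,v)=\lim_n\mathcal E_n(u,v)$ on $\operatorname{dom}\mathcal E^K=\{u\in C(K):\sup_n\mathcal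 E_n(u,u)<\infty\}$. *Base.* Let $K_*$ be a Sierpinski-like fractal: a p.c.f. self-similar set generated by similarities $\phi_{*,i}$, $i\in\mathcal S$, of the plane with common ratio $c_*\in(0,1)$, whose boundary $V_0$ consists of three points, each the fixed point of some $\phi_{*,i}$, and such that there is a group of homeomorphisms of $K_*$, isomorphic to the dihedral group $D_3$, acting faithfully on $V_0$ by permutations and mapping $n$-cells to $n$-cells for every $n$. Let $r_*>0$ be its resistance scaling factor, i.e. the matrix on $V_0$ with diagonal entries $-2$ and off-diagonal entries $1$ together with the constant weights $r_*$ is a harmonic structure on $K_*$. *Hybrid.* Let $0<c<c_*$ and let $\phi_i$ be the similarity with the same fixed point and orthogonal part as $\phi_{*,i}$ and with ratio $c$. Let $(K_b)_{b\in B}$ be a finite family of p.c.f. self-similar sets (bonds), each attached to a set $\mathcal S_b\subseteq\mathcal S$ of cells (e.g. $b=(i,j)$, $i\neq j$, $\mathcal S_b=\{i,j\}$), with $\partial K_b=K_b\cap\bigcup_{i\in\mathcal S_b}\phi_i(V_0)$, and let ${\rm H}$ be the non-empty compact set with $${\rm H}=\bigcup_{i\in\mathcal S}\phi_i({\rm H})\cup\bigcup_{b\in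 B}K_b .$$ Assume that the cells $\phi_i({\rm H})$ are pairwise disjoint, that bonds meet cells and other bonds only at common boundary points (the boundary of $\phi_i({\rm H})$ being $\phi_i(V_0)$), and that the bonds replace the junction points of $K_*$: if $\phi_{*,i}(p)=\phi_{*,j}(q)$ with $p,q\in V_0$, then $\phi_i(p)$ and $\phi_j(q)$ are joined by a chain of bonds through their boundary points. Let each bond carry a regular harmonic structure, with form $(\mathcal E^{K_b},\operatorname{dom}\mathcal E^{K_b})$, and let $0<r<r_*$. A *resistance form* $(\mathcal E,\operatorname{dom}\mathcal E)$ is taken in the sense of Kigami; with $R$ its resistance metric, it is *local* if $\mathcal E(u,v)=0$ whenever the $R$-supports of $u,v\in\operatorname{dom}\mathcal E$ have positive $R$-distance, and *regular* if the space is locally compact in $R$ and the functions of $\operatorname{dom}\mathcal E$ with compact support are uniformly dense in the continuous functions with compact support. **Theorem.** (i) There is a unique local and regular resistance form $(\mathcal E,\operatorname{dom}\mathcal E)$ on ${\rm H}$ that is graph-directed self-similar with scaling $r$: a function $u:{\rm H}\to\mathbb R$ is in $\operatorname{dom}\mathcal E$ if and only if $u\circ\phi_i\in\operatorname{dom}\mathcal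 E$ for all $i\in\mathcal S$ and $u|_{K_b}\in\operatorname{dom}\mathcal E^{K_b}$ for all $b\in B$, and for all $u,v\in\operatorname{dom}\mathcal E$ $$\mathcal E(u,v)=\sum_{i\in\mathcal S}\frac1r\,\mathcal E(u\circ\phi_i,v\circ\phi_i)+\sum_{b\in B}\mathcal E^{K_b}(u|_{K_b},v|_{K_b}).$$ (ii) For $n\ge1$ let $\widetilde{\mathcal F}_n$ be the set of $u\in\operatorname{dom}\mathcal E$ that are constant on $\phi_\alpha({\rm H})$ for every word $\alpha\in\mathcal S^n$, where $\phi_\alpha=\phi_{\alpha_1}\circ\dots\circ\phi_{\alpha_n}$. Then $\operatorname{dom}\mathcal E$ is the set of all $u\in C({\rm H})$ for which there are $u_n\in\bigcup_{m\ge1}\widetilde{\mathcal F}_m$ with $u-u_n\in\operatorname{dom}\mathcal E$, $\mathcal E(u-u_n,u-u_n)\to0$ and $u_n(x)\to u(x)$ for all $x\in{\rm H}$; and for all $u,v\in\operatorname{dom}\mathcal E$ $$\mathcal E(u,v)=\sum_{k=0}^\infty\ \sum_{(\alpha,b)\in\mathcal S^k\times B}\frac1{r^k}\,\mathcal E^{K_b}\big((u\circ\phi_\alpha)|_{K_b},(v\circ\phi_\alpha)|_{K_b}\big).$$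 -/

import Mathlib

open Set Filter Topology

/-- The Euclidean plane. -/
abbrev Plane : Type := EuclideanSpace ℝ (Fin 2)

/-- The composition `F (α 0) ∘ F (α 1) ∘ ⋯ ∘ F (α (k - 1))` along the word `α` of length `k`;
the empty word gives the identity. -/
def wordMap {S X : Type*} (F : S → X → X) : (k : ℕ) → (Fin k → S) → X → X
  | 0, _ => id
  | k + 1, α => F (α 0) ∘ wordMap F k (fun j => α j.succ)

/-- Prepend a letter to an infinite word. -/
def consWord {S : Type*} (i : S) (ω : ℕ → S) : ℕ → S
  | 0 => i
  | k + 1 => ω k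

/-! ### Resistance forms -/

/-- A resistance form on a set `X`. -/
structure ResistanceForm (X : Type*) where
  /-- the domain, a linear space of functions on `X` -/
  dom : Submodule ℝ (X → ℝ)
  /-- the form, defined on the domain only -/
  form : dom →ₗ[ℝ] dom →ₗ[ℝ] ℝ
  const_mem : ∀ a : ℝ, (fun _ => a) ∈ dom
  symm : ∀ u v : dom, form u v = form v u
  nonneg : ∀ u : dom, 0 ≤ form u u
  eq_zero_iff : ∀ u : dom, form u u = 0 ↔ ∀ x y, u.1 x = u.1 y
  /-- the domain modulo constants is complete -/
  complete : ∀ us : ℕ → dom,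
    (∀ ε > 0, ∃ n₀, ∀ m ≥ n₀, ∀ n ≥ n₀, form (us m - us n) (us m - us n) < ε) →
      ∃ u : dom, Tendsto (fun n => form (us n - u) (us n - u)) atTop (𝓝 0)
  separates : ∀ x y, x ≠ y → ∃ u : dom, u.1 x ≠ u.1 y
  /-- the supremum defining the effective resistance between `x` and `y` is finite -/
  resistance_finite : ∀ x y, ∃ M : ℝ, ∀ u : dom, 0 < form u u →
    |u.1 x - u.1 y| ^ 2 / form u u ≤ M
  /-- the unit contraction operates on the form -/
  markov : ∀ u : dom, ∃ h : (fun x => min (max 0 (u.1 x)) 1) ∈ dom,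
    form ⟨_, h⟩ ⟨_, h⟩ ≤ form u u

namespace ResistanceForm

variable {X : Type*} (E : ResistanceForm X)

open Classical in
/-- The value `E(u, v)`, for functions `u, v` in the domain
(with the value `0` if one of them is not in the domain). -/
noncomputable def energy (u v : X → ℝ) : ℝ :=
  if h : u ∈ E.dom ∧ v ∈ E.dom then E.form ⟨u, h.1⟩ ⟨v, h.2⟩ else 0

/-- The effective resistance `R(x, y)`. -/
noncomputable def resistance (x y : X) : ℝ :=
  sSup {t : ℝ | ∃ u : E.dom, 0 < E.form u u ∧ t = |u.1 x - u.1 y| ^ 2 / E.form u u}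

/-- The topology of the resistance metric. -/
@[reducible] def topology : TopologicalSpace X where
  IsOpen U := ∀ x ∈ U, ∃ ε > 0, ∀ y, E.resistance x y < ε → y ∈ U
  isOpen_univ := fun _ _ => ⟨1, one_pos, fun _ _ => mem_univ _⟩
  isOpen_inter := by
    rintro U V hU hV x ⟨hxU, hxV⟩
    obtain ⟨ε, hε, h₁⟩ := hU x hxU
    obtain ⟨δ, hδ, h₂⟩ := hV x hxV
    exact ⟨min ε δ, lt_min hε hδ, fun y hy =>
      ⟨h₁ y (hy.trans_le (min_le_left _ _)), h₂ y (hy.trans_le (min_le_right _ _))⟩⟩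
  isOpen_sUnion := by
    rintro 𝒰 h𝒰 x ⟨U, hU, hx⟩
    obtain ⟨ε, hε, h⟩ := h𝒰 U hU x hx
    exact ⟨ε, hε, fun y hy => ⟨U, hU, h y hy⟩⟩

/-- Locality: `E(u, v) = 0` whenever the supports of `u` and `v` (closures taken in the
resistance metric) have positive resistance distance. -/
def IsLocal : Prop :=
  letI := E.topology
  ∀ u v : E.dom,
    (∃ ε > 0, ∀ x ∈ tsupport u.1, ∀ y ∈ tsupport v.1, ε ≤ E.resistance x y) →
      E.form u v = 0

/-- Regularity: `X` with the resistance metric is locally compact and the functions of the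
domain with compact support are uniformly dense in the continuous functions with compact
support. -/
def IsRegular : Prop :=
  letI := E.topology
  LocallyCompactSpace X ∧
    ∀ f : X → ℝ, Continuous f → HasCompactSupport f → ∀ ε > 0,
      ∃ u : E.dom, Continuous u.1 ∧ HasCompactSupport u.1 ∧ ∀ x, |f x - u.1 x| < ε

end ResistanceForm

/-! ### Post-critically finite self-similar sets and harmonic structures -/

/-- A (connected, non-degenerate) post-critically finite self-similar set in the plane, with its
self-similar structure: finitely many continuous injections of the set into itself and a
continuous surjective coding map from the space of infinite words that intertwines them with the
shifts. -/
structure PCFSet where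
  carrier : Set Plane
  isConnected : IsConnected carrier
  nontrivial : carrier.Nontrivial
  /-- the number of maps -/
  N : ℕ
  map : Fin N → carrier → carrier
  map_continuous : ∀ i, Continuous (map i)
  map_injective : ∀ i, Function.Injective (map i)
  coding : (ℕ → Fin N) → carrier
  coding_continuous : Continuous coding
  coding_surjective : Function.Surjective coding
  coding_cons : ∀ i ω, coding (consWord i ω) = map i (coding ω)
  /-- the boundary `V₀` -/
  boundary : Finset carrier
  /-- the post-critical set, that is, the set of all `σⁿ ω` with `n ≥ 1` and `ω` a code of a
  point that lies in two different first level cells, is finite -/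
  postcritical_finite : {τ : ℕ → Fin N | ∃ ω : ℕ → Fin N, ∃ i j, i ≠ j ∧
    coding ω ∈ range (map i) ∧ coding ω ∈ range (map j) ∧
      ∃ n, 1 ≤ n ∧ τ = fun k => ω (k + n)}.Finite
  /-- the boundary is the image of the post-critical set under the coding map -/
  coe_boundary : (boundary : Set carrier) =
    coding '' {τ : ℕ → Fin N | ∃ ω : ℕ → Fin N, ∃ i j, i ≠ j ∧
      coding ω ∈ range (map i) ∧ coding ω ∈ range (map j) ∧
        ∃ n, 1 ≤ n ∧ τ = fun k => ω (k + n)}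

/-- `D` is a Laplacian on the finite set `V`: symmetric, with non-negative off-diagonal entries
and vanishing row sums, and with only the constants in its kernel. -/
structure IsLaplacian {V : Type*} [Fintype V] (D : Matrix V V ℝ) : Prop where
  symm : D.IsSymm
  offDiag_nonneg : ∀ p q, p ≠ q → 0 ≤ D p q
  row_sum : ∀ p, ∑ q, D p q = 0
  ker : ∀ f : V → ℝ, D.mulVec f = 0 → ∀ p q, f p = f q

namespace PCFSet

variable (K : PCFSet)

/-- The boundary as a subset of the plane. -/
def boundarySet : Set Plane := Subtype.val '' (K.boundary : Set K.carrier)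

/-- The graph energy `E_n(u, v) = ∑_{|w| = n} ρ_w⁻¹ E_0(u ∘ F_w, v ∘ F_w)` of level `n`, where
`E_0(f, g) = - fᵀ D g` on the boundary; it depends only on the values of `u` and `v` on `V_n`. -/
noncomputable def levelEnergy (D : Matrix K.boundary K.boundary ℝ) (ρ : Fin K.N → ℝ) (n : ℕ)
    (u v : K.carrier → ℝ) : ℝ :=
  ∑ w : Fin n → Fin K.N, (∏ k, ρ (w k))⁻¹ *
    -(dotProduct (fun p : K.boundary => u (wordMap K.map n w p.1))
        (D.mulVec fun p : K.boundary => v (wordMap K.map n w p.1)))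

/-- `(D, ρ)` is a harmonic structure: the weights are positive and the trace on the boundary of
the first level graph energy is the graph energy of level zero. -/
structure IsHarmonicStructure (D : Matrix K.boundary K.boundary ℝ) (ρ : Fin K.N → ℝ) : Prop where
  laplacian : IsLaplacian D
  weight_pos : ∀ i, 0 < ρ i
  trace_eq : ∀ f : K.carrier → ℝ,
    IsLeast {t | ∃ u : K.carrier → ℝ, (∀ p ∈ K.boundary, u p = f p) ∧
      t = K.levelEnergy D ρ 1 u u} (K.levelEnergy D ρ 0 f f)

/-- A harmonic structure is regular if all weights are smaller than one. -/
structure IsRegularHarmonicStructure (D : Matrix K.boundary K.boundary ℝ) (ρ : Fin K.N → ℝ) :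
    Prop extends K.IsHarmonicStructure D ρ where
  weight_lt_one : ∀ i, ρ i < 1

/-- The domain of the self-similar energy: the continuous functions of finite energy. -/
def domain (D : Matrix K.boundary K.boundary ℝ) (ρ : Fin K.N → ℝ) : Set (K.carrier → ℝ) :=
  {u | Continuous u ∧ BddAbove (range fun n => K.levelEnergy D ρ n u u)}

/-- The self-similar energy, the limit of the graph energies. -/
noncomputable def energy (D : Matrix K.boundary K.boundary ℝ) (ρ : Fin K.N → ℝ)
    (u v : K.carrier → ℝ) : ℝ :=
  limUnder atTop fun n => K.levelEnergy D ρ n u v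

end PCFSet

/-! ### Sierpinski-like fractals and hybrids -/

/-- A Sierpinski-like fractal: a p.c.f. self-similar set generated by similarities of the plane
with a common ratio, whose boundary consists of three points, each of them the fixed point of one
of the similarities, and which is invariant under a group of homeomorphisms isomorphic to the
dihedral group of order six that acts on the boundary by permutations and maps cells to cells. -/
structure SierpinskiLike extends PCFSet where
  ratio : ℝ
  ratio_pos : 0 < ratio
  ratio_lt_one : ratio < 1
  /-- the generating similarities -/
  sim : Fin N → Plane → Plane
  dist_sim : ∀ i x y, dist (sim i x) (sim i y) = ratio * dist x y
  map_eq_sim : ∀ i x, (map i x : Plane) = sim i x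
  fixedPt : Fin N → Plane
  sim_fixedPt : ∀ i, sim i (fixedPt i) = fixedPt i
  boundary_card : boundary.card = 3
  boundary_fixed : ∀ p ∈ boundary, ∃ i, (p : Plane) = fixedPt i
  dihedral_symm : ∃ G : Subgroup (carrier ≃ₜ carrier),
    Nonempty (G ≃* DihedralGroup 3) ∧
    (∀ g ∈ G, ∀ p ∈ boundary, g p ∈ boundary) ∧
    (∀ g ∈ G, (∀ p ∈ boundary, g p = p) → g = 1) ∧
    (∀ g ∈ G, ∀ (n : ℕ) (w : Fin n → Fin N), ∃ w' : Fin n → Fin N,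
      g '' range (wordMap map n w) = range (wordMap map n w'))

namespace SierpinskiLike

variable (K : SierpinskiLike)

open Classical in
/-- The symmetric Laplacian on the boundary, with diagonal entries `-2` and off-diagonal
entries `1`. -/
noncomputable def symmLaplacian : Matrix K.boundary K.boundary ℝ :=
  fun p q => if p = q then -2 else 1

/-- The similarity obtained from the `i`-th generating similarity by replacing its ratio by `c`:
the fixed point and the orthogonal part are kept. -/
noncomputable def shrunkSim (c : ℝ) (i : Fin K.N) (x : Plane) : Plane :=
  K.fixedPt i + (c / K.ratio) • (K.sim i x - K.fixedPt i)

end SierpinskiLike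

/-- `H` is the hybrid fractal with base `K`, contraction ratio `c` and bonds `bond b`, `b ∈ B`,
where the bond `b` is attached to the first level cells with index in `att b`. (If the bonds are
indexed by pairs `(i, j)`, then `att (i, j) = {i, j}`.) -/
structure IsHybrid (K : SierpinskiLike) (c : ℝ) {B : Type*} (bond : B → PCFSet)
    (att : B → Finset (Fin K.N)) (H : Set Plane) : Prop where
  nonempty : H.Nonempty
  isCompact : IsCompact H
  eq_union : H = (⋃ i, K.shrunkSim c i '' H) ∪ ⋃ b, (bond b).carrier
  /-- the boundary of a bond consists of its common points with the vertices of the cells that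
  it is attached to -/
  bond_boundary : ∀ b, (bond b).boundarySet =
    (bond b).carrier ∩ ⋃ i ∈ att b, K.shrunkSim c i '' K.boundarySet
  /-- the cells do not meet -/
  cell_disjoint : ∀ i j, i ≠ j → Disjoint (K.shrunkSim c i '' H) (K.shrunkSim c j '' H)
  /-- bonds meet cells only at common boundary points -/
  bond_inter_cell : ∀ b i, (bond b).carrier ∩ K.shrunkSim c i '' H ⊆
    (bond b).boundarySet ∩ K.shrunkSim c i '' K.boundarySet
  /-- bonds meet each other only at common boundary points -/
  bond_inter_bond : ∀ b b', b ≠ b' → (bond b).carrier ∩ (bond b').carrier ⊆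
    (bond b).boundarySet ∩ (bond b').boundarySet
  /-- the bonds replace the junction points of the base: two vertices of cells that coincide in
  the base are joined by bonds in the hybrid -/
  junction : ∀ i j, ∀ p ∈ K.boundarySet, ∀ q ∈ K.boundarySet, K.sim i p = K.sim j q →
    Relation.ReflTransGen
      (fun x y => ∃ b, x ∈ (bond b).boundarySet ∧ y ∈ (bond b).boundarySet)
      (K.shrunkSim c i p) (K.shrunkSim c j q)

namespace IsHybrid

variable {K : SierpinskiLike} {c : ℝ} {B : Type*} {bond : B → PCFSet}
  {att : B → Finset (Fin K.N)} {H : Set Plane}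

/-- The map `φ_i` as a map of the hybrid into itself. -/
noncomputable def cellMap (h : IsHybrid K c bond att H) (i : Fin K.N) (x : H) : H :=
  ⟨K.shrunkSim c i x,
    h.eq_union.ge (Or.inl (mem_iUnion.2 ⟨i, mem_image_of_mem _ x.2⟩))⟩

/-- The inclusion of a bond into the hybrid. -/
def bondIncl (h : IsHybrid K c bond att H) (b : B) (x : (bond b).carrier) : H :=
  ⟨x, h.eq_union.ge (Or.inr (mem_iUnion.2 ⟨b, x.2⟩))⟩

/-- Graph-directed self-similarity, with scaling factor `r`, of a resistance form on the hybrid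
whose bonds carry the energies given by `D` and `ρ`: a function is in the domain if and only if
its restrictions to all cells and all bonds are in the respective domains, and the energy is the
sum of the scaled energies of these restrictions. -/
structure SelfSimilar [Fintype B] (h : IsHybrid K c bond att H)
    (D : ∀ b, Matrix (bond b).boundary (bond b).boundary ℝ) (ρ : ∀ b, Fin (bond b).N → ℝ)
    (r : ℝ) (E : ResistanceForm H) : Prop where
  mem_dom_iff : ∀ u : H → ℝ, u ∈ E.dom ↔
    (∀ i, u ∘ h.cellMap i ∈ E.dom) ∧ ∀ b, u ∘ h.bondIncl b ∈ (bond b).domain (D b) (ρ b)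
  energy_eq : ∀ u ∈ E.dom, ∀ v ∈ E.dom, E.energy u v =
    ∑ i, r⁻¹ * E.energy (u ∘ h.cellMap i) (v ∘ h.cellMap i) +
      ∑ b, (bond b).energy (D b) (ρ b) (u ∘ h.bondIncl b) (v ∘ h.bondIncl b)

/-- The functions in the domain that are constant on every `n`-cell `φ_α(H)`, `|α| = n`. -/
def cellConstant (h : IsHybrid K c bond att H) (E : ResistanceForm H) (n : ℕ) : Set (H → ℝ) :=
  {u | u ∈ E.dom ∧ ∀ (α : Fin n → Fin K.N) (x y : H),
    u (wordMap h.cellMap n α x) = u (wordMap h.cellMap n α y)}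

end IsHybrid

/-! Existence. The energy has to be the sum, over all words `α` and all bonds, of the bond energies
of `u ∘ φ_α` with weights `r ^ (-|α|)`. It is realised as the limit of the increasing graph energies
`graphForm`, so it is quadratic, contracts under Lipschitz maps of constant one and is lower
semicontinuous under pointwise convergence. The real issue is that it must control oscillations. In
the base, the energy on `V₀` is the trace of the level one energy with weight `rK`. In the hybrid
each junction point is split into several vertices joined by bonds, so its values differ by at most
a constant times the square root of the bond energy. Since `r < rK`, one can write `r⁻¹ = (1 + t)
rK⁻¹` with `t > 0`, and this slack absorbs the splitting (`exists_renormalisation_bound`). The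
constant multiplies the bond energy only, hence does not grow under iteration, and resistances
between vertices are bounded (`exists_vertex_bound`). As `r < rK ≤ 1`, the contributions of deeper
levels form a geometric series (`IsCellConst.exists_osc_bound`).

The graph energies do not see points that lie on no bond of any level, so the domain is taken to be
`closureDom`, the closure, uniformly and in energy, of the cellwise constant functions. By a
convexity argument (`mem_closureDom_of_bounded`) uniform approximation with bounded energies
suffices for membership. This makes the closure stable under contractions and under gluing
(`mem_closureDom_iff`). Its resistance metric induces the Euclidean topology, whence regularity;
locality holds because the cells of the approximating graphs have small resistance diameter.

Uniqueness. Self-similarity prescribes the energy of cellwise constant functions, and completeness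
puts their closure into the domain. Conversely, local compactness near a vertex fixed by a cell map,
transported by that map, bounds the resistance metric (`exists_resistance_bound`). Replacing a
function by constants on `n`-cells then creates errors of order `√r ^ n` at the vertices, which are
repaired on the bonds at summable cost (`SelfSimilar.mem_closureDom`). So the domain is the closure.
Cellwise constant functions carry no energy in deep cells; by approximation the remainder of the
bond series tends to zero for all functions, and the energy is that series
(`hasSum_bondLevelEnergy`). -/

/-! ### Monotone sequences of non-negative forms -/

/-- A sequence of non-negative symmetric bilinear forms that increases on the diagonal. -/
structure IsFormSeq {M : Type*} [AddCommGroup M] [Module ℝ M] (A : ℕ → M → M → ℝ) : Prop where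
  add_left : ∀ n u v w, A n (u + v) w = A n u w + A n v w
  smul_left : ∀ n (a : ℝ) u v, A n (a • u) v = a * A n u v
  symm : ∀ n u v, A n u v = A n v u
  nonneg : ∀ n u, 0 ≤ A n u u
  mono : ∀ n u, A n u u ≤ A (n + 1) u u

/-- The elements of bounded energy. -/
def formDom {M : Type*} (A : ℕ → M → M → ℝ) : Set M := {u | BddAbove (range fun n => A n u u)}

/-- The limit form. -/
noncomputable def formLim {M : Type*} (A : ℕ → M → M → ℝ) (u v : M) : ℝ :=
  limUnder atTop fun n => A n u v

namespace IsFormSeq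

variable {M : Type*} [AddCommGroup M] [Module ℝ M] {A : ℕ → M → M → ℝ} (hA : IsFormSeq A)
include hA

lemma monotone (u : M) : Monotone fun n => A n u u := monotone_nat_of_le_succ fun n => hA.mono n u

lemma add_right (n : ℕ) (u v w : M) : A n u (v + w) = A n u v + A n u w := by
  rw [hA.symm, hA.add_left, hA.symm n v, hA.symm n w]

lemma smul_right (n : ℕ) (a : ℝ) (u v : M) : A n u (a • v) = a * A n u v := by
  rw [hA.symm, hA.smul_left, hA.symm]

lemma neg_left (n : ℕ) (u v : M) : A n (-u) v = -A n u v := by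
  rw [← neg_one_smul ℝ u, hA.smul_left]; ring

lemma neg_right (n : ℕ) (u v : M) : A n u (-v) = -A n u v := by
  rw [hA.symm, hA.neg_left, hA.symm]

lemma diag_add (n : ℕ) (u v : M) :
    A n (u + v) (u + v) = A n u u + 2 * A n u v + A n v v := by
  rw [hA.add_left, hA.add_right, hA.add_right, hA.symm n v u]; ring

lemma diag_sub (n : ℕ) (u v : M) :
    A n (u - v) (u - v) = A n u u - 2 * A n u v + A n v v := by
  rw [sub_eq_add_neg, hA.diag_add, hA.neg_right, hA.neg_left, hA.neg_right]; ring

lemma diag_smul (n : ℕ) (a : ℝ) (u : M) : A n (a • u) (a • u) = a ^ 2 * A n u u := by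
  rw [hA.smul_left, hA.smul_right]; ring

/-- Young's inequality, from non-negativity at `t • u - v`. The free parameter keeps the factor of
the first term close to one; the renormalisation estimate spends the gap between `r` and `rK` on it.
-/
lemma diag_add_le (n : ℕ) (u v : M) {t : ℝ} (ht : 0 < t) :
    A n (u + v) (u + v) ≤ (1 + t) * A n u u + (1 + t⁻¹) * A n v v := by
  have h := hA.nonneg n (t • u - v)
  rw [hA.diag_sub, hA.diag_smul, hA.smul_left] at h
  rw [hA.diag_add]
  have h2 : 0 ≤ t⁻¹ * (t ^ 2 * A n u u - 2 * (t * A n u v) + A n v v) := by positivity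
  have h3 : t⁻¹ * (t ^ 2 * A n u u - 2 * (t * A n u v) + A n v v)
      = t * A n u u - 2 * A n u v + t⁻¹ * A n v v := by field_simp
  linarith

lemma add_mem {u v : M} (hu : u ∈ formDom A) (hv : v ∈ formDom A) : u + v ∈ formDom A := by
  obtain ⟨a, ha⟩ := hu
  obtain ⟨b, hb⟩ := hv
  refine ⟨2 * a + 2 * b, ?_⟩
  rintro _ ⟨n, rfl⟩
  have h1 := ha ⟨n, rfl⟩
  have h2 := hb ⟨n, rfl⟩
  have h3 := hA.diag_add_le n u v one_pos
  dsimp only at *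
  linarith

lemma smul_mem (a : ℝ) {u : M} (hu : u ∈ formDom A) : a • u ∈ formDom A := by
  obtain ⟨b, hb⟩ := hu
  refine ⟨a ^ 2 * b, ?_⟩
  rintro _ ⟨n, rfl⟩
  have h1 := hb ⟨n, rfl⟩
  dsimp only at *
  rw [hA.diag_smul]
  gcongr

lemma sub_mem {u v : M} (hu : u ∈ formDom A) (hv : v ∈ formDom A) : u - v ∈ formDom A := by
  have := hA.add_mem hu (hA.smul_mem (-1) hv)
  rwa [neg_one_smul, ← sub_eq_add_neg] at this

lemma tendsto_diag {u : M} (hu : u ∈ formDom A) :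
    Tendsto (fun n => A n u u) atTop (𝓝 (formLim A u u)) :=
  tendsto_nhds_limUnder ⟨_, tendsto_atTop_ciSup (hA.monotone u) hu⟩

/-- Only the diagonal is monotone; off the diagonal convergence follows by polarisation. -/
lemma tendsto {u v : M} (hu : u ∈ formDom A) (hv : v ∈ formDom A) :
    Tendsto (fun n => A n u v) atTop (𝓝 (formLim A u v)) := by
  refine tendsto_nhds_limUnder ⟨4⁻¹ * (formLim A (u + v) (u + v) - formLim A (u - v) (u - v)), ?_⟩
  have h := ((hA.tendsto_diag (hA.add_mem hu hv)).sub
    (hA.tendsto_diag (hA.sub_mem hu hv))).const_mul (4⁻¹ : ℝ)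
  refine h.congr fun n => ?_
  rw [hA.diag_add, hA.diag_sub]; ring

lemma le_lim {u : M} (hu : u ∈ formDom A) (n : ℕ) : A n u u ≤ formLim A u u :=
  (hA.monotone u).ge_of_tendsto (hA.tendsto_diag hu) n

lemma lim_le {u : M} {C : ℝ} (h : ∀ n, A n u u ≤ C) : u ∈ formDom A ∧ formLim A u u ≤ C := by
  have hu : u ∈ formDom A := ⟨C, by rintro _ ⟨n, rfl⟩; exact h n⟩
  exact ⟨hu, le_of_tendsto' (hA.tendsto_diag hu) h⟩

lemma lim_nonneg {u : M} (hu : u ∈ formDom A) : 0 ≤ formLim A u u :=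
  ge_of_tendsto' (hA.tendsto_diag hu) fun n => hA.nonneg n u

lemma lim_symm (u v : M) : formLim A u v = formLim A v u := by
  simp only [formLim, hA.symm _ u v]

lemma lim_add_left {u v w : M} (hu : u ∈ formDom A) (hv : v ∈ formDom A) (hw : w ∈ formDom A) :
    formLim A (u + v) w = formLim A u w + formLim A v w := by
  refine tendsto_nhds_unique (hA.tendsto (hA.add_mem hu hv) hw) ?_
  simpa only [hA.add_left] using (hA.tendsto hu hw).add (hA.tendsto hv hw)

lemma lim_smul_left (a : ℝ) {u v : M} (hu : u ∈ formDom A) (hv : v ∈ formDom A) :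
    formLim A (a • u) v = a * formLim A u v := by
  refine tendsto_nhds_unique (hA.tendsto (hA.smul_mem a hu) hv) ?_
  simpa only [hA.smul_left] using (hA.tendsto hu hv).const_mul a

lemma lim_smul (a : ℝ) {u : M} (hu : u ∈ formDom A) :
    formLim A (a • u) (a • u) = a ^ 2 * formLim A u u := by
  refine tendsto_nhds_unique (hA.tendsto_diag (hA.smul_mem a hu)) ?_
  simpa only [hA.diag_smul] using (hA.tendsto hu hu).const_mul (a ^ 2)

lemma lim_parallelogram {u v : M} (hu : u ∈ formDom A) (hv : v ∈ formDom A) :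
    formLim A (u + v) (u + v) + formLim A (u - v) (u - v)
      = 2 * (formLim A u u + formLim A v v) := by
  refine tendsto_nhds_unique ((hA.tendsto_diag (hA.add_mem hu hv)).add
    (hA.tendsto_diag (hA.sub_mem hu hv))) ?_
  refine (((hA.tendsto hu hu).add (hA.tendsto hv hv)).const_mul 2).congr fun n => ?_
  rw [hA.diag_add, hA.diag_sub]; ring

lemma lim_add_le {u v : M} (hu : u ∈ formDom A) (hv : v ∈ formDom A) :
    formLim A (u + v) (u + v) ≤ 2 * formLim A u u + 2 * formLim A v v := by
  have := hA.lim_parallelogram hu hv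
  have := hA.lim_nonneg (hA.sub_mem hu hv)
  linarith

lemma lim_sub_le {u v : M} (hu : u ∈ formDom A) (hv : v ∈ formDom A) :
    formLim A (u - v) (u - v) ≤ 2 * formLim A u u + 2 * formLim A v v := by
  have := hA.lim_parallelogram hu hv
  have := hA.lim_nonneg (hA.add_mem hu hv)
  linarith

end IsFormSeq

/-- The pointwise lower semicontinuity of the limit form. -/
lemma IsFormSeq.lim_le_of_tendsto {X : Type*} {A : ℕ → (X → ℝ) → (X → ℝ) → ℝ} (hA : IsFormSeq A)
    (hc : ∀ n (us : ℕ → X → ℝ) (u : X → ℝ), (∀ x, Tendsto (fun j => us j x) atTop (𝓝 (u x))) →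
      Tendsto (fun j => A n (us j) (us j)) atTop (𝓝 (A n u u)))
    {us : ℕ → X → ℝ} {u : X → ℝ} (hu : ∀ x, Tendsto (fun j => us j x) atTop (𝓝 (u x)))
    {C : ℝ} (h : ∀ j, us j ∈ formDom A) (hC : ∀ j, formLim A (us j) (us j) ≤ C) :
    u ∈ formDom A ∧ formLim A u u ≤ C :=
  -- The limit form is a supremum of functionals that are continuous for pointwise convergence.
  hA.lim_le fun n => le_of_tendsto' (hc n us u hu) fun j => (hA.le_lim (h j) n).trans (hC j)

/-! ### Laplacians on finite sets -/

namespace IsLaplacian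

variable {V : Type*} [Fintype V] {D : Matrix V V ℝ} (hD : IsLaplacian D)
include hD

lemma neg_dotProduct_eq (f g : V → ℝ) :
    -(dotProduct f (D.mulVec g)) = 2⁻¹ * ∑ p, ∑ q, D p q * ((f p - f q) * (g p - g q)) := by
  have h1 : ∑ p, ∑ q, D p q * (f p * g p) = 0 := by
    refine Finset.sum_eq_zero fun p _ => ?_
    rw [← Finset.sum_mul, hD.row_sum, zero_mul]
  have h2 : ∑ p, ∑ q, D p q * (f q * g q) = 0 := by
    rw [Finset.sum_comm]
    refine Finset.sum_eq_zero fun p _ => ?_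
    rw [← Finset.sum_mul]
    simp_rw [fun q => hD.symm.apply p q]
    rw [hD.row_sum, zero_mul]
  have h3 : ∑ p, ∑ q, D p q * (f p * g q) = dotProduct f (D.mulVec g) := by
    simp only [dotProduct, Matrix.mulVec, Finset.mul_sum]
    exact Finset.sum_congr rfl fun p _ => Finset.sum_congr rfl fun q _ => by ring
  have h4 : ∑ p, ∑ q, D p q * (f q * g p) = dotProduct f (D.mulVec g) := by
    rw [← h3, Finset.sum_comm]
    refine Finset.sum_congr rfl fun p _ => Finset.sum_congr rfl fun q _ => ?_
    rw [hD.symm.apply]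
  have : ∑ p, ∑ q, D p q * ((f p - f q) * (g p - g q))
      = ∑ p, ∑ q, D p q * (f p * g p) - ∑ p, ∑ q, D p q * (f p * g q)
        - ∑ p, ∑ q, D p q * (f q * g p) + ∑ p, ∑ q, D p q * (f q * g q) := by
    simp only [← Finset.sum_sub_distrib, ← Finset.sum_add_distrib]
    exact Finset.sum_congr rfl fun p _ => Finset.sum_congr rfl fun q _ => by ring
  rw [this, h1, h2, h3, h4]; ring

lemma term_nonneg (f : V → ℝ) (p q : V) : 0 ≤ D p q * ((f p - f q) * (f p - f q)) := by
  by_cases h : p = q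
  · simp [h]
  · exact mul_nonneg (hD.offDiag_nonneg p q h) (mul_self_nonneg _)

lemma term_le (f : V → ℝ) (p q : V) :
    D p q * ((f p - f q) * (f p - f q)) ≤ 2 * -(dotProduct f (D.mulVec f)) := by
  rw [hD.neg_dotProduct_eq, mul_inv_cancel_left₀ two_ne_zero]
  exact (Finset.single_le_sum (f := fun q => D p q * ((f p - f q) * (f p - f q)))
    (fun q _ => hD.term_nonneg f p q) (Finset.mem_univ q)).trans
    (Finset.single_le_sum (f := fun p => ∑ q, D p q * ((f p - f q) * (f p - f q)))
      (fun p _ => Finset.sum_nonneg fun q _ => hD.term_nonneg f p q) (Finset.mem_univ p))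

lemma form_nonneg (f : V → ℝ) : 0 ≤ -(dotProduct f (D.mulVec f)) := by
  rw [hD.neg_dotProduct_eq]
  exact mul_nonneg (by norm_num)
    (Finset.sum_nonneg fun p _ => Finset.sum_nonneg fun q _ => hD.term_nonneg f p q)

/-- The form is a combination of squared differences with non-negative coefficients. The Markov
property of all later energies originates here. -/
lemma form_mono {f g : V → ℝ} (h : ∀ p q, |f p - f q| ≤ |g p - g q|) :
    -(dotProduct f (D.mulVec f)) ≤ -(dotProduct g (D.mulVec g)) := by
  rw [hD.neg_dotProduct_eq, hD.neg_dotProduct_eq]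
  refine mul_le_mul_of_nonneg_left ?_ (by norm_num)
  refine Finset.sum_le_sum fun p _ => Finset.sum_le_sum fun q _ => ?_
  by_cases hpq : p = q
  · simp [hpq]
  · exact mul_le_mul_of_nonneg_left (abs_le_iff_mul_self_le.1 (h p q))
      (hD.offDiag_nonneg p q hpq)

lemma exists_form_le : ∃ C : ℝ, 0 < C ∧ ∀ (f : V → ℝ) (M : ℝ), (∀ p q, |f p - f q| ≤ M) →
    -(dotProduct f (D.mulVec f)) ≤ C * M ^ 2 := by
  refine ⟨1 + ∑ p, ∑ q, |D p q|, by positivity, fun f M hM => ?_⟩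
  have h : ∑ p, ∑ q, D p q * ((f p - f q) * (f p - f q)) ≤ (∑ p, ∑ q, |D p q|) * M ^ 2 := by
    simp only [Finset.sum_mul]
    refine Finset.sum_le_sum fun p _ => Finset.sum_le_sum fun q _ => ?_
    refine mul_le_mul (le_abs_self _) ?_ (mul_self_nonneg _) (abs_nonneg _)
    rw [← sq, ← sq_abs]
    exact pow_le_pow_left₀ (abs_nonneg _) (hM p q) 2
  have h0 : 0 ≤ (∑ p, ∑ q, |D p q|) * M ^ 2 := by positivity
  rw [hD.neg_dotProduct_eq]
  nlinarith [sq_nonneg M]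

/-- No positive entry connects the set of points reachable from `p` with its complement, so its
indicator lies in the kernel and is constant. -/
lemma reachable (p q : V) : Relation.ReflTransGen (fun p q => 0 < D p q) p q := by
  classical
  let A : Set V := {q | Relation.ReflTransGen (fun p q => 0 < D p q) p q}
  have key : D.mulVec (A.indicator 1) = 0 := by
    funext x
    simp only [Matrix.mulVec, dotProduct, Pi.zero_apply]
    by_cases hx : x ∈ A
    · rw [← hD.row_sum x]
      refine Finset.sum_congr rfl fun y _ => ?_
      by_cases hy : y ∈ A
      · simp [hy]
      · have hxy : x ≠ y := fun h => hy (h ▸ hx)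
        have : ¬ 0 < D x y := fun h => hy (Relation.ReflTransGen.tail hx h)
        have := hD.offDiag_nonneg x y hxy
        simp [hy]; linarith
    · refine Finset.sum_eq_zero fun y _ => ?_
      by_cases hy : y ∈ A
      · have hxy : x ≠ y := fun h => hx (h ▸ hy)
        have : ¬ 0 < D x y := fun h =>
          hx (Relation.ReflTransGen.tail hy (by rwa [hD.symm.apply]))
        have := hD.offDiag_nonneg x y hxy
        simp [hy]; linarith
      · simp [hy]
  have h := hD.ker _ key p q
  have hp : p ∈ A := Relation.ReflTransGen.refl
  by_contra hq
  have hq' : q ∉ A := hq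
  simp [hp, hq'] at h

/-- Differences are added along a path of positive entries. An edge costs `√(2 / D x y)`, where the
two undoes the factor one half in front of the double sum. -/
lemma poincare : ∃ C : ℝ, 0 < C ∧ ∀ (f : V → ℝ) (p q : V),
    |f p - f q| ≤ C * √(-(dotProduct f (D.mulVec f))) := by
  have key : ∀ p q : V, ∃ C : ℝ, 0 ≤ C ∧ ∀ f : V → ℝ,
      |f p - f q| ≤ C * √(-(dotProduct f (D.mulVec f))) := by
    intro p q
    induction hD.reachable p q with
    | refl => exact ⟨0, le_rfl, fun f => by simp⟩
    | @tail x y _ hxy ih =>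
      obtain ⟨C, hC, h⟩ := ih
      refine ⟨C + √(2 / D x y), by positivity, fun f => ?_⟩
      have h1 := h f
      have h2 := hD.term_le f x y
      have h3 : |f x - f y| ≤ √(2 / D x y) * √(-(dotProduct f (D.mulVec f))) := by
        rw [← Real.sqrt_mul (by positivity)]
        apply Real.abs_le_sqrt
        rw [div_mul_eq_mul_div, le_div_iff₀ hxy]
        linarith
      have h4 := abs_sub_le (f p) (f x) (f y)
      linarith
  choose C hC h using key
  refine ⟨1 + ∑ p, ∑ q, C p q, ?_, fun f p q => (h p q f).trans ?_⟩
  · have : 0 ≤ ∑ p, ∑ q, C p q := Finset.sum_nonneg fun p _ => Finset.sum_nonneg fun q _ => hC p q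
    linarith
  · refine mul_le_mul_of_nonneg_right ?_ (Real.sqrt_nonneg _)
    have h1 := Finset.single_le_sum (f := fun q => C p q) (fun q _ => hC p q) (Finset.mem_univ q)
    have h2 := Finset.single_le_sum (f := fun p => ∑ q, C p q)
      (fun p _ => Finset.sum_nonneg fun q _ => hC p q) (Finset.mem_univ p)
    linarith

end IsLaplacian

/-! ### Level energies -/

namespace PCFSet

variable {K : PCFSet} {D : Matrix K.boundary K.boundary ℝ} {ρ : Fin K.N → ℝ}

lemma levelEnergy_zero (D : Matrix K.boundary K.boundary ℝ) (ρ : Fin K.N → ℝ)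
    (u v : K.carrier → ℝ) : K.levelEnergy D ρ 0 u v =
      -(dotProduct (fun p : K.boundary => u p.1) (D.mulVec fun p : K.boundary => v p.1)) := by
  simp [levelEnergy, wordMap]

/-- The first letter belongs to the outermost map, so splitting it off restricts to first level
cells. Inductions on the level rest on this recursion. -/
lemma levelEnergy_succ (D : Matrix K.boundary K.boundary ℝ) (ρ : Fin K.N → ℝ) (n : ℕ)
    (u v : K.carrier → ℝ) : K.levelEnergy D ρ (n + 1) u v =
      ∑ i, (ρ i)⁻¹ * K.levelEnergy D ρ n (u ∘ K.map i) (v ∘ K.map i) := by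
  simp only [levelEnergy, Finset.mul_sum]
  rw [← (Fin.consEquiv fun _ => Fin K.N).sum_comp, Fintype.sum_prod_type]
  refine Finset.sum_congr rfl fun i _ => Finset.sum_congr rfl fun w _ => ?_
  simp only [Fin.consEquiv, wordMap, Fin.prod_univ_succ, mul_inv, mul_assoc, Function.comp_def,
    Equiv.coe_fn_mk, Fin.cons_zero, Fin.cons_succ]

lemma levelEnergy_congr {u v : K.carrier → ℝ}
    (huv : ∀ p ∈ K.boundary, u p = v p) :
    K.levelEnergy D ρ 0 u u = K.levelEnergy D ρ 0 v v := by
  have : (fun p : K.boundary => u p.1) = fun p : K.boundary => v p.1 :=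
    funext fun p => huv p.1 p.2
  rw [levelEnergy_zero, levelEnergy_zero, this]

namespace IsHarmonicStructure

variable (h : K.IsHarmonicStructure D ρ)
include h

lemma isFormSeq : IsFormSeq (K.levelEnergy D ρ) where
  add_left n := by
    induction n with
    | zero =>
      intro u v w
      simp only [levelEnergy_zero, h.laplacian.neg_dotProduct_eq, Pi.add_apply]
      rw [← mul_add, ← Finset.sum_add_distrib]
      simp_rw [← Finset.sum_add_distrib]
      congr 1
      exact Finset.sum_congr rfl fun p _ => Finset.sum_congr rfl fun q _ => by ring
    | succ n ih =>
      intro u v w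
      simp only [levelEnergy_succ]
      rw [← Finset.sum_add_distrib]
      refine Finset.sum_congr rfl fun i _ => ?_
      rw [← mul_add, ← ih]
      rfl
  smul_left n := by
    induction n with
    | zero =>
      intro a u v
      simp only [levelEnergy_zero, h.laplacian.neg_dotProduct_eq, Pi.smul_apply, smul_eq_mul]
      simp only [Finset.mul_sum]
      exact Finset.sum_congr rfl fun p _ => Finset.sum_congr rfl fun q _ => by ring
    | succ n ih =>
      intro a u v
      simp only [levelEnergy_succ, Finset.mul_sum]
      refine Finset.sum_congr rfl fun i _ => ?_
      rw [mul_left_comm a, ← ih a]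
      rfl
  symm n := by
    induction n with
    | zero =>
      intro u v
      simp only [levelEnergy_zero, h.laplacian.neg_dotProduct_eq]
      congr 1
      exact Finset.sum_congr rfl fun p _ => Finset.sum_congr rfl fun q _ => by ring
    | succ n ih =>
      intro u v
      simp only [levelEnergy_succ, ih (u ∘ _)]
  nonneg n := by
    induction n with
    | zero => intro u; rw [levelEnergy_zero]; exact h.laplacian.form_nonneg _
    | succ n ih =>
      intro u
      rw [levelEnergy_succ]
      exact Finset.sum_nonneg fun i _ => mul_nonneg (inv_nonneg.2 (h.weight_pos i).le) (ih _)
  mono n := by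
    induction n with
    -- `u` itself competes in the minimum of the trace condition; higher levels inherit the
    -- inequality cell by cell.
    | zero => intro u; exact (h.trace_eq u).2 ⟨u, fun _ _ => rfl, rfl⟩
    | succ n ih =>
      intro u
      rw [levelEnergy_succ, levelEnergy_succ]
      exact Finset.sum_le_sum fun i _ =>
        mul_le_mul_of_nonneg_left (ih _) (inv_nonneg.2 (h.weight_pos i).le)

lemma levelEnergy_contraction {φ : ℝ → ℝ} (hφ : ∀ a b, |φ a - φ b| ≤ |a - b|) (n : ℕ) :
    ∀ u : K.carrier → ℝ, K.levelEnergy D ρ n (φ ∘ u) (φ ∘ u) ≤ K.levelEnergy D ρ n u u := by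
  induction n with
  | zero =>
    intro u
    rw [levelEnergy_zero, levelEnergy_zero]
    exact h.laplacian.form_mono fun p q => hφ _ _
  | succ n ih =>
    intro u
    rw [levelEnergy_succ, levelEnergy_succ]
    exact Finset.sum_le_sum fun i _ =>
      mul_le_mul_of_nonneg_left (ih _) (inv_nonneg.2 (h.weight_pos i).le)

lemma levelEnergy_const (n : ℕ) : ∀ a : ℝ,
    K.levelEnergy D ρ n (fun _ => a) (fun _ => a) = 0 := by
  induction n with
  | zero => intro a; simp [levelEnergy_zero, h.laplacian.neg_dotProduct_eq]
  | succ n ih =>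
    intro a
    rw [levelEnergy_succ]
    exact Finset.sum_eq_zero fun i _ => by
      rw [show (fun _ : K.carrier => a) ∘ K.map i = fun _ => a from rfl, ih, mul_zero]

lemma levelEnergy_comp_le (n : ℕ) (i : Fin K.N) (u : K.carrier → ℝ) :
    K.levelEnergy D ρ n (u ∘ K.map i) (u ∘ K.map i) ≤ ρ i * K.levelEnergy D ρ (n + 1) u u := by
  rw [levelEnergy_succ, ← inv_mul_le_iff₀ (h.weight_pos i)]
  exact Finset.single_le_sum
    (f := fun i => (ρ i)⁻¹ * K.levelEnergy D ρ n (u ∘ K.map i) (u ∘ K.map i))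
    (fun i _ => mul_nonneg (inv_nonneg.2 (h.weight_pos i).le) (h.isFormSeq.nonneg _ _))
    (Finset.mem_univ i)

end IsHarmonicStructure

lemma tendsto_levelEnergy (D : Matrix K.boundary K.boundary ℝ) (ρ : Fin K.N → ℝ) (n : ℕ)
    (us : ℕ → K.carrier → ℝ) (u : K.carrier → ℝ)
    (hu : ∀ x, Tendsto (fun j => us j x) atTop (𝓝 (u x))) :
    Tendsto (fun j => K.levelEnergy D ρ n (us j) (us j)) atTop (𝓝 (K.levelEnergy D ρ n u u)) := by
  simp only [levelEnergy, dotProduct, Matrix.mulVec]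
  exact tendsto_finsetSum _ fun w _ => (tendsto_finsetSum _ fun p _ =>
    (hu _).mul (tendsto_finsetSum _ fun q _ => (hu _).const_mul _)).neg.const_mul _

end PCFSet

/-! ### Finite closed covers -/

/-- Off the closed range the implication is vacuous near `x`. Hence a local property can be checked
separately on the pieces of a finite closed cover, also at points common to several pieces. -/
lemma Topology.IsClosedEmbedding.eventually_range {X Y : Type*} [TopologicalSpace X]
    [TopologicalSpace Y] {f : Y → X} (hf : IsClosedEmbedding f) {P : X → X → Prop}
    (h : ∀ y, ∀ᶠ y' in 𝓝 y, P (f y) (f y')) (x : X) :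
    ∀ᶠ x' in 𝓝 x, x' ∈ range f → P x x' := by
  by_cases hx : x ∈ range f
  · obtain ⟨y, rfl⟩ := hx
    have := h y
    rw [hf.isInducing.nhds_eq_comap, eventually_comap] at this
    filter_upwards [this] with x' hx'
    rintro ⟨y', rfl⟩
    exact hx' y' rfl
  · filter_upwards [hf.isClosed_range.isOpen_compl.mem_nhds hx] with x' hx' h'
    exact absurd h' hx'

lemma continuous_real_iff_eventually {X : Type*} [TopologicalSpace X] {g : X → ℝ} :
    Continuous g ↔ ∀ ε > 0, ∀ x, ∀ᶠ x' in 𝓝 x, |g x - g x'| ≤ ε := by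
  rw [Metric.continuous_iff']
  constructor
  · intro h ε hε x
    filter_upwards [h x ε hε] with x' hx'
    rw [abs_sub_comm]; exact hx'.le
  · intro h x ε hε
    filter_upwards [h (ε / 2) (half_pos hε) x] with x' hx'
    rw [Real.dist_eq, abs_sub_comm]; linarith

lemma tendsto_of_forall_abs_sub_le {X : Type*} {us : ℕ → X → ℝ} {u : X → ℝ}
    (h : ∀ n x, |u x - us n x| ≤ 1 / ((n : ℝ) + 1)) (x : X) :
    Tendsto (fun n => us n x) atTop (𝓝 (u x)) := by
  rw [tendsto_iff_dist_tendsto_zero]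
  refine squeeze_zero (fun _ => dist_nonneg) (fun n => ?_) tendsto_one_div_add_atTop_nhds_zero_nat
  rw [dist_comm]
  exact h n x

lemma continuous_of_forall_approx {X : Type*} [TopologicalSpace X] {u : X → ℝ}
    (h : ∀ ε > 0, ∃ w : X → ℝ, Continuous w ∧ ∀ x, |u x - w x| ≤ ε) : Continuous u := by
  rw [continuous_real_iff_eventually]
  intro ε hε x
  obtain ⟨w, hw, hwu⟩ := h (ε / 3) (by positivity)
  filter_upwards [continuous_real_iff_eventually.1 hw (ε / 3) (by positivity) x] with y hy
  have h1 := hwu x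
  have h2 := hwu y
  rw [abs_le] at *
  constructor <;> linarith

lemma sqrt_le_mul_sqrt {a b t s : ℝ} (hs : 0 ≤ s) (hb : 0 ≤ b) (ht : t ≤ s ^ 2) (h : a ≤ t * b) :
    √a ≤ s * √b := by
  rw [show s * √b = √(s ^ 2 * b) by rw [Real.sqrt_mul (sq_nonneg _), Real.sqrt_sq hs]]
  exact Real.sqrt_le_sqrt (h.trans (mul_le_mul_of_nonneg_right ht hb))

/-! ### Codes, cells and connectedness of p.c.f. sets -/

namespace PCFSet

variable (K : PCFSet)

/-- The post-critical set. -/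
def postcritical : Set (ℕ → Fin K.N) :=
  {τ | ∃ ω : ℕ → Fin K.N, ∃ i j, i ≠ j ∧ K.coding ω ∈ range (K.map i) ∧
    K.coding ω ∈ range (K.map j) ∧ ∃ n, 1 ≤ n ∧ τ = fun k => ω (k + n)}

variable {K}

lemma consWord_shift {S : Type*} (ω : ℕ → S) : consWord (ω 0) (fun k => ω (k + 1)) = ω := by
  funext k; cases k <;> rfl

lemma coding_eq (ω : ℕ → Fin K.N) :
    K.coding ω = K.map (ω 0) (K.coding fun k => ω (k + 1)) := by
  rw [← K.coding_cons, consWord_shift]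

lemma mem_boundary {x : K.carrier} : x ∈ K.boundary ↔ ∃ τ ∈ K.postcritical, K.coding τ = x := by
  rw [← Finset.mem_coe, K.coe_boundary]; rfl

lemma postcritical_shift {τ : ℕ → Fin K.N} (hτ : τ ∈ K.postcritical) :
    (fun k => τ (k + 1)) ∈ K.postcritical := by
  obtain ⟨ω, i, j, hij, hi, hj, n, hn, rfl⟩ := hτ
  exact ⟨ω, i, j, hij, hi, hj, n + 1, by omega, funext fun k => congrArg ω (by omega)⟩

lemma shift_mem_postcritical {ω ω' : ℕ → Fin K.N} (h : K.coding ω = K.coding ω')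
    (h0 : ω 0 ≠ ω' 0) : (fun k => ω (k + 1)) ∈ K.postcritical :=
  ⟨ω, ω 0, ω' 0, h0, ⟨_, (coding_eq ω).symm⟩, ⟨_, by rw [h, ← coding_eq]⟩, 1, le_rfl, rfl⟩

/-- The common point has codes beginning with `i` and with `j`; removing the `i` leaves a
post-critical code of `x`. So distinct cells meet only in images of boundary points. -/
lemma mem_boundary_of_map_eq {i j : Fin K.N} (hij : i ≠ j) {x y : K.carrier}
    (h : K.map i x = K.map j y) : x ∈ K.boundary := by
  obtain ⟨ω, rfl⟩ := K.coding_surjective x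
  obtain ⟨ω', rfl⟩ := K.coding_surjective y
  rw [← K.coding_cons, ← K.coding_cons] at h
  exact mem_boundary.2 ⟨ω, shift_mem_postcritical h hij, rfl⟩

lemma exists_map_eq (x : K.carrier) : ∃ i y, K.map i y = x := by
  obtain ⟨ω, rfl⟩ := K.coding_surjective x
  exact ⟨_, _, (coding_eq ω).symm⟩

/-- The post-critical set is invariant under the shift, so boundary points are also vertices of
first level cells. -/
lemma exists_map_eq_of_mem_boundary {x : K.carrier} (hx : x ∈ K.boundary) :
    ∃ i, ∃ y ∈ K.boundary, K.map i y = x := by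
  obtain ⟨τ, hτ, rfl⟩ := mem_boundary.1 hx
  exact ⟨_, _, mem_boundary.2 ⟨_, postcritical_shift hτ, rfl⟩, (coding_eq τ).symm⟩

instance : CompactSpace K.carrier :=
  ⟨by rw [← K.coding_surjective.range_eq]; exact isCompact_range K.coding_continuous⟩

instance : ConnectedSpace K.carrier := isConnected_iff_connectedSpace.1 K.isConnected

lemma isClosedEmbedding_map (i : Fin K.N) : IsClosedEmbedding (K.map i) :=
  (K.map_continuous i).isClosedEmbedding (K.map_injective i)

lemma isQuotientMap_coding : IsQuotientMap K.coding :=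
  K.coding_continuous.isClosedMap.isQuotientMap K.coding_continuous K.coding_surjective

lemma eventually_of_cells {P : K.carrier → K.carrier → Prop}
    (h : ∀ i y, ∀ᶠ y' in 𝓝 y, P (K.map i y) (K.map i y')) (x : K.carrier) :
    ∀ᶠ x' in 𝓝 x, P x x' := by
  have := eventually_all.2 fun i => (isClosedEmbedding_map (K := K) i).eventually_range (h i) x
  filter_upwards [this] with x' hx'
  obtain ⟨i, y, hy⟩ := exists_map_eq x'
  exact hx' i ⟨y, hy⟩

lemma continuous_of_cells {u : K.carrier → ℝ} (h : ∀ i, Continuous (u ∘ K.map i)) :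
    Continuous u := by
  rw [continuous_real_iff_eventually]
  intro ε hε
  exact eventually_of_cells fun i => continuous_real_iff_eventually.1 (h i) ε hε

/-- Two cells are adjacent if they have images of boundary points in common. -/
def Adj (K : PCFSet) (i j : Fin K.N) : Prop :=
  ∃ p ∈ K.boundary, ∃ q ∈ K.boundary, K.map i p = K.map j q

/-- Otherwise the cells reachable from `i` and the remaining ones form two non-empty closed sets
covering a connected space. They have a common point, and there two cells are adjacent. -/
lemma reachable (i j : Fin K.N) : Relation.ReflTransGen K.Adj i j := by
  classical
  by_contra hj
  let T : Set (Fin K.N) := {k | Relation.ReflTransGen K.Adj i k}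
  have hcl : ∀ S : Set (Fin K.N), IsClosed (⋃ k ∈ S, range (K.map k)) := fun S =>
    S.toFinite.isClosed_biUnion fun k _ => (isClosedEmbedding_map k).isClosed_range
  obtain ⟨x₀⟩ : Nonempty K.carrier := inferInstance
  obtain ⟨x, -, hx1, hx2⟩ := isPreconnected_closed_iff.1
    (isPreconnected_univ (α := K.carrier)) _ _ (hcl T) (hcl Tᶜ)
    (fun x _ => by
      obtain ⟨k, y, rfl⟩ := exists_map_eq x
      by_cases hk : k ∈ T
      · exact Or.inl (mem_biUnion hk ⟨y, rfl⟩)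
      · exact Or.inr (mem_biUnion (show k ∈ Tᶜ from hk) ⟨y, rfl⟩))
    ⟨K.map i x₀, trivial, mem_biUnion (show i ∈ T from Relation.ReflTransGen.refl) ⟨x₀, rfl⟩⟩
    ⟨K.map j x₀, trivial, mem_biUnion (show j ∈ Tᶜ from hj) ⟨x₀, rfl⟩⟩
  obtain ⟨k, hk, y, rfl⟩ := mem_iUnion₂.1 hx1
  obtain ⟨l, hl, z, hz⟩ := mem_iUnion₂.1 hx2
  have hkl : k ≠ l := fun h => hl (h ▸ hk)
  exact hl (Relation.ReflTransGen.tail hk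
    ⟨y, mem_boundary_of_map_eq hkl hz.symm, z, mem_boundary_of_map_eq hkl.symm hz, hz.symm⟩)

/-- Codes of two distinct points differ in some letter, so there are two different cells; the first
step of a chain between them exhibits a boundary point. -/
lemma boundary_nonempty : K.boundary.Nonempty := by
  obtain ⟨x, hx, y, hy, hxy⟩ := K.nontrivial
  obtain ⟨ω, hω⟩ := K.coding_surjective ⟨x, hx⟩
  obtain ⟨ω', hω'⟩ := K.coding_surjective ⟨y, hy⟩
  have : ω ≠ ω' := by
    rintro rfl
    exact hxy (congrArg Subtype.val (hω.symm.trans hω'))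
  obtain ⟨n, hn⟩ := Function.ne_iff.1 this
  rcases Relation.ReflTransGen.cases_head (reachable (ω n) (ω' n)) with h | ⟨c, ⟨p, hp, _⟩, _⟩
  · exact absurd h hn
  · exact ⟨p, hp⟩

instance : Nonempty (Fin K.N) := by
  obtain ⟨x⟩ : Nonempty K.carrier := inferInstance
  exact ⟨(exists_map_eq x).choose⟩

/-- The words on whose `n`-cylinder `f ∘ coding` oscillates by at most `ε` form an open set
increasing with `n`; these sets exhaust the compact space of words. -/
lemma exists_prefix_uniform {f : K.carrier → ℝ} (hf : Continuous f) {ε : ℝ} (hε : 0 < ε) :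
    ∃ n, ∀ ω ω' : ℕ → Fin K.N, (∀ k < n, ω k = ω' k) →
      |f (K.coding ω) - f (K.coding ω')| ≤ ε := by
  let U : ℕ → Set (ℕ → Fin K.N) := fun n => {τ | ∀ ω ω' : ℕ → Fin K.N, (∀ k < n, τ k = ω k) →
    (∀ k < n, τ k = ω' k) → |f (K.coding ω) - f (K.coding ω')| ≤ ε}
  have hcyl : ∀ (n : ℕ) (τ : ℕ → Fin K.N), {τ' | ∀ k < n, τ k = τ' k} ∈ 𝓝 τ := by
    intro n τ
    have := PiNat.isOpen_cylinder (fun _ => Fin K.N) τ n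
    refine mem_of_superset (this.mem_nhds (PiNat.self_mem_cylinder τ n)) fun τ' h k hk => ?_
    exact (h k hk).symm
  have hU : ∀ n, IsOpen (U n) := by
    intro n
    rw [isOpen_iff_mem_nhds]
    intro τ hτ
    filter_upwards [hcyl n τ] with τ' hτ' ω ω' h h'
    exact hτ ω ω' (fun k hk => (hτ' k hk).trans (h k hk)) fun k hk => (hτ' k hk).trans (h' k hk)
  have hmono : Monotone U := fun m n hmn τ hτ ω ω' h h' =>
    hτ ω ω' (fun k hk => h k (hk.trans_le hmn)) fun k hk => h' k (hk.trans_le hmn)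
  have hcov : (univ : Set (ℕ → Fin K.N)) ⊆ ⋃ n, U n := by
    intro τ _
    have hc := continuous_real_iff_eventually.1 (hf.comp K.coding_continuous) (ε / 2)
      (half_pos hε) τ
    obtain ⟨v, ⟨x, n, rfl⟩, hτv, hv⟩ :=
      (PiNat.isTopologicalBasis_cylinders fun _ => Fin K.N).mem_nhds_iff.1 hc
    refine mem_iUnion.2 ⟨n, fun ω ω' h h' => ?_⟩
    have key : ∀ ω : ℕ → Fin K.N, (∀ k < n, τ k = ω k) →
        |f (K.coding τ) - f (K.coding ω)| ≤ ε / 2 := fun ω h =>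
      hv fun k hk => (h k hk).symm.trans (hτv k hk)
    have h1 := key ω h
    have h2 := key ω' h'
    rw [abs_le] at *
    constructor <;> linarith
  obtain ⟨n, hn⟩ := isCompact_univ.elim_directed_cover U hU hcov hmono.directed_le
  exact ⟨n, fun ω ω' h => hn (mem_univ ω) ω ω' (fun _ _ => rfl) h⟩

variable {D : Matrix K.boundary K.boundary ℝ} {ρ : Fin K.N → ℝ}

lemma energy_eq_formLim (u v : K.carrier → ℝ) :
    K.energy D ρ u v = formLim (K.levelEnergy D ρ) u v := rfl

namespace IsHarmonicStructure

variable (h : K.IsHarmonicStructure D ρ)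
include h

lemma energy_nonneg {u : K.carrier → ℝ} (hu : u ∈ K.domain D ρ) : 0 ≤ K.energy D ρ u u :=
  h.isFormSeq.lim_nonneg hu.2

lemma add_mem {u v : K.carrier → ℝ} (hu : u ∈ K.domain D ρ) (hv : v ∈ K.domain D ρ) :
    u + v ∈ K.domain D ρ := ⟨hu.1.add hv.1, h.isFormSeq.add_mem hu.2 hv.2⟩

lemma smul_mem (a : ℝ) {u : K.carrier → ℝ} (hu : u ∈ K.domain D ρ) :
    a • u ∈ K.domain D ρ := ⟨hu.1.const_smul a, h.isFormSeq.smul_mem a hu.2⟩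

lemma const_mem (a : ℝ) : (fun _ => a) ∈ K.domain D ρ :=
  ⟨continuous_const, 0, by rintro _ ⟨n, rfl⟩; exact (h.levelEnergy_const n a).le⟩

lemma energy_const (a : ℝ) : K.energy D ρ (fun _ => a) (fun _ => a) = 0 :=
  tendsto_nhds_unique (h.isFormSeq.tendsto_diag (h.const_mem a).2)
    (by simp only [h.levelEnergy_const]; exact tendsto_const_nhds)

lemma contraction_mem {φ : ℝ → ℝ} (hc : Continuous φ) (hφ : ∀ a b, |φ a - φ b| ≤ |a - b|)
    {u : K.carrier → ℝ} (hu : u ∈ K.domain D ρ) : φ ∘ u ∈ K.domain D ρ :=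
  ⟨hc.comp hu.1, (h.isFormSeq.lim_le fun n =>
    (h.levelEnergy_contraction hφ n u).trans (h.isFormSeq.le_lim hu.2 n)).1⟩

lemma comp_map {u : K.carrier → ℝ} (hu : u ∈ K.domain D ρ) (i : Fin K.N) :
    u ∘ K.map i ∈ K.domain D ρ ∧
      K.energy D ρ (u ∘ K.map i) (u ∘ K.map i) ≤ ρ i * K.energy D ρ u u := by
  have := h.isFormSeq.lim_le (u := u ∘ K.map i) (C := ρ i * K.energy D ρ u u) fun n =>
    (h.levelEnergy_comp_le n i u).trans
      (mul_le_mul_of_nonneg_left (h.isFormSeq.le_lim hu.2 _) (h.weight_pos i).le)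
  exact ⟨⟨hu.1.comp (K.map_continuous i), this.1⟩, this.2⟩

/-- A bound for the resistances in the graph of level one. -/
lemma exists_level_one_bound : ∃ C : ℝ, 0 < C ∧ ∀ (u : K.carrier → ℝ) (i j : Fin K.N),
    ∀ p ∈ K.boundary, ∀ q ∈ K.boundary,
      |u (K.map i p) - u (K.map j q)| ≤ C * √(K.levelEnergy D ρ 1 u u) := by
  obtain ⟨C₀, hC₀, hP⟩ := h.laplacian.poincare
  have hcell : ∀ i (u : K.carrier → ℝ), ∀ p ∈ K.boundary, ∀ q ∈ K.boundary,
      |u (K.map i p) - u (K.map i q)| ≤ C₀ * √(ρ i) * √(K.levelEnergy D ρ 1 u u) := by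
    intro i u p hp q hq
    have h1 := hP (fun p : K.boundary => (u ∘ K.map i) p.1) ⟨p, hp⟩ ⟨q, hq⟩
    rw [← levelEnergy_zero D ρ] at h1
    refine h1.trans ?_
    rw [mul_assoc, ← Real.sqrt_mul (h.weight_pos i).le]
    exact mul_le_mul_of_nonneg_left (Real.sqrt_le_sqrt (h.levelEnergy_comp_le 0 i u)) hC₀.le
  -- Along a chain of adjacent cells neighbours share a vertex, so each new cell only adds the cost
  -- of crossing it.
  have key : ∀ i j, ∃ C : ℝ, 0 ≤ C ∧ ∀ u : K.carrier → ℝ, ∀ p ∈ K.boundary, ∀ q ∈ K.boundary,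
      |u (K.map i p) - u (K.map j q)| ≤ C * √(K.levelEnergy D ρ 1 u u) := by
    intro i j
    induction reachable i j with
    | refl => exact ⟨C₀ * √(ρ i), by positivity, fun u p hp q hq => hcell i u p hp q hq⟩
    | @tail k l _ hkl ih =>
      obtain ⟨C, hC, hu⟩ := ih
      obtain ⟨p', hp', q', hq', heq⟩ := hkl
      refine ⟨C + C₀ * √(ρ l), by positivity, fun u p hp q hq => ?_⟩
      have h1 := hu u p hp p' hp'
      have h2 := hcell l u q' hq' q hq
      rw [heq] at h1
      have h3 := abs_sub_le (u (K.map i p)) (u (K.map l q')) (u (K.map l q))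
      linarith
  choose C hC hu using key
  have hs : 0 ≤ ∑ i, ∑ j, C i j := Finset.sum_nonneg fun i _ => Finset.sum_nonneg fun j _ => hC i j
  refine ⟨1 + ∑ i, ∑ j, C i j, by linarith, fun u i j p hp q hq =>
    (hu i j u p hp q hq).trans (mul_le_mul_of_nonneg_right ?_ (Real.sqrt_nonneg _))⟩
  have h1 := Finset.single_le_sum (f := fun j => C i j) (fun j _ => hC i j) (Finset.mem_univ j)
  have h2 := Finset.single_le_sum (f := fun i => ∑ j, C i j)
    (fun i _ => Finset.sum_nonneg fun j _ => hC i j) (Finset.mem_univ i)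
  linarith

end IsHarmonicStructure

/-- The coding map sees the beginning of a word through the cell maps. -/
lemma coding_append (n : ℕ) : ∀ (ω τ : ℕ → Fin K.N),
    ∃ ω' : ℕ → Fin K.N, (∀ k < n, ω k = ω' k) ∧
      K.coding ω' = wordMap K.map n (fun k => ω k) (K.coding τ) := by
  induction n with
  | zero => intro ω τ; exact ⟨τ, by simp, rfl⟩
  | succ n ih =>
    intro ω τ
    obtain ⟨ω', h1, h2⟩ := ih (fun k => ω (k + 1)) τ
    refine ⟨consWord (ω 0) ω', ?_, ?_⟩
    · rintro (_ | k) hk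
      · rfl
      · exact h1 k (by omega)
    · rw [K.coding_cons, h2]; rfl

lemma exists_wordMap_near {u : K.carrier → ℝ} (hu : Continuous u) (x p : K.carrier) {ε : ℝ}
    (hε : 0 < ε) : ∃ (n : ℕ) (w : Fin n → Fin K.N), |u x - u (wordMap K.map n w p)| ≤ ε := by
  obtain ⟨n, hn⟩ := exists_prefix_uniform hu hε
  obtain ⟨ω, rfl⟩ := K.coding_surjective x
  obtain ⟨τ, rfl⟩ := K.coding_surjective p
  obtain ⟨ω', h1, h2⟩ := coding_append n ω τ
  exact ⟨n, fun k => ω k, by rw [← h2]; exact hn ω ω' h1⟩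

lemma exists_level_uniform {f : K.carrier → ℝ} (hf : Continuous f) {ε : ℝ} (hε : 0 < ε) :
    ∃ n, ∀ (w : Fin n → Fin K.N) (x y : K.carrier),
      |f (wordMap K.map n w x) - f (wordMap K.map n w y)| ≤ ε := by
  obtain ⟨n, hn⟩ := exists_prefix_uniform hf hε
  refine ⟨n, fun w x y => ?_⟩
  obtain ⟨τ, rfl⟩ := K.coding_surjective x
  obtain ⟨τ', rfl⟩ := K.coding_surjective y
  -- An infinite word is needed, but only its first `n` letters matter; the rest is arbitrary.
  let ω : ℕ → Fin K.N := fun k => if h : k < n then w ⟨k, h⟩ else Classical.arbitrary _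
  have hω : (fun k : Fin n => ω k) = w := funext fun k => by simp [ω]
  obtain ⟨ω₁, h1, h2⟩ := coding_append n ω τ
  obtain ⟨ω₂, h3, h4⟩ := coding_append n ω τ'
  rw [hω] at h2 h4
  rw [← h2, ← h4]
  exact hn _ _ fun k hk => (h1 k hk).symm.trans (h3 k hk)

/-! ### Resistance estimates for regular harmonic structures -/

namespace IsRegularHarmonicStructure

variable (h : K.IsRegularHarmonicStructure D ρ)
include h

/-- Oscillations scale like square roots of energies, so `s` is the factor gained per level. -/
lemma exists_ratio : ∃ s : ℝ, 0 < s ∧ s < 1 ∧ ∀ i, ρ i ≤ s ^ 2 := by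
  obtain ⟨i, hi⟩ := Finite.exists_max ρ
  refine ⟨√(ρ i), Real.sqrt_pos.2 (h.weight_pos i), ?_, fun j => ?_⟩
  · rw [Real.sqrt_lt' one_pos]; simpa using h.weight_lt_one i
  · rw [Real.sq_sqrt (h.weight_pos i).le]; exact hi j

/-- The resistance estimate: the oscillation is bounded by the energy. -/
lemma exists_osc_bound : ∃ C : ℝ, 0 < C ∧ ∀ u ∈ K.domain D ρ, ∀ x y,
    |u x - u y| ≤ C * √(K.energy D ρ u u) := by
  obtain ⟨s, hs0, hs1, hs⟩ := h.exists_ratio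
  obtain ⟨C₁, hC₁, hb⟩ := h.exists_level_one_bound
  obtain ⟨p₀, hp₀⟩ := K.boundary_nonempty
  obtain ⟨i₀, q₀, hq₀, rfl⟩ := exists_map_eq_of_mem_boundary hp₀
  set p₀ := K.map i₀ q₀
  -- The sum of a geometric series; `C₁ + C * s = C` is what closes the induction.
  set C := C₁ / (1 - s) with hCdef
  have hCs : C₁ + C * s = C := by
    have : 1 - s ≠ 0 := by linarith
    rw [hCdef]; field_simp; ring
  have hC : 0 < C := div_pos hC₁ (by linarith)
  -- The image of `p₀` under a word is first compared, inside one cell and with gain `s`, with the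
  -- image of `p₀` under the first letter. That point and `p₀`, the image of `q₀` under `i₀`, are
  -- vertices of the level one graph.
  have key : ∀ (n : ℕ) (w : Fin n → Fin K.N) (u : K.carrier → ℝ),
      |u (wordMap K.map n w p₀) - u p₀| ≤ C * √(K.levelEnergy D ρ n u u) := by
    intro n
    induction n with
    | zero => intro w u; simp only [wordMap, id_eq, sub_self, abs_zero]; positivity
    | succ n ih =>
      intro w u
      have h1 := ih (fun j => w j.succ) (u ∘ K.map (w 0))
      have h2 := hb u (w 0) i₀ p₀ hp₀ q₀ hq₀
      have h3 : √(K.levelEnergy D ρ n (u ∘ K.map (w 0)) (u ∘ K.map (w 0)))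
          ≤ s * √(K.levelEnergy D ρ (n + 1) u u) :=
        sqrt_le_mul_sqrt hs0.le (h.isFormSeq.nonneg _ _) (hs _) (h.levelEnergy_comp_le n _ u)
      have h4 : √(K.levelEnergy D ρ 1 u u) ≤ √(K.levelEnergy D ρ (n + 1) u u) :=
        Real.sqrt_le_sqrt (h.isFormSeq.monotone u (by omega))
      have h5 := abs_sub_le (u (wordMap K.map (n + 1) w p₀)) (u (K.map (w 0) p₀)) (u p₀)
      have h6 := mul_le_mul_of_nonneg_left h3 hC.le
      have h7 := mul_le_mul_of_nonneg_left h4 hC₁.le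
      have h8 : C * √(K.levelEnergy D ρ (n + 1) u u)
        = C * (s * √(K.levelEnergy D ρ (n + 1) u u)) + C₁ * √(K.levelEnergy D ρ (n + 1) u u) := by
        rw [← mul_assoc, ← add_mul, add_comm (C * s), hCs]
      rw [h8]
      simp only [wordMap, Function.comp_apply] at h1 h5 ⊢
      linarith
  have key2 : ∀ u ∈ K.domain D ρ, ∀ x, |u x - u p₀| ≤ C * √(K.energy D ρ u u) := by
    intro u hu x
    refine le_of_forall_pos_le_add fun ε hε => ?_
    obtain ⟨n, w, hw⟩ := exists_wordMap_near hu.1 x p₀ hε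
    have h1 := key n w u
    have h2 := mul_le_mul_of_nonneg_left (Real.sqrt_le_sqrt (h.isFormSeq.le_lim hu.2 n)) hC.le
    have h3 := abs_sub_le (u x) (u (wordMap K.map n w p₀)) (u p₀)
    rw [energy_eq_formLim]
    linarith
  refine ⟨2 * C, by linarith, fun u hu x y => ?_⟩
  have h1 := key2 u hu x
  have h2 := key2 u hu y
  rw [abs_le] at *
  constructor <;> linarith

lemma exists_cell_bound : ∃ C s : ℝ, 0 < C ∧ 0 < s ∧ s < 1 ∧ ∀ (n : ℕ) (w : Fin n → Fin K.N),
    ∀ u ∈ K.domain D ρ, ∀ x y,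
      |u (wordMap K.map n w x) - u (wordMap K.map n w y)|
        ≤ C * s ^ n * √(K.energy D ρ u u) := by
  obtain ⟨s, hs0, hs1, hs⟩ := h.exists_ratio
  obtain ⟨C, hC, hb⟩ := h.exists_osc_bound
  refine ⟨C, s, hC, hs0, hs1, fun n => ?_⟩
  induction n with
  | zero => intro w u hu x y; simpa [wordMap] using hb u hu x y
  | succ n ih =>
    intro w u hu x y
    have h1 := h.comp_map hu (w 0)
    refine (ih (fun j => w j.succ) _ h1.1 x y).trans ?_
    rw [pow_succ, mul_assoc, mul_assoc, mul_assoc]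
    refine mul_le_mul_of_nonneg_left (mul_le_mul_of_nonneg_left ?_ (by positivity)) hC.le
    exact sqrt_le_mul_sqrt hs0.le (h.energy_nonneg hu) (hs _) h1.2

/-- The neighbourhood serves all `u` at once, as estimates of the resistance, a supremum over `u`,
require. Each passage to smaller cells gains the factor `s`. -/
lemma equicontinuous {ε : ℝ} (hε : 0 < ε) (x : K.carrier) :
    ∀ᶠ y in 𝓝 x, ∀ u ∈ K.domain D ρ, |u x - u y| ≤ ε * √(K.energy D ρ u u) := by
  obtain ⟨s, hs0, hs1, hs⟩ := h.exists_ratio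
  obtain ⟨C, hC, hb⟩ := h.exists_osc_bound
  have key : ∀ (n : ℕ) (x : K.carrier), ∀ᶠ y in 𝓝 x, ∀ u ∈ K.domain D ρ,
      |u x - u y| ≤ C * s ^ n * √(K.energy D ρ u u) := by
    intro n
    induction n with
    | zero => intro x; filter_upwards with y u hu; simpa using hb u hu x y
    | succ n ih =>
      refine eventually_of_cells fun i y => ?_
      filter_upwards [ih y] with y' hy' u hu
      have h1 := h.comp_map hu i
      refine (hy' _ h1.1).trans ?_
      rw [pow_succ, mul_assoc, mul_assoc, mul_assoc]
      refine mul_le_mul_of_nonneg_left (mul_le_mul_of_nonneg_left ?_ (by positivity)) hC.le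
      exact sqrt_le_mul_sqrt hs0.le (h.energy_nonneg hu) (hs _) h1.2
  obtain ⟨n, hn⟩ := exists_pow_lt_of_lt_one (div_pos hε hC) hs1
  filter_upwards [key n x] with y hy u hu
  refine (hy u hu).trans (mul_le_mul_of_nonneg_right ?_ (Real.sqrt_nonneg _))
  rw [lt_div_iff₀ hC] at hn
  linarith

end IsRegularHarmonicStructure

end PCFSet

/-! ### Harmonic extension and approximation on a p.c.f. set -/

namespace PCFSet

variable {K : PCFSet} {D : Matrix K.boundary K.boundary ℝ} {ρ : Fin K.N → ℝ}

/-- Apply an extension operator `e` on smaller and smaller cells along an infinite word. -/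
def iterExt {X S : Type*} (F : S → X → X) (e : (X → ℝ) → X → ℝ) :
    ℕ → (X → ℝ) → (ℕ → S) → X → ℝ
  | 0, f, _ => f
  | n + 1, f, ω => iterExt F e n (e f ∘ F (ω 0)) fun k => ω (k + 1)

namespace IsRegularHarmonicStructure

variable (h : K.IsRegularHarmonicStructure D ρ)
include h

/-- `G f ω` is to be the value at `coding ω` of the harmonic extension of `f`. It is the limit of
the values at `p₀` when the level one minimiser `e` is applied in smaller and smaller cells along
`ω`; each passage to a cell reduces the root of the energy by `s`, so the values are Cauchy. -/
lemma exists_extension_on_words {e : (K.carrier → ℝ) → K.carrier → ℝ}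
    (he : ∀ f, ∀ p ∈ K.boundary, e f p = f p)
    (hee : ∀ f, K.levelEnergy D ρ 1 (e f) (e f) = K.levelEnergy D ρ 0 f f) :
    ∃ G : (K.carrier → ℝ) → (ℕ → Fin K.N) → ℝ, ∃ C s : ℝ, 0 < C ∧ 0 < s ∧ s < 1 ∧
      (∀ f ω, G f ω = G (e f ∘ K.map (ω 0)) fun k => ω (k + 1)) ∧
      (∀ f ω, ∀ p ∈ K.boundary, |G f ω - f p| ≤ C * √(K.levelEnergy D ρ 0 f f)) ∧
      ∀ f i, √(K.levelEnergy D ρ 0 (e f ∘ K.map i) (e f ∘ K.map i))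
        ≤ s * √(K.levelEnergy D ρ 0 f f) := by
  obtain ⟨s, hs0, hs1, hs⟩ := h.exists_ratio
  obtain ⟨C₁, hC₁, hb⟩ := h.exists_level_one_bound
  obtain ⟨p₀, hp₀⟩ := K.boundary_nonempty
  have hdec : ∀ f i, √(K.levelEnergy D ρ 0 (e f ∘ K.map i) (e f ∘ K.map i))
      ≤ s * √(K.levelEnergy D ρ 0 f f) := fun f i =>
    sqrt_le_mul_sqrt hs0.le (h.isFormSeq.nonneg _ _) (hs i)
      ((h.levelEnergy_comp_le 0 i (e f)).trans_eq (by rw [zero_add, hee]))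
  have hstep : ∀ f i, ∀ p ∈ K.boundary, ∀ q ∈ K.boundary,
      |(e f ∘ K.map i) p - f q| ≤ C₁ * √(K.levelEnergy D ρ 0 f f) := by
    intro f i p hp q hq
    obtain ⟨j, q', hq', hj⟩ := exists_map_eq_of_mem_boundary hq
    have := hb (e f) i j p hp q' hq'
    rwa [hj, he f q hq, hee] at this
  have hC1s : 0 < 1 - s := by linarith
  set C := C₁ / (1 - s) with hCdef
  have hCs : C₁ + C * s = C := by
    have : 1 - s ≠ 0 := hC1s.ne'
    rw [hCdef]; field_simp; ring
  have hC : 0 < C := div_pos hC₁ hC1s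
  have hbase : ∀ (n : ℕ) (f : K.carrier → ℝ) (ω : ℕ → Fin K.N),
      |iterExt K.map e n f ω p₀ - f p₀| ≤ C * √(K.levelEnergy D ρ 0 f f) := by
    intro n
    induction n with
    | zero => intro f ω; simp only [iterExt, sub_self, abs_zero]; positivity
    | succ n ih =>
      intro f ω
      have h1 := ih (e f ∘ K.map (ω 0)) fun k => ω (k + 1)
      have h2 := hstep f (ω 0) p₀ hp₀ p₀ hp₀
      have h3 := mul_le_mul_of_nonneg_left (hdec f (ω 0)) hC.le
      have h4 := abs_sub_le (iterExt K.map e (n + 1) f ω p₀) ((e f ∘ K.map (ω 0)) p₀) (f p₀)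
      have h5 : C * √(K.levelEnergy D ρ 0 f f) = C₁ * √(K.levelEnergy D ρ 0 f f)
        + C * (s * √(K.levelEnergy D ρ 0 f f)) := by rw [← mul_assoc, ← add_mul, hCs]
      rw [h5]
      simp only [iterExt] at h4 ⊢
      linarith
  have hcau : ∀ (m n : ℕ) (f : K.carrier → ℝ) (ω : ℕ → Fin K.N),
      |iterExt K.map e (m + n) f ω p₀ - iterExt K.map e m f ω p₀|
        ≤ C * √(K.levelEnergy D ρ 0 f f) * s ^ m := by
    intro m n
    induction m with
    | zero => intro f ω; simpa [iterExt] using hbase n f ω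
    | succ m ih =>
      intro f ω
      rw [Nat.succ_add]
      refine (ih (e f ∘ K.map (ω 0)) fun k => ω (k + 1)).trans ?_
      rw [pow_succ', ← mul_assoc]
      refine mul_le_mul_of_nonneg_right ?_ (by positivity)
      rw [mul_assoc]
      refine mul_le_mul_of_nonneg_left ((hdec f (ω 0)).trans_eq (mul_comm _ _)) hC.le
  have hlim : ∀ f ω, ∃ l, Tendsto (fun n => iterExt K.map e n f ω p₀) atTop (𝓝 l) := by
    intro f ω
    refine cauchySeq_tendsto_of_complete (cauchySeq_of_le_tendsto_0'
      (fun m => C * √(K.levelEnergy D ρ 0 f f) * s ^ m) (fun m n hmn => ?_) ?_)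
    · obtain ⟨k, rfl⟩ := Nat.exists_eq_add_of_le hmn
      rw [dist_comm]
      exact hcau m k f ω
    · simpa using (tendsto_pow_atTop_nhds_zero_of_lt_one hs0.le hs1).const_mul
        (C * √(K.levelEnergy D ρ 0 f f))
  choose G hG using hlim
  refine ⟨G, C + C₁, s, by positivity, hs0, hs1, fun f ω => ?_, fun f ω p hp => ?_, hdec⟩
  · exact tendsto_nhds_unique ((tendsto_add_atTop_iff_nat 1).2 (hG f ω)) (hG _ _)
  · have h1 : |G f ω - f p₀| ≤ C * √(K.levelEnergy D ρ 0 f f) :=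
      le_of_tendsto' ((hG f ω).sub_const _).abs fun n => hbase n f ω
    have h2 : |f p₀ - f p| ≤ C₁ * √(K.levelEnergy D ρ 0 f f) := by
      obtain ⟨j, q', hq', hj⟩ := exists_map_eq_of_mem_boundary hp₀
      have := hstep f j q' hq' p hp
      rwa [Function.comp_apply, hj, he f p₀ hp₀] at this
    have h3 := abs_sub_le (G f ω) (f p₀) (f p)
    rw [add_mul]
    linarith

/-- Existence of harmonic extensions. -/
lemma exists_harmonic (f : K.carrier → ℝ) : ∃ u ∈ K.domain D ρ, (∀ p ∈ K.boundary, u p = f p) ∧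
    K.energy D ρ u u ≤ K.levelEnergy D ρ 0 f f := by
  choose e he hee using fun f => (h.trace_eq f).1
  obtain ⟨G, C, s, hC, hs0, hs1, hG, hGb, hdec⟩ :=
    h.exists_extension_on_words he fun f => (hee f).symm
  have hpow : ∀ a : ℝ, Tendsto (fun n : ℕ => C * s ^ n * a) atTop (𝓝 0) := fun a => by
    simpa using ((tendsto_pow_atTop_nhds_zero_of_lt_one hs0.le hs1).const_mul C).mul_const a
  -- Tails of post-critical words are post-critical, so the crude bound can be used in ever smaller
  -- cells; it forces `G` to take the prescribed boundary values.
  have hbd : ∀ (n : ℕ) (f : K.carrier → ℝ), ∀ τ ∈ K.postcritical,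
      |G f τ - f (K.coding τ)| ≤ C * s ^ n * √(K.levelEnergy D ρ 0 f f) := by
    intro n
    induction n with
    | zero => intro f τ hτ; simpa using hGb f τ _ (mem_boundary.2 ⟨τ, hτ, rfl⟩)
    | succ n ih =>
      intro f τ hτ
      have h1 := ih (e f ∘ K.map (τ 0)) _ (postcritical_shift hτ)
      rw [← hG, Function.comp_apply, ← coding_eq, he f _ (mem_boundary.2 ⟨τ, hτ, rfl⟩)] at h1
      refine h1.trans ?_
      rw [pow_succ, mul_assoc, mul_assoc, mul_assoc]
      exact mul_le_mul_of_nonneg_left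
        (mul_le_mul_of_nonneg_left (hdec f _) (by positivity)) hC.le
  have hGP : ∀ f, ∀ τ ∈ K.postcritical, G f τ = f (K.coding τ) := by
    intro f τ hτ
    have := ge_of_tendsto' (hpow _) fun n => hbd n f τ hτ
    exact sub_eq_zero.1 (abs_nonpos_iff.1 this)
  -- Well-definedness on points: common first letters are peeled off by injectivity. Once the first
  -- letters differ, both tails are post-critical and `G` is given there by `e f`, evaluated at the
  -- same point.
  have hwd : ∀ (n : ℕ) (f : K.carrier → ℝ) (ω ω' : ℕ → Fin K.N), ω n ≠ ω' n →
      K.coding ω = K.coding ω' → G f ω = G f ω' := by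
    intro n
    induction n with
    | zero =>
      intro f ω ω' hn hc
      rw [hG f ω, hG f ω', hGP _ _ (shift_mem_postcritical hc hn),
        hGP _ _ (shift_mem_postcritical hc.symm hn.symm), Function.comp_apply,
        Function.comp_apply, ← coding_eq, ← coding_eq, hc]
    | succ n ih =>
      intro f ω ω' hn hc
      by_cases h0 : ω 0 = ω' 0
      · rw [hG f ω, hG f ω', h0]
        refine ih _ _ _ hn (K.map_injective (ω 0) ?_)
        rw [← coding_eq, hc, coding_eq ω', h0]
      · rw [hG f ω, hG f ω', hGP _ _ (shift_mem_postcritical hc h0),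
          hGP _ _ (shift_mem_postcritical hc.symm (Ne.symm h0)), Function.comp_apply,
          Function.comp_apply, ← coding_eq, ← coding_eq, hc]
  have hwd' : ∀ (f : K.carrier → ℝ) (ω ω' : ℕ → Fin K.N), K.coding ω = K.coding ω' →
      G f ω = G f ω' := by
    intro f ω ω' hc
    by_cases hne : ω = ω'
    · rw [hne]
    · obtain ⟨n, hn⟩ := Function.ne_iff.1 hne
      exact hwd n f ω ω' hn hc
  choose code hcode using K.coding_surjective
  let U : (K.carrier → ℝ) → K.carrier → ℝ := fun f x => G f (code x)
  have hU : ∀ f ω, U f (K.coding ω) = G f ω := fun f ω => hwd' f _ _ (hcode _)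
  have hmod : ∀ (n : ℕ) (f : K.carrier → ℝ) (ω ω' : ℕ → Fin K.N), (∀ k < n, ω k = ω' k) →
      |G f ω - G f ω'| ≤ C * s ^ n * (2 * √(K.levelEnergy D ρ 0 f f)) := by
    intro n
    induction n with
    | zero =>
      intro f ω ω' _
      obtain ⟨p, hp⟩ := K.boundary_nonempty
      have h1 := hGb f ω p hp
      have h2 := hGb f ω' p hp
      rw [pow_zero, mul_one, mul_left_comm]
      rw [abs_le] at *
      constructor <;> linarith
    | succ n ih =>
      intro f ω ω' hω
      rw [hG f ω, hG f ω', hω 0 (by omega)]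
      refine (ih _ _ _ fun k hk => hω (k + 1) (by omega)).trans ?_
      rw [pow_succ, mul_assoc, mul_assoc, mul_assoc]
      refine mul_le_mul_of_nonneg_left (mul_le_mul_of_nonneg_left ?_ (by positivity)) hC.le
      have := hdec f (ω' 0)
      linarith
  have hcont : ∀ f, Continuous (U f) := by
    intro f
    rw [K.isQuotientMap_coding.continuous_iff, continuous_real_iff_eventually]
    intro ε hε ω
    obtain ⟨n, hn⟩ := ((hpow (2 * √(K.levelEnergy D ρ 0 f f))).eventually_lt_const hε).exists
    have hcyl := (PiNat.isOpen_cylinder (fun _ => Fin K.N) ω n).mem_nhds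
      (PiNat.self_mem_cylinder ω n)
    filter_upwards [hcyl] with ω' hω'
    rw [Function.comp_apply, Function.comp_apply, hU, hU]
    exact (hmod n f ω ω' fun k hk => (hω' k hk).symm).trans hn.le
  have hbdry : ∀ f, ∀ p ∈ K.boundary, U f p = f p := by
    intro f p hp
    obtain ⟨τ, hτ, rfl⟩ := mem_boundary.1 hp
    rw [hU, hGP f τ hτ]
  have hcomp : ∀ f i, U f ∘ K.map i = U (e f ∘ K.map i) := by
    intro f i
    funext x
    obtain ⟨ω, rfl⟩ := K.coding_surjective x
    rw [Function.comp_apply, ← K.coding_cons, hU, hU, hG]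
    rfl
  -- The minimiser has the energy of its boundary values, so refinement creates no energy.
  have hen : ∀ (n : ℕ) (f : K.carrier → ℝ),
      K.levelEnergy D ρ n (U f) (U f) ≤ K.levelEnergy D ρ 0 f f := by
    intro n
    induction n with
    | zero => intro f; exact (levelEnergy_congr (hbdry f)).le
    | succ n ih =>
      intro f
      rw [hee f, levelEnergy_succ, levelEnergy_succ]
      refine Finset.sum_le_sum fun i _ =>
        mul_le_mul_of_nonneg_left ?_ (inv_nonneg.2 (h.weight_pos i).le)
      rw [hcomp]
      exact ih _
  have := h.isFormSeq.lim_le fun n => hen n f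
  exact ⟨U f, ⟨hcont f, this.1⟩, hbdry f, this.2⟩

/-- Boundary values extend to the whole set with bounds for the values and the energy. -/
lemma exists_lift : ∃ C : ℝ, 0 < C ∧ ∀ (f : K.carrier → ℝ) (M : ℝ), (∀ p ∈ K.boundary, |f p| ≤ M) →
    ∃ u ∈ K.domain D ρ, (∀ p ∈ K.boundary, u p = f p) ∧ (∀ x, |u x| ≤ C * M) ∧
      K.energy D ρ u u ≤ C * M ^ 2 := by
  obtain ⟨C₁, hC₁, h1⟩ := h.laplacian.exists_form_le
  obtain ⟨C₂, hC₂, h2⟩ := h.exists_osc_bound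
  obtain ⟨p₀, hp₀⟩ := K.boundary_nonempty
  -- Boundary values oscillate by at most `2 * M`, so the energy is at most `C₁ * 4 * M ^ 2`; `C₂`
  -- times its root bounds the oscillation inside.
  refine ⟨1 + C₂ * √(C₁ * 4) + C₁ * 4, by positivity, fun f M hM => ?_⟩
  have hM0 : 0 ≤ M := (abs_nonneg _).trans (hM p₀ hp₀)
  obtain ⟨u, hu, hub, hue⟩ := h.exists_harmonic f
  have h3 : K.energy D ρ u u ≤ C₁ * 4 * M ^ 2 := by
    refine hue.trans ?_
    rw [levelEnergy_zero]
    refine (h1 _ (2 * M) fun p q => ?_).trans_eq (by ring)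
    have := hM p.1 p.2
    have := hM q.1 q.2
    rw [abs_le] at *
    constructor <;> linarith
  refine ⟨u, hu, hub, fun x => ?_, h3.trans ?_⟩
  · have h4 := h2 u hu x p₀
    have h5 := hM p₀ hp₀
    rw [← hub p₀ hp₀] at h5
    have h6 : √(K.energy D ρ u u) ≤ √(C₁ * 4) * M := by
      refine (Real.sqrt_le_sqrt h3).trans_eq ?_
      rw [Real.sqrt_mul (by positivity), Real.sqrt_sq hM0]
    have h7 := abs_add_le (u x - u p₀) (u p₀)
    rw [sub_add_cancel] at h7
    have h8 := mul_le_mul_of_nonneg_left h6 hC₂.le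
    have h9 : 0 ≤ C₁ * 4 * M := by positivity
    linarith
  · have : 0 ≤ (1 + C₂ * √(C₁ * 4)) * M ^ 2 := by positivity
    linarith

/-- Extensions are made only in the cells of level `n`, whence a constant independent of `n`. Exact
agreement at boundary points allows the functions on neighbouring cells to be glued. -/
lemma exists_approx : ∃ C : ℝ, 0 < C ∧ ∀ (n : ℕ) (f : K.carrier → ℝ) (ε : ℝ),
    (∀ (w : Fin n → Fin K.N) (x y : K.carrier),
      |f (wordMap K.map n w x) - f (wordMap K.map n w y)| ≤ ε) →
    ∃ u ∈ K.domain D ρ, (∀ p ∈ K.boundary, u p = f p) ∧ ∀ x, |u x - f x| ≤ C * ε := by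
  classical
  obtain ⟨C, hC, hl⟩ := h.exists_lift
  obtain ⟨p₀, hp₀⟩ := K.boundary_nonempty
  refine ⟨C + 1, by positivity, fun n => ?_⟩
  induction n with
  | zero =>
    intro f ε hε
    have hf : ∀ x y, |f x - f y| ≤ ε := hε Fin.elim0
    obtain ⟨u, hu, hub, huc, -⟩ := hl (fun x => f x - f p₀) ε fun p _ => hf p p₀
    refine ⟨u + fun _ => f p₀, h.add_mem hu (h.const_mem _), fun p hp => ?_, fun x => ?_⟩
    · rw [Pi.add_apply, hub p hp]; ring
    · have h1 := huc x
      have h2 := hf x p₀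
      rw [Pi.add_apply]
      rw [abs_le] at *
      constructor <;> linarith
  | succ n ih =>
    intro f ε hε
    have : ∀ i, ∃ u ∈ K.domain D ρ, (∀ p ∈ K.boundary, u p = (f ∘ K.map i) p) ∧
        ∀ x, |u x - (f ∘ K.map i) x| ≤ (C + 1) * ε := fun i =>
      ih (f ∘ K.map i) ε fun w x y => hε (Fin.cons i w) x y
    choose g hg hgb hgf using this
    choose I Y hIY using K.exists_map_eq
    let u : K.carrier → ℝ := fun x => g (I x) (Y x)
    have hu : ∀ i, u ∘ K.map i = g i := by
      intro i
      funext y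
      have h1 := hIY (K.map i y)
      simp only [u, Function.comp_apply]
      by_cases hi : I (K.map i y) = i
      · rw [hi] at h1 ⊢
        rw [K.map_injective i h1]
      · rw [hgb _ _ (mem_boundary_of_map_eq hi h1),
          hgb _ _ (mem_boundary_of_map_eq (Ne.symm hi) h1.symm), Function.comp_apply, h1]; rfl
    have hux : ∀ i y, u (K.map i y) = g i y := fun i y => congrFun (hu i) y
    refine ⟨u, ⟨continuous_of_cells fun i => by rw [hu]; exact (hg i).1, ?_⟩, fun p hp => ?_,
      fun x => ?_⟩
    · refine (h.isFormSeq.lim_le (C := ∑ i, (ρ i)⁻¹ * K.energy D ρ (g i) (g i)) fun n => ?_).1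
      refine (h.isFormSeq.mono n u).trans ?_
      rw [levelEnergy_succ]
      refine Finset.sum_le_sum fun i _ =>
        mul_le_mul_of_nonneg_left ?_ (inv_nonneg.2 (h.weight_pos i).le)
      rw [hu]
      exact h.isFormSeq.le_lim (hg i).2 n
    · obtain ⟨i, q, hq, rfl⟩ := exists_map_eq_of_mem_boundary hp
      rw [hux, hgb i q hq]; rfl
    · obtain ⟨i, y, rfl⟩ := K.exists_map_eq x
      rw [hux]; exact hgf i y

lemma exists_uniform_approx {f : K.carrier → ℝ} (hf : Continuous f) {ε : ℝ} (hε : 0 < ε) :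
    ∃ u ∈ K.domain D ρ, ∀ x, |u x - f x| ≤ ε := by
  obtain ⟨C, hC, hb⟩ := h.exists_approx
  obtain ⟨n, hn⟩ := exists_level_uniform hf (div_pos hε hC)
  obtain ⟨u, hu, -, hux⟩ := hb n f _ hn
  exact ⟨u, hu, fun x => (hux x).trans_eq (mul_div_cancel₀ ε hC.ne')⟩

end IsRegularHarmonicStructure

end PCFSet

lemma exists_pos_forall_le {ι : Type*} [Finite ι] (C : ι → ℝ) : ∃ M > 0, ∀ i, C i ≤ M := by
  obtain ⟨M, hM⟩ := (Set.finite_range C).bddAbove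
  exact ⟨max M 1, by positivity, fun i => (hM ⟨i, rfl⟩).trans (le_max_left _ _)⟩

/-! ### The base -/

namespace SierpinskiLike

variable {K : SierpinskiLike}

lemma exists_fixing {p : K.carrier} (hp : p ∈ K.boundary) :
    ∃ i, (p : Plane) = K.fixedPt i ∧ K.map i p = p := by
  obtain ⟨i, hi⟩ := K.boundary_fixed p hp
  exact ⟨i, hi, Subtype.ext (by rw [K.map_eq_sim, hi, K.sim_fixedPt])⟩

/-- A boundary point lies in one cell of the first level only. -/
lemma eq_of_map_eq_of_fixed {p q : K.carrier} {i j : Fin K.N} (hi : K.map i p = p)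
    (hj : K.map j q = p) : j = i := by
  by_contra hij
  obtain ⟨ω, rfl⟩ := K.coding_surjective q
  -- These words consist of `n` letters `i`, then `j`, then `ω`, and all code `p`. If `i ≠ j`, each
  -- of them is post-critical, being the shift of the next one, and they are pairwise distinct.
  let W : ℕ → ℕ → Fin K.N := fun n => (consWord i)^[n] (consWord j ω)
  have hW : ∀ n, W (n + 1) = consWord i (W n) := fun n => Function.iterate_succ_apply' _ _ _
  have hcod : ∀ n, K.coding (W n) = p := by
    intro n
    induction n with
    | zero => rw [← hj, ← K.coding_cons]; rfl
    | succ n ih => rw [hW, K.coding_cons, ih, hi]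
  have hlt : ∀ n m, m < n → W n m = i := by
    intro n
    induction n with
    | zero => intro m hm; omega
    | succ n ih =>
      rintro (_ | m) hm
      · rw [hW]; rfl
      · rw [hW]; exact ih m (by omega)
  have heq : ∀ n, W n n = j := by
    intro n
    induction n with
    | zero => rfl
    | succ n ih => rw [hW]; exact ih
  have hinj : Function.Injective W := by
    intro m n hmn
    by_contra hne
    rcases lt_or_gt_of_ne hne with hl | hl
    · exact hij ((heq m).symm.trans ((congrFun hmn m).trans (hlt n m hl)))
    · exact hij ((heq n).symm.trans ((congrFun hmn n).symm.trans (hlt m n hl)))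
  refine Set.infinite_of_injective_forall_mem hinj (fun n => ?_) K.postcritical_finite
  refine ⟨W (n + 1), i, j, Ne.symm hij, ?_, ?_, 1, le_rfl, ?_⟩
  · rw [hcod]; exact ⟨p, hi⟩
  · rw [hcod]; exact ⟨_, hj⟩
  · rw [hW]; rfl

/-- Test with the indicator of a boundary point `p` fixed by the map `i`. Only the cell `i` contains
`p`, and there the indicator reproduces itself, so its level one energy is `rK⁻¹` times its level
zero energy. In consequence `r < 1`. -/
lemma resistance_factor_le_one {rK : ℝ}
    (hrK : K.IsHarmonicStructure K.symmLaplacian fun _ => rK) : rK ≤ 1 := by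
  classical
  obtain ⟨p, hp⟩ := K.boundary_nonempty
  obtain ⟨i, -, hi⟩ := exists_fixing hp
  have hpos : 0 < rK := hrK.weight_pos i
  let f : K.carrier → ℝ := fun x => if x = p then 1 else 0
  have h1 := hrK.isFormSeq.mono 0 f
  rw [PCFSet.levelEnergy_succ, Finset.sum_eq_single i] at h1
  · have h2 : f ∘ K.map i = f := by
      funext x
      simp only [f, Function.comp_apply]
      by_cases hx : x = p
      · rw [hx, hi]
      · rw [if_neg hx, if_neg fun h => hx (K.map_injective i (h.trans hi.symm))]
    rw [h2] at h1
    have h3 : 0 < K.levelEnergy K.symmLaplacian (fun _ => rK) 0 f f := by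
      obtain ⟨C, hC, hb⟩ := hrK.laplacian.poincare
      obtain ⟨q, hq, hqp⟩ : ∃ q ∈ K.boundary, q ≠ p := by
        refine Finset.exists_mem_ne ?_ p
        rw [K.boundary_card]; norm_num
      have h4 := hb (fun p : K.boundary => f p.1) ⟨p, hp⟩ ⟨q, hq⟩
      rw [← PCFSet.levelEnergy_zero K.symmLaplacian fun _ => rK] at h4
      simp only [f, if_true, if_neg hqp] at h4
      by_contra hle
      rw [Real.sqrt_eq_zero'.2 (not_lt.1 hle)] at h4
      norm_num at h4
    by_contra hlt
    have : rK⁻¹ < 1 := inv_lt_one_of_one_lt₀ (not_le.1 hlt)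
    nlinarith
  · intro j _ hji
    have h2 : f ∘ K.map j = fun _ => 0 := by
      funext x
      simp only [f, Function.comp_apply]
      exact if_neg fun h => hji (eq_of_map_eq_of_fixed hi h)
    rw [h2, hrK.levelEnergy_const, mul_zero]
  · simp

lemma dist_shrunkSim {c : ℝ} (hc : 0 < c) (i : Fin K.N) (x y : Plane) :
    dist (K.shrunkSim c i x) (K.shrunkSim c i y) = c * dist x y := by
  have hp := K.ratio_pos
  rw [shrunkSim, shrunkSim, dist_add_left, dist_smul₀, dist_sub_right, K.dist_sim, Real.norm_eq_abs,
    abs_of_pos (div_pos hc hp), ← mul_assoc, div_mul_cancel₀ _ hp.ne']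

lemma shrunkSim_injective {c : ℝ} (hc : 0 < c) (i : Fin K.N) :
    Function.Injective (K.shrunkSim c i) := fun x y h => by
  have := dist_shrunkSim hc i x y
  rw [h, dist_self] at this
  exact dist_eq_zero.1 ((mul_eq_zero.1 this.symm).resolve_left hc.ne')

lemma shrunkSim_fixedPt (c : ℝ) (i : Fin K.N) : K.shrunkSim c i (K.fixedPt i) = K.fixedPt i := by
  simp [shrunkSim, K.sim_fixedPt]

end SierpinskiLike

/-! ### The hybrid -/

namespace IsHybrid

variable {K : SierpinskiLike} {c : ℝ} {B : Type*} {bond : B → PCFSet}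
  {att : B → Finset (Fin K.N)} {H : Set Plane} (h : IsHybrid K c bond att H)

include h in
lemma compactSpace : CompactSpace H := isCompact_iff_compactSpace.1 h.isCompact

include h in
lemma cellMap_mem (i : Fin K.N) {x : Plane} (hx : x ∈ H) : K.shrunkSim c i x ∈ H :=
  (h.cellMap i ⟨x, hx⟩).2

-- The orbit of a point of `H` under the shrunk similarity converges to the fixed point, and `H` is
-- closed. This is how the vertices of the base come to lie in the hybrid.
include h in
lemma fixedPt_mem (hc : 0 < c) (hc1 : c < 1) (i : Fin K.N) : K.fixedPt i ∈ H := by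
  obtain ⟨x, hx⟩ := h.nonempty
  have hmem : ∀ n, (K.shrunkSim c i)^[n] x ∈ H := by
    intro n
    induction n with
    | zero => exact hx
    | succ n ih => rw [Function.iterate_succ_apply']; exact h.cellMap_mem i ih
  have hdist : ∀ n, dist ((K.shrunkSim c i)^[n] x) (K.fixedPt i)
      = c ^ n * dist x (K.fixedPt i) := by
    intro n
    induction n with
    | zero => simp
    | succ n ih =>
      rw [Function.iterate_succ_apply']
      nth_rewrite 1 [← K.shrunkSim_fixedPt c i]
      rw [K.dist_shrunkSim hc, ih, pow_succ']; ring
  refine h.isCompact.isClosed.mem_of_tendsto (b := atTop)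
    (f := fun n => (K.shrunkSim c i)^[n] x) ?_ (Eventually.of_forall hmem)
  rw [tendsto_iff_dist_tendsto_zero]
  simp only [hdist]
  simpa using (tendsto_pow_atTop_nhds_zero_of_lt_one hc.le hc1).mul_const (dist x (K.fixedPt i))

include h in
lemma boundarySet_subset (hc : 0 < c) (hc1 : c < 1) : K.boundarySet ⊆ H := by
  rintro _ ⟨p, hp, rfl⟩
  obtain ⟨i, hi, -⟩ := SierpinskiLike.exists_fixing hp
  rw [hi]
  exact h.fixedPt_mem hc hc1 i

lemma cellMap_continuous (hc : 0 < c) (i : Fin K.N) : Continuous (h.cellMap i) := by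
  refine Continuous.subtype_mk ?_ _
  have : LipschitzWith (⟨c, hc.le⟩ : NNReal) (K.shrunkSim c i) :=
    LipschitzWith.of_dist_le_mul fun x y => (K.dist_shrunkSim hc i x y).le
  exact this.continuous.comp continuous_subtype_val

lemma cellMap_injective (hc : 0 < c) (i : Fin K.N) : Function.Injective (h.cellMap i) :=
  fun _ _ hxy => Subtype.ext (K.shrunkSim_injective hc i (congrArg Subtype.val hxy))

lemma isClosedEmbedding_cellMap (hc : 0 < c) (i : Fin K.N) : IsClosedEmbedding (h.cellMap i) :=
  have := h.compactSpace
  (h.cellMap_continuous hc i).isClosedEmbedding (h.cellMap_injective hc i)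

lemma bondIncl_continuous (b : B) : Continuous (h.bondIncl b) :=
  Continuous.subtype_mk continuous_subtype_val _

lemma bondIncl_injective (b : B) : Function.Injective (h.bondIncl b) :=
  fun _ _ hxy => Subtype.ext (congrArg (fun x : H => (x : Plane)) hxy)

lemma isClosedEmbedding_bondIncl (b : B) : IsClosedEmbedding (h.bondIncl b) :=
  (h.bondIncl_continuous b).isClosedEmbedding (h.bondIncl_injective b)

lemma cover (x : H) : (∃ i y, h.cellMap i y = x) ∨ ∃ b y, h.bondIncl b y = x := by
  rcases h.eq_union.le x.2 with hx | hx
  · obtain ⟨i, y, hy, hyx⟩ := mem_iUnion.1 hx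
    exact Or.inl ⟨i, ⟨y, hy⟩, Subtype.ext hyx⟩
  · obtain ⟨b, hb⟩ := mem_iUnion.1 hx
    exact Or.inr ⟨b, ⟨x, hb⟩, rfl⟩

lemma index_eq {i j : Fin K.N} {x y : H} (hxy : h.cellMap i x = h.cellMap j y) : i = j := by
  by_contra hij
  have hv : K.shrunkSim c i x = K.shrunkSim c j y := congrArg Subtype.val hxy
  exact (h.cell_disjoint i j hij).le_bot ⟨mem_image_of_mem _ x.2, hv ▸ mem_image_of_mem _ y.2⟩

lemma bond_cell (hc : 0 < c) {b : B} {i : Fin K.N} {x : (bond b).carrier} {y : H}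
    (hxy : h.bondIncl b x = h.cellMap i y) : x ∈ (bond b).boundary ∧ (y : Plane) ∈ K.boundarySet := by
  have hv : (x : Plane) = K.shrunkSim c i y := congrArg Subtype.val hxy
  obtain ⟨⟨x', hx', hxx⟩, ⟨y', hy', hyy⟩⟩ :=
    h.bond_inter_cell b i ⟨x.2, hv ▸ mem_image_of_mem _ y.2⟩
  refine ⟨by rwa [← Subtype.ext hxx], ?_⟩
  rwa [← K.shrunkSim_injective hc i (hyy.trans hv)]

lemma bond_bond {b b' : B} (hb : b ≠ b') {x : (bond b).carrier} {x' : (bond b').carrier}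
    (hxx : h.bondIncl b x = h.bondIncl b' x') : x ∈ (bond b).boundary := by
  have hv : (x : Plane) = x' := congrArg Subtype.val hxx
  obtain ⟨⟨y, hy, hyx⟩, -⟩ := h.bond_inter_bond b b' hb ⟨x.2, hv ▸ x'.2⟩
  rwa [← Subtype.ext hyx]

lemma exists_cell_of_boundary (hc : 0 < c) (hc1 : c < 1) {b : B} {x : (bond b).carrier}
    (hx : x ∈ (bond b).boundary) :
    ∃ i, ∃ y : H, (y : Plane) ∈ K.boundarySet ∧ h.bondIncl b x = h.cellMap i y := by
  have : (x : Plane) ∈ (bond b).boundarySet := ⟨x, hx, rfl⟩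
  rw [h.bond_boundary] at this
  obtain ⟨i, -, y, hy, hyx⟩ := mem_iUnion₂.1 this.2
  exact ⟨i, ⟨y, h.boundarySet_subset hc hc1 hy⟩, hy, Subtype.ext hyx.symm⟩

lemma exists_fixing {x : H} (hx : (x : Plane) ∈ K.boundarySet) :
    ∃ i, h.cellMap i x = x := by
  obtain ⟨p, hp, hpx⟩ := hx
  obtain ⟨i, hi, -⟩ := SierpinskiLike.exists_fixing hp
  refine ⟨i, Subtype.ext ?_⟩
  change K.shrunkSim c i x = x
  rw [← hpx, hi, K.shrunkSim_fixedPt]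

lemma eventually_of_pieces (hc : 0 < c) [Finite B] {P : H → H → Prop}
    (hcell : ∀ i y, ∀ᶠ y' in 𝓝 y, P (h.cellMap i y) (h.cellMap i y'))
    (hbond : ∀ b y, ∀ᶠ y' in 𝓝 y, P (h.bondIncl b y) (h.bondIncl b y')) (x : H) :
    ∀ᶠ x' in 𝓝 x, P x x' := by
  have h1 := eventually_all.2 fun i =>
    (h.isClosedEmbedding_cellMap hc i).eventually_range (hcell i) x
  have h2 := eventually_all.2 fun b =>
    (h.isClosedEmbedding_bondIncl b).eventually_range (hbond b) x
  filter_upwards [h1, h2] with x' h1 h2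
  rcases h.cover x' with ⟨i, y, hy⟩ | ⟨b, y, hy⟩
  · exact h1 i ⟨y, hy⟩
  · exact h2 b ⟨y, hy⟩

lemma continuous_of_pieces (hc : 0 < c) [Finite B] {u : H → ℝ}
    (hcell : ∀ i, Continuous (u ∘ h.cellMap i)) (hbond : ∀ b, Continuous (u ∘ h.bondIncl b)) :
    Continuous u := by
  rw [continuous_real_iff_eventually]
  intro ε hε
  exact h.eventually_of_pieces hc
    (fun i => continuous_real_iff_eventually.1 (hcell i) ε hε)
    fun b => continuous_real_iff_eventually.1 (hbond b) ε hε

/-- Gluing of functions on the cells and bonds. -/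
lemma exists_glue (hc : 0 < c) (hc1 : c < 1) (g : Fin K.N → H → ℝ)
    (a : ∀ b, (bond b).carrier → ℝ)
    (hga : ∀ b x i y, h.bondIncl b x = h.cellMap i y → a b x = g i y) :
    ∃ v : H → ℝ, (∀ i, v ∘ h.cellMap i = g i) ∧ ∀ b, v ∘ h.bondIncl b = a b := by
  classical
  have key : ∀ x : H, ∃ t : ℝ, (∀ i y, h.cellMap i y = x → g i y = t) ∧
      ∀ b y, h.bondIncl b y = x → a b y = t := by
    intro x
    by_cases hx : ∃ i y, h.cellMap i y = x
    · obtain ⟨i, y, rfl⟩ := hx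
      refine ⟨g i y, fun j z hz => ?_, fun b z hz => hga b z i y hz⟩
      obtain rfl := h.index_eq hz
      rw [h.cellMap_injective hc j hz]
    · obtain ⟨b, y, rfl⟩ := (h.cover x).resolve_left hx
      refine ⟨a b y, fun i z hz => absurd ⟨i, z, hz⟩ hx, fun b' z hz => ?_⟩
      by_cases hb : b = b'
      · subst hb
        rw [h.bondIncl_injective b hz]
      -- A common point of two bonds is a boundary point, hence lies in a cell, which this case
      -- excludes.
      · obtain ⟨i, w, -, hw⟩ := h.exists_cell_of_boundary hc hc1 (h.bond_bond hb hz.symm)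
        exact absurd ⟨i, w, hw.symm⟩ hx
  choose v hv1 hv2 using key
  exact ⟨v, fun i => funext fun y => (hv1 _ i y rfl).symm, fun b => funext fun y => (hv2 _ b y rfl).symm⟩

variable [Fintype B] {D : ∀ b, Matrix (bond b).boundary (bond b).boundary ℝ}
  {ρ : ∀ b, Fin (bond b).N → ℝ}

/-- Gluing of functions on the cells and bonds that nearly match: the functions on the bonds are
corrected, at a controlled cost. -/
lemma exists_glue_lift (hc : 0 < c) (hc1 : c < 1)
    (hD : ∀ b, (bond b).IsRegularHarmonicStructure (D b) (ρ b)) :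
    ∃ C : ℝ, 0 < C ∧ ∀ (g : Fin K.N → H → ℝ) (a : ∀ b, (bond b).carrier → ℝ) (M : ℝ), 0 ≤ M →
      (∀ b, a b ∈ (bond b).domain (D b) (ρ b)) →
      (∀ b x i y, h.bondIncl b x = h.cellMap i y → (y : Plane) ∈ K.boundarySet →
        |g i y - a b x| ≤ M) →
      ∃ v : H → ℝ, (∀ i, v ∘ h.cellMap i = g i) ∧ ∀ b,
        v ∘ h.bondIncl b ∈ (bond b).domain (D b) (ρ b) ∧
        (∀ x, |v (h.bondIncl b x) - a b x| ≤ C * M) ∧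
        (bond b).energy (D b) (ρ b) (v ∘ h.bondIncl b) (v ∘ h.bondIncl b)
          ≤ 2 * (bond b).energy (D b) (ρ b) (a b) (a b) + C * M ^ 2 := by
  classical
  choose C' hC' hl using fun b => (hD b).exists_lift
  obtain ⟨C, hC, hCC⟩ := exists_pos_forall_le C'
  refine ⟨2 * C, by positivity, fun g a M hM ha hga => ?_⟩
  choose I Y hYV hIY using fun b (x : (bond b).boundary) => h.exists_cell_of_boundary hc hc1 x.2
  have hlb : ∀ b, ∃ l ∈ (bond b).domain (D b) (ρ b),
      (∀ x : (bond b).boundary, l x.1 = g (I b x) (Y b x) - a b x.1) ∧ (∀ x, |l x| ≤ C' b * M) ∧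
      (bond b).energy (D b) (ρ b) l l ≤ C' b * M ^ 2 := by
    intro b
    -- The mismatch at the ends of the bond, to be lifted and added to `a b`; the value zero
    -- elsewhere plays no role.
    let f : (bond b).carrier → ℝ := fun x =>
      if hx : x ∈ (bond b).boundary then g (I b ⟨x, hx⟩) (Y b ⟨x, hx⟩) - a b x else 0
    have hf : ∀ x : (bond b).boundary, f x.1 = g (I b x) (Y b x) - a b x.1 := fun x => dif_pos x.2
    obtain ⟨l, hl1, hl2, hl3⟩ := hl b f M fun p hp => by
      rw [hf ⟨p, hp⟩]; exact hga b p _ _ (hIY b ⟨p, hp⟩) (hYV b ⟨p, hp⟩)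
    exact ⟨l, hl1, fun x => (hl2 x.1 x.2).trans (hf x), hl3⟩
  choose l hl1 hl2 hl3 hl4 using hlb
  obtain ⟨v, hv1, hv2⟩ := h.exists_glue hc hc1 g (fun b => a b + l b) (by
    intro b x i y hxy
    have hx := (h.bond_cell hc hxy).1
    have h1 := hIY b ⟨x, hx⟩
    obtain rfl := h.index_eq (hxy.symm.trans h1)
    rw [h.cellMap_injective hc _ (hxy.symm.trans h1), Pi.add_apply, hl2 b ⟨x, hx⟩]
    ring)
  refine ⟨v, hv1, fun b => ⟨?_, fun x => ?_, ?_⟩⟩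
  · rw [hv2]; exact (hD b).add_mem (ha b) (hl1 b)
  · have : v (h.bondIncl b x) = a b x + l b x := congrFun (hv2 b) x
    rw [this, add_sub_cancel_left]
    have := mul_le_mul_of_nonneg_right (hCC b) hM
    have := hl3 b x
    have : 0 ≤ C * M := by positivity
    linarith
  · rw [hv2]
    have h1 := (hD b).isFormSeq.lim_add_le (ha b).2 (hl1 b).2
    have h2 := hl4 b
    have h3 := mul_le_mul_of_nonneg_right (hCC b) (sq_nonneg M)
    simp only [← PCFSet.energy_eq_formLim] at h1
    linarith

/-- The total energy on the bonds of level zero. -/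
noncomputable def bondEnergy (h : IsHybrid K c bond att H)
    (D : ∀ b, Matrix (bond b).boundary (bond b).boundary ℝ) (ρ : ∀ b, Fin (bond b).N → ℝ)
    (u v : H → ℝ) : ℝ :=
  ∑ b, (bond b).energy (D b) (ρ b) (u ∘ h.bondIncl b) (v ∘ h.bondIncl b)

lemma energy_le_bondEnergy (hD : ∀ b, (bond b).IsRegularHarmonicStructure (D b) (ρ b))
    {u : H → ℝ} (hu : ∀ b, u ∘ h.bondIncl b ∈ (bond b).domain (D b) (ρ b)) (b : B) :
    (bond b).energy (D b) (ρ b) (u ∘ h.bondIncl b) (u ∘ h.bondIncl b) ≤ h.bondEnergy D ρ u u :=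
  Finset.single_le_sum (f := fun b =>
    (bond b).energy (D b) (ρ b) (u ∘ h.bondIncl b) (u ∘ h.bondIncl b))
    (fun b _ => (hD b).energy_nonneg (hu b)) (Finset.mem_univ b)

lemma bondEnergy_nonneg (hD : ∀ b, (bond b).IsRegularHarmonicStructure (D b) (ρ b))
    {u : H → ℝ} (hu : ∀ b, u ∘ h.bondIncl b ∈ (bond b).domain (D b) (ρ b)) :
    0 ≤ h.bondEnergy D ρ u u :=
  Finset.sum_nonneg fun b _ => (hD b).energy_nonneg (hu b)

lemma exists_bond_bound (hD : ∀ b, (bond b).IsRegularHarmonicStructure (D b) (ρ b)) :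
    ∃ C > 0, ∀ u : H → ℝ, (∀ b, u ∘ h.bondIncl b ∈ (bond b).domain (D b) (ρ b)) →
      ∀ b x y, |u (h.bondIncl b x) - u (h.bondIncl b y)| ≤ C * √(h.bondEnergy D ρ u u) := by
  choose C' hC' hb using fun b => (hD b).exists_osc_bound
  obtain ⟨C, hC, hCC⟩ := exists_pos_forall_le C'
  refine ⟨C, hC, fun u hu b x y => (hb b _ (hu b) x y).trans ?_⟩
  exact mul_le_mul (hCC b) (Real.sqrt_le_sqrt (h.energy_le_bondEnergy hD hu b))
    (Real.sqrt_nonneg _) hC.le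

/-- Junction points of the base are joined by bonds of bounded resistance. -/
lemma exists_junction_bound (hc : 0 < c) (hc1 : c < 1)
    (hD : ∀ b, (bond b).IsRegularHarmonicStructure (D b) (ρ b)) :
    ∃ C > 0, ∀ u : H → ℝ, (∀ b, u ∘ h.bondIncl b ∈ (bond b).domain (D b) (ρ b)) →
      ∀ i j, ∀ p q : H, (p : Plane) ∈ K.boundarySet → (q : Plane) ∈ K.boundarySet →
        K.sim i p = K.sim j q →
        |u (h.cellMap i p) - u (h.cellMap j q)| ≤ C * √(h.bondEnergy D ρ u u) := by
  obtain ⟨C₀, hC₀, hb⟩ := h.exists_bond_bound hD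
  -- Each chain of bonds has its own constant; there are finitely many quadruples, so a common one
  -- exists. For quadruples that are not junctions the claim is void.
  have key : ∀ t : Fin K.N × Fin K.N × K.boundary × K.boundary, ∃ C : ℝ,
      K.sim t.1 t.2.2.1 = K.sim t.2.1 t.2.2.2 →
      ∀ u : H → ℝ, (∀ b, u ∘ h.bondIncl b ∈ (bond b).domain (D b) (ρ b)) →
      ∀ p q : H, (p : Plane) = t.2.2.1 → (q : Plane) = t.2.2.2 →
        |u (h.cellMap t.1 p) - u (h.cellMap t.2.1 q)| ≤ C * √(h.bondEnergy D ρ u u) := by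
    rintro ⟨i, j, p, q⟩
    by_cases hpq : K.sim i p = K.sim j q
    swap
    · exact ⟨0, fun h => absurd h hpq⟩
    have hp : (p.1 : Plane) ∈ K.boundarySet := ⟨p, p.2, rfl⟩
    have hq : (q.1 : Plane) ∈ K.boundarySet := ⟨q, q.2, rfl⟩
    have hstart : K.shrunkSim c i p ∈ H := h.cellMap_mem i (h.boundarySet_subset hc hc1 hp)
    have hchain : ∀ y, Relation.ReflTransGen
        (fun x y => ∃ b, x ∈ (bond b).boundarySet ∧ y ∈ (bond b).boundarySet)
        (K.shrunkSim c i p) y → ∃ hy : y ∈ H, ∃ C : ℝ, ∀ u : H → ℝ,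
          (∀ b, u ∘ h.bondIncl b ∈ (bond b).domain (D b) (ρ b)) →
          |u ⟨_, hstart⟩ - u ⟨y, hy⟩| ≤ C * √(h.bondEnergy D ρ u u) := by
      intro y hy
      induction hy with
      | refl => exact ⟨hstart, 0, fun u _ => by simp⟩
      | tail _ hstep ih =>
        obtain ⟨hy, C, hC⟩ := ih
        obtain ⟨b, ⟨y', hy', rfl⟩, ⟨z, hz, rfl⟩⟩ := hstep
        refine ⟨(h.bondIncl b z).2, C + C₀, fun u hu => ?_⟩
        have h1 := hC u hu
        have h2 := hb u hu b y' z
        have h3 := abs_sub_le (u ⟨_, hstart⟩) (u (h.bondIncl b y')) (u (h.bondIncl b z))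
        rw [add_mul]
        exact h3.trans (add_le_add h1 h2)
    obtain ⟨hy, C, hC⟩ := hchain _ (h.junction i j p hp q hq hpq)
    refine ⟨C, fun _ u hu p' q' hp' hq' => ?_⟩
    obtain ⟨p', hpm⟩ := p'
    obtain ⟨q', hqm⟩ := q'
    obtain rfl : p' = _ := hp'
    obtain rfl : q' = _ := hq'
    exact hC u hu
  choose C' hC' using key
  obtain ⟨C, hC, hCC⟩ := exists_pos_forall_le C'
  refine ⟨C, hC, fun u hu i j p q ⟨p', hp', hpp⟩ ⟨q', hq', hqq⟩ hpq => ?_⟩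
  refine (hC' ⟨i, j, ⟨p', hp'⟩, ⟨q', hq'⟩⟩ ?_ u hu p q hpp.symm hqq.symm).trans
    (mul_le_mul_of_nonneg_right (hCC _) (Real.sqrt_nonneg _))
  change K.sim i p' = K.sim j q'
  rw [hpp, hqq, hpq]

end IsHybrid

/-! ### Renormalisation on the vertices -/

namespace IsHybrid

variable {K : SierpinskiLike} {c : ℝ} {B : Type*} {bond : B → PCFSet}
  {att : B → Finset (Fin K.N)} {H : Set Plane} (h : IsHybrid K c bond att H)

open Classical in
/-- The restriction of a function on the hybrid to the base, extended by zero. -/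
noncomputable def onBase (_ : IsHybrid K c bond att H) (u : H → ℝ) (x : K.carrier) : ℝ :=
  if hx : (x : Plane) ∈ H then u ⟨x, hx⟩ else 0

lemma onBase_apply (u : H → ℝ) {x : K.carrier} {y : H} (hxy : (x : Plane) = y) :
    h.onBase u x = u y := by
  obtain ⟨y, hy⟩ := y
  obtain rfl : (x : Plane) = y := hxy
  exact dif_pos hy

variable [Fintype B] {D : ∀ b, Matrix (bond b).boundary (bond b).boundary ℝ}
  {ρ : ∀ b, Fin (bond b).N → ℝ}

/-- The renormalisation estimate: the energy of the values at the vertices is bounded by that of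
the values at the vertices of the cells, scaled by `r`, and the energy on the bonds. -/
lemma exists_renormalisation_bound (hc : 0 < c) (hc1 : c < 1)
    (hD : ∀ b, (bond b).IsRegularHarmonicStructure (D b) (ρ b)) {rK r : ℝ}
    (hrK : K.IsHarmonicStructure K.symmLaplacian fun _ => rK) (hr : 0 < r) (hrr : r < rK) :
    ∃ C > 0, ∀ u : H → ℝ, (∀ b, u ∘ h.bondIncl b ∈ (bond b).domain (D b) (ρ b)) →
      K.levelEnergy K.symmLaplacian (fun _ => rK) 0 (h.onBase u) (h.onBase u) ≤
        ∑ i, r⁻¹ * K.levelEnergy K.symmLaplacian (fun _ => rK) 0 (h.onBase (u ∘ h.cellMap i))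
          (h.onBase (u ∘ h.cellMap i)) + C * h.bondEnergy D ρ u u := by
  classical
  obtain ⟨C, hC, hj⟩ := h.exists_junction_bound hc hc1 hD
  obtain ⟨C₁, hC₁, hf⟩ := hrK.laplacian.exists_form_le
  have hrKpos : 0 < rK := hr.trans hrr
  -- The slack between `r` and `rK`: with this choice `rK⁻¹ * (1 + t) = r⁻¹`.
  set t := rK / r - 1 with ht
  have htpos : 0 < t := by rw [ht, sub_pos, one_lt_div hr]; exact hrr
  refine ⟨∑ _i : Fin K.N, rK⁻¹ * ((1 + t⁻¹) * (C₁ * (2 * C) ^ 2)) + 1, by positivity,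
    fun u hu => ?_⟩
  have hE := h.bondEnergy_nonneg hD hu
  have hvtx : ∀ p ∈ K.boundary, (p : Plane) ∈ H := fun p hp =>
    h.boundarySet_subset hc hc1 ⟨p, hp, rfl⟩
  -- A junction of the base corresponds to several vertices in the hybrid; `g` picks the value of
  -- `u` at one of them, and the junction bound controls the others. On the boundary `g` keeps the
  -- value of `u`, so the level zero energies agree.
  let g : K.carrier → ℝ := fun x =>
    if x ∈ K.boundary then h.onBase u x else
      if hx : ∃ ip : Fin K.N × K.boundary, K.map ip.1 ip.2 = x then
        u (h.cellMap hx.choose.1 ⟨_, hvtx _ hx.choose.2.2⟩) else 0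
  have hg : ∀ i, ∀ p (hp : p ∈ K.boundary),
      |g (K.map i p) - u (h.cellMap i ⟨p, hvtx p hp⟩)| ≤ C * √(h.bondEnergy D ρ u u) := by
    intro i p hp
    by_cases hb : K.map i p ∈ K.boundary
    · obtain ⟨j, hj1, hj2⟩ := SierpinskiLike.exists_fixing hb
      have h1 : g (K.map i p) = u (h.cellMap j ⟨_, hvtx _ hb⟩) := by
        simp only [g, if_pos hb]
        refine h.onBase_apply u ?_
        change _ = K.shrunkSim c j (K.map i p)
        rw [hj1, K.shrunkSim_fixedPt]
      rw [h1]
      refine hj u hu j i _ _ ⟨_, hb, rfl⟩ ⟨_, hp, rfl⟩ ?_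
      change K.sim j (K.map i p) = K.sim i p
      rw [hj1, K.sim_fixedPt, ← hj1, K.map_eq_sim]
    · have hx : ∃ ip : Fin K.N × K.boundary, K.map ip.1 ip.2 = K.map i p := ⟨(i, ⟨p, hp⟩), rfl⟩
      have h1 : g (K.map i p) = u (h.cellMap hx.choose.1 ⟨_, hvtx _ hx.choose.2.2⟩) := by
        simp only [g, if_neg hb, dif_pos hx]
      rw [h1]
      refine hj u hu _ _ _ _ ⟨_, hx.choose.2.2, rfl⟩ ⟨_, hp, rfl⟩ ?_
      change K.sim hx.choose.1 hx.choose.2 = K.sim i p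
      rw [← K.map_eq_sim, ← K.map_eq_sim, hx.choose_spec]
  have hcell : ∀ i, K.levelEnergy K.symmLaplacian (fun _ => rK) 0 (g ∘ K.map i) (g ∘ K.map i) ≤
      (1 + t) * K.levelEnergy K.symmLaplacian (fun _ => rK) 0 (h.onBase (u ∘ h.cellMap i))
        (h.onBase (u ∘ h.cellMap i)) +
      (1 + t⁻¹) * (C₁ * (2 * C) ^ 2) * h.bondEnergy D ρ u u := by
    intro i
    have h1 := hrK.isFormSeq.diag_add_le 0 (h.onBase (u ∘ h.cellMap i))
      (g ∘ K.map i - h.onBase (u ∘ h.cellMap i)) htpos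
    rw [add_sub_cancel] at h1
    refine h1.trans (add_le_add le_rfl ?_)
    rw [mul_assoc]
    refine mul_le_mul_of_nonneg_left ?_ (by positivity)
    have h2 : ∀ p : K.boundary, |(g ∘ K.map i - h.onBase (u ∘ h.cellMap i)) p.1|
        ≤ C * √(h.bondEnergy D ρ u u) := by
      intro p
      rw [Pi.sub_apply, h.onBase_apply (u ∘ h.cellMap i) (y := ⟨p.1, hvtx p.1 p.2⟩) rfl]
      exact hg i p.1 p.2
    rw [PCFSet.levelEnergy_zero]
    refine (hf _ (2 * (C * √(h.bondEnergy D ρ u u))) fun p q => ?_).trans_eq ?_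
    · have h3 := h2 p
      have h4 := h2 q
      rw [abs_le] at *
      constructor <;> linarith
    · rw [mul_pow, mul_pow, mul_pow, Real.sq_sqrt hE]; ring
  have h0 : K.levelEnergy K.symmLaplacian (fun _ => rK) 0 (h.onBase u) (h.onBase u)
      = K.levelEnergy K.symmLaplacian (fun _ => rK) 0 g g :=
    PCFSet.levelEnergy_congr fun p hp => by simp only [g, if_pos hp]
  have hrt : rK⁻¹ * (1 + t) = r⁻¹ := by
    rw [ht, add_sub_cancel]; field_simp
  calc _ = K.levelEnergy K.symmLaplacian (fun _ => rK) 0 g g := h0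
    _ ≤ K.levelEnergy K.symmLaplacian (fun _ => rK) 1 g g := hrK.isFormSeq.mono 0 g
    _ = ∑ i, rK⁻¹ * K.levelEnergy K.symmLaplacian (fun _ => rK) 0 (g ∘ K.map i) (g ∘ K.map i) :=
      PCFSet.levelEnergy_succ _ _ _ _ _
    _ ≤ ∑ i, rK⁻¹ * ((1 + t) * K.levelEnergy K.symmLaplacian (fun _ => rK) 0
          (h.onBase (u ∘ h.cellMap i)) (h.onBase (u ∘ h.cellMap i)) +
        (1 + t⁻¹) * (C₁ * (2 * C) ^ 2) * h.bondEnergy D ρ u u) :=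
      Finset.sum_le_sum fun i _ => mul_le_mul_of_nonneg_left (hcell i) (by positivity)
    _ = ∑ i, r⁻¹ * K.levelEnergy K.symmLaplacian (fun _ => rK) 0 (h.onBase (u ∘ h.cellMap i))
          (h.onBase (u ∘ h.cellMap i)) +
        (∑ _i : Fin K.N, rK⁻¹ * ((1 + t⁻¹) * (C₁ * (2 * C) ^ 2))) * h.bondEnergy D ρ u u := by
      rw [Finset.sum_mul, ← Finset.sum_add_distrib]
      refine Finset.sum_congr rfl fun i _ => ?_
      rw [← hrt]; ring
    _ ≤ _ := by rw [add_mul, one_mul]; linarith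

/-! ### Approximating forms and cellwise constant functions -/

/-- The graph energies that approximate the energy of the hybrid. -/
noncomputable def graphForm (h : IsHybrid K c bond att H)
    (D : ∀ b, Matrix (bond b).boundary (bond b).boundary ℝ) (ρ : ∀ b, Fin (bond b).N → ℝ)
    (r : ℝ) : ℕ → (H → ℝ) → (H → ℝ) → ℝ
  -- With this start, the bonds inside cells of word length `k` enter the form of index `n` with
  -- graph level `n - 1 - k`: new bonds appear and old ones are refined at the same time.
  | 0, _, _ => 0
  | n + 1, u, v =>
    ∑ b, (bond b).levelEnergy (D b) (ρ b) n (u ∘ h.bondIncl b) (v ∘ h.bondIncl b) +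
      ∑ i, r⁻¹ * graphForm h D ρ r n (u ∘ h.cellMap i) (v ∘ h.cellMap i)

variable {r : ℝ}

lemma graphForm_isFormSeq (hD : ∀ b, (bond b).IsRegularHarmonicStructure (D b) (ρ b))
    (hr : 0 < r) : IsFormSeq (h.graphForm D ρ r) where
  add_left n := by
    induction n with
    | zero => intro u v w; simp [graphForm]
    | succ n ih =>
      intro u v w
      have h1 : ∀ b, (bond b).levelEnergy (D b) (ρ b) n ((u + v) ∘ h.bondIncl b) (w ∘ h.bondIncl b)
          = (bond b).levelEnergy (D b) (ρ b) n (u ∘ h.bondIncl b) (w ∘ h.bondIncl b) +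
            (bond b).levelEnergy (D b) (ρ b) n (v ∘ h.bondIncl b) (w ∘ h.bondIncl b) := fun b =>
        (hD b).isFormSeq.add_left n _ _ _
      have h2 : ∀ i, h.graphForm D ρ r n ((u + v) ∘ h.cellMap i) (w ∘ h.cellMap i)
          = h.graphForm D ρ r n (u ∘ h.cellMap i) (w ∘ h.cellMap i) +
            h.graphForm D ρ r n (v ∘ h.cellMap i) (w ∘ h.cellMap i) := fun i => ih _ _ _
      simp only [graphForm, h1, h2, mul_add, Finset.sum_add_distrib]
      ring
  smul_left n := by
    induction n with
    | zero => intro a u v; simp [graphForm]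
    | succ n ih =>
      intro a u v
      have h1 : ∀ b, (bond b).levelEnergy (D b) (ρ b) n ((a • u) ∘ h.bondIncl b) (v ∘ h.bondIncl b)
          = a * (bond b).levelEnergy (D b) (ρ b) n (u ∘ h.bondIncl b) (v ∘ h.bondIncl b) :=
        fun b => (hD b).isFormSeq.smul_left n _ _ _
      have h2 : ∀ i, h.graphForm D ρ r n ((a • u) ∘ h.cellMap i) (v ∘ h.cellMap i)
          = a * h.graphForm D ρ r n (u ∘ h.cellMap i) (v ∘ h.cellMap i) := fun i => ih _ _ _
      simp only [graphForm, h1, h2, mul_add, Finset.mul_sum, mul_left_comm a]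
  symm n := by
    induction n with
    | zero => intro u v; rfl
    | succ n ih =>
      intro u v
      simp only [graphForm, ih (u ∘ _), fun b => (hD b).isFormSeq.symm n (u ∘ h.bondIncl b)]
  nonneg n := by
    induction n with
    | zero => intro u; exact le_rfl
    | succ n ih =>
      intro u
      exact add_nonneg (Finset.sum_nonneg fun b _ => (hD b).isFormSeq.nonneg n _)
        (Finset.sum_nonneg fun i _ => mul_nonneg (inv_nonneg.2 hr.le) (ih _))
  mono n := by
    induction n with
    | zero =>
      intro u
      refine add_nonneg (Finset.sum_nonneg fun b _ => (hD b).isFormSeq.nonneg 0 _)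
        (Finset.sum_nonneg fun i _ => ?_)
      simp [graphForm]
    | succ n ih =>
      intro u
      exact add_le_add (Finset.sum_le_sum fun b _ => (hD b).isFormSeq.mono n _)
        (Finset.sum_le_sum fun i _ => mul_le_mul_of_nonneg_left (ih _) (inv_nonneg.2 hr.le))

lemma graphForm_contraction (hD : ∀ b, (bond b).IsRegularHarmonicStructure (D b) (ρ b))
    (hr : 0 < r) {φ : ℝ → ℝ} (hφ : ∀ a b, |φ a - φ b| ≤ |a - b|) (n : ℕ) :
    ∀ u : H → ℝ, h.graphForm D ρ r n (φ ∘ u) (φ ∘ u) ≤ h.graphForm D ρ r n u u := by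
  induction n with
  | zero => intro u; exact le_rfl
  | succ n ih =>
    intro u
    exact add_le_add
      (Finset.sum_le_sum fun b _ => (hD b).levelEnergy_contraction hφ n (u ∘ h.bondIncl b))
      (Finset.sum_le_sum fun i _ =>
        mul_le_mul_of_nonneg_left (ih (u ∘ h.cellMap i)) (inv_nonneg.2 hr.le))

lemma tendsto_graphForm (n : ℕ) : ∀ (us : ℕ → H → ℝ) (u : H → ℝ),
    (∀ x, Tendsto (fun j => us j x) atTop (𝓝 (u x))) →
    Tendsto (fun j => h.graphForm D ρ r n (us j) (us j)) atTop (𝓝 (h.graphForm D ρ r n u u)) := by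
  induction n with
  | zero => intro us u _; exact tendsto_const_nhds
  | succ n ih =>
    intro us u hu
    exact (tendsto_finsetSum _ fun b _ => PCFSet.tendsto_levelEnergy _ _ n
      (fun j => us j ∘ h.bondIncl b) _ fun x => hu _).add
      (tendsto_finsetSum _ fun i _ => (ih (fun j => us j ∘ h.cellMap i) _ fun x => hu _).const_mul _)

lemma graphForm_const (hD : ∀ b, (bond b).IsRegularHarmonicStructure (D b) (ρ b)) (n : ℕ) :
    ∀ a : ℝ, h.graphForm D ρ r n (fun _ => a) (fun _ => a) = 0 := by
  induction n with
  | zero => intro a; rfl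
  | succ n ih =>
    intro a
    have h1 : ∀ b, (bond b).levelEnergy (D b) (ρ b) n ((fun _ => a) ∘ h.bondIncl b)
        ((fun _ => a) ∘ h.bondIncl b) = 0 := fun b => (hD b).levelEnergy_const n a
    have h2 : ∀ i, h.graphForm D ρ r n ((fun _ => a) ∘ h.cellMap i)
        ((fun _ => a) ∘ h.cellMap i) = 0 := fun i => ih a
    simp [graphForm, h1, h2]

/-- The functions of bounded graph energy, without any continuity. -/
abbrev finDom (h : IsHybrid K c bond att H)
    (D : ∀ b, Matrix (bond b).boundary (bond b).boundary ℝ) (ρ : ∀ b, Fin (bond b).N → ℝ)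
    (r : ℝ) : Set (H → ℝ) := formDom (h.graphForm D ρ r)

/-- The limit of the graph energies. -/
noncomputable abbrev limForm (h : IsHybrid K c bond att H)
    (D : ∀ b, Matrix (bond b).boundary (bond b).boundary ℝ) (ρ : ∀ b, Fin (bond b).N → ℝ)
    (r : ℝ) (u v : H → ℝ) : ℝ := formLim (h.graphForm D ρ r) u v

section

variable (hD : ∀ b, (bond b).IsRegularHarmonicStructure (D b) (ρ b)) (hr : 0 < r)
include hD hr

lemma comp_cellMap_mem {u : H → ℝ} (hu : u ∈ h.finDom D ρ r) (i : Fin K.N) :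
    u ∘ h.cellMap i ∈ h.finDom D ρ r ∧
      h.limForm D ρ r (u ∘ h.cellMap i) (u ∘ h.cellMap i) ≤ r * h.limForm D ρ r u u := by
  have hA := h.graphForm_isFormSeq hD hr
  refine hA.lim_le fun n => ?_
  have h1 := hA.le_lim hu (n + 1)
  have h2 := Finset.single_le_sum (f := fun i =>
    r⁻¹ * h.graphForm D ρ r n (u ∘ h.cellMap i) (u ∘ h.cellMap i))
    (fun i _ => mul_nonneg (inv_nonneg.2 hr.le) (hA.nonneg _ _)) (Finset.mem_univ i)
  have h3 : 0 ≤ ∑ b, (bond b).levelEnergy (D b) (ρ b) n (u ∘ h.bondIncl b) (u ∘ h.bondIncl b) :=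
    Finset.sum_nonneg fun b _ => (hD b).isFormSeq.nonneg n _
  rw [← inv_mul_le_iff₀ hr]
  simp only [graphForm] at h1 h2
  linarith

lemma comp_bondIncl_mem {u : H → ℝ} (hu : u ∈ h.finDom D ρ r) (b : B) :
    u ∘ h.bondIncl b ∈ formDom ((bond b).levelEnergy (D b) (ρ b)) := by
  have hA := h.graphForm_isFormSeq hD hr
  refine ((hD b).isFormSeq.lim_le (C := h.limForm D ρ r u u) fun n => ?_).1
  have h1 := hA.le_lim hu (n + 1)
  have h2 := Finset.single_le_sum (f := fun b =>
    (bond b).levelEnergy (D b) (ρ b) n (u ∘ h.bondIncl b) (u ∘ h.bondIncl b))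
    (fun b _ => (hD b).isFormSeq.nonneg n _) (Finset.mem_univ b)
  have h3 : 0 ≤ ∑ i, r⁻¹ * h.graphForm D ρ r n (u ∘ h.cellMap i) (u ∘ h.cellMap i) :=
    Finset.sum_nonneg fun i _ => mul_nonneg (inv_nonneg.2 hr.le) (hA.nonneg _ _)
  simp only [graphForm] at h1 h2
  linarith

lemma mem_finDom_of_pieces {u : H → ℝ} (hcell : ∀ i, u ∘ h.cellMap i ∈ h.finDom D ρ r)
    (hbond : ∀ b, u ∘ h.bondIncl b ∈ formDom ((bond b).levelEnergy (D b) (ρ b))) :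
    u ∈ h.finDom D ρ r := by
  have hA := h.graphForm_isFormSeq hD hr
  refine (hA.lim_le (C := h.bondEnergy D ρ u u + ∑ i, r⁻¹ *
    h.limForm D ρ r (u ∘ h.cellMap i) (u ∘ h.cellMap i)) fun n => ?_).1
  refine (hA.mono n u).trans (add_le_add (Finset.sum_le_sum fun b _ => ?_)
    (Finset.sum_le_sum fun i _ => mul_le_mul_of_nonneg_left ?_ (inv_nonneg.2 hr.le)))
  · exact (hD b).isFormSeq.le_lim (hbond b) n
  · exact hA.le_lim (hcell i) n

lemma limForm_eq {u v : H → ℝ} (hu : u ∈ h.finDom D ρ r) (hv : v ∈ h.finDom D ρ r) :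
    h.limForm D ρ r u v = h.bondEnergy D ρ u v +
      ∑ i, r⁻¹ * h.limForm D ρ r (u ∘ h.cellMap i) (v ∘ h.cellMap i) := by
  have hA := h.graphForm_isFormSeq hD hr
  refine tendsto_nhds_unique ((tendsto_add_atTop_iff_nat 1).2 (hA.tendsto hu hv)) ?_
  exact (tendsto_finsetSum _ fun b _ => (hD b).isFormSeq.tendsto
      (h.comp_bondIncl_mem hD hr hu b) (h.comp_bondIncl_mem hD hr hv b)).add
    (tendsto_finsetSum _ fun i _ => (hA.tendsto (h.comp_cellMap_mem hD hr hu i).1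
      (h.comp_cellMap_mem hD hr hv i).1).const_mul _)

lemma const_mem_finDom (a : ℝ) : (fun _ => a) ∈ h.finDom D ρ r ∧
    h.limForm D ρ r (fun _ => a) (fun _ => a) = 0 := by
  have hA := h.graphForm_isFormSeq hD hr
  have := hA.lim_le fun n => (h.graphForm_const (r := r) hD n a).le
  exact ⟨this.1, this.2.antisymm (hA.lim_nonneg this.1)⟩

end

/-- The functions that are constant on the cells of level `n` and whose restrictions to the bonds
of lower levels are in the domains of the energies of the bonds. -/
def IsCellConst (h : IsHybrid K c bond att H)
    (D : ∀ b, Matrix (bond b).boundary (bond b).boundary ℝ) (ρ : ∀ b, Fin (bond b).N → ℝ) :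
    ℕ → (H → ℝ) → Prop
  | 0, u => ∃ a, u = fun _ => a
  | n + 1, u => (∀ i, IsCellConst h D ρ n (u ∘ h.cellMap i)) ∧
      ∀ b, u ∘ h.bondIncl b ∈ (bond b).domain (D b) (ρ b)

namespace IsCellConst

variable {h} (hD : ∀ b, (bond b).IsRegularHarmonicStructure (D b) (ρ b))
include hD

omit [Fintype B] in
lemma const (n : ℕ) : ∀ a : ℝ, h.IsCellConst D ρ n fun _ => a := by
  induction n with
  | zero => exact fun a => ⟨a, rfl⟩
  | succ n ih => exact fun a => ⟨fun i => ih a, fun b => (hD b).const_mem a⟩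

omit [Fintype B] in
lemma succ {n : ℕ} : ∀ {u : H → ℝ}, h.IsCellConst D ρ n u → h.IsCellConst D ρ (n + 1) u := by
  induction n with
  | zero => rintro u ⟨a, rfl⟩; exact const hD 1 a
  | succ n ih => exact fun hu => ⟨fun i => ih (hu.1 i), hu.2⟩

omit [Fintype B] in
lemma mono {m n : ℕ} (hmn : m ≤ n) {u : H → ℝ} (hu : h.IsCellConst D ρ m u) :
    h.IsCellConst D ρ n u := by
  induction hmn with
  | refl => exact hu
  | step _ ih => exact ih.succ hD

omit [Fintype B] in
lemma add_same {n : ℕ} : ∀ {u v : H → ℝ}, h.IsCellConst D ρ n u → h.IsCellConst D ρ n v →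
    h.IsCellConst D ρ n (u + v) := by
  induction n with
  | zero => rintro u v ⟨a, rfl⟩ ⟨b, rfl⟩; exact ⟨a + b, rfl⟩
  | succ n ih =>
    exact fun hu hv => ⟨fun i => ih (hu.1 i) (hv.1 i), fun b => (hD b).add_mem (hu.2 b) (hv.2 b)⟩

omit [Fintype B] in
lemma add {m n : ℕ} {u v : H → ℝ} (hu : h.IsCellConst D ρ m u) (hv : h.IsCellConst D ρ n v) :
    h.IsCellConst D ρ (max m n) (u + v) :=
  add_same hD (hu.mono hD (le_max_left _ _)) (hv.mono hD (le_max_right _ _))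

omit [Fintype B] in
lemma smul (a : ℝ) {n : ℕ} : ∀ {u : H → ℝ}, h.IsCellConst D ρ n u →
    h.IsCellConst D ρ n (a • u) := by
  induction n with
  | zero => rintro u ⟨b, rfl⟩; exact ⟨a * b, rfl⟩
  | succ n ih => exact fun hu => ⟨fun i => ih (hu.1 i), fun b => (hD b).smul_mem a (hu.2 b)⟩

omit [Fintype B] in
lemma sub {m n : ℕ} {u v : H → ℝ} (hu : h.IsCellConst D ρ m u) (hv : h.IsCellConst D ρ n v) :
    h.IsCellConst D ρ (max m n) (u - v) := by
  have := hu.add hD (hv.smul hD (-1))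
  rwa [neg_one_smul, ← sub_eq_add_neg] at this

omit [Fintype B] in
lemma contraction {φ : ℝ → ℝ} (hc : Continuous φ) (hφ : ∀ a b, |φ a - φ b| ≤ |a - b|) {n : ℕ} :
    ∀ {u : H → ℝ}, h.IsCellConst D ρ n u → h.IsCellConst D ρ n (φ ∘ u) := by
  induction n with
  | zero => rintro u ⟨b, rfl⟩; exact ⟨φ b, rfl⟩
  | succ n ih => exact fun hu => ⟨fun i => ih (hu.1 i), fun b => (hD b).contraction_mem hc hφ (hu.2 b)⟩

omit [Fintype B] in
lemma bond_mem {n : ℕ} {u : H → ℝ} (hu : h.IsCellConst D ρ n u) (b : B) :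
    u ∘ h.bondIncl b ∈ (bond b).domain (D b) (ρ b) := (hu.succ hD).2 b

omit hD in
lemma continuous (hc : 0 < c) {n : ℕ} : ∀ {u : H → ℝ}, h.IsCellConst D ρ n u → Continuous u := by
  induction n with
  | zero => rintro u ⟨b, rfl⟩; exact continuous_const
  | succ n ih =>
    exact fun hu => h.continuous_of_pieces hc (fun i => ih (hu.1 i)) fun b => (hu.2 b).1

lemma mem_finDom (hr : 0 < r) {n : ℕ} : ∀ {u : H → ℝ}, h.IsCellConst D ρ n u →
    u ∈ h.finDom D ρ r := by
  induction n with
  | zero => rintro u ⟨b, rfl⟩; exact (h.const_mem_finDom hD hr b).1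
  | succ n ih =>
    exact fun hu => h.mem_finDom_of_pieces hD hr (fun i => ih (hu.1 i)) fun b => (hu.2 b).2

end IsCellConst

section

variable (hc : 0 < c) (hc1 : c < 1)
  (hD : ∀ b, (bond b).IsRegularHarmonicStructure (D b) (ρ b)) {rK : ℝ}
  (hrK : K.IsHarmonicStructure K.symmLaplacian fun _ => rK) (hr : 0 < r) (hrr : r < rK)
include hc hc1 hD hrK hr hrr

/-- The effective resistance between vertices, for cellwise constant functions, is bounded. -/
lemma exists_vertex_bound : ∃ C > 0, ∀ (n : ℕ) (u : H → ℝ), h.IsCellConst D ρ n u →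
    ∀ p q : H, (p : Plane) ∈ K.boundarySet → (q : Plane) ∈ K.boundarySet →
      |u p - u q| ≤ C * √(h.limForm D ρ r u u) := by
  obtain ⟨C, hC, hren⟩ := h.exists_renormalisation_bound hc hc1 hD hrK hr hrr
  obtain ⟨C', hC', hP⟩ := hrK.laplacian.poincare
  -- The cell terms of the renormalisation bound carry exactly the factor `r⁻¹` of the energy and
  -- `C` multiplies only the bond term, so the same `C` survives every induction step.
  have key : ∀ (n : ℕ) (u : H → ℝ), h.IsCellConst D ρ n u →
      K.levelEnergy K.symmLaplacian (fun _ => rK) 0 (h.onBase u) (h.onBase u)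
        ≤ C * h.limForm D ρ r u u := by
    intro n
    induction n with
    | zero =>
      rintro u ⟨a, rfl⟩
      rw [(h.const_mem_finDom hD hr a).2, mul_zero,
        PCFSet.levelEnergy_congr (v := fun _ => a) fun p hp => h.onBase_apply (fun _ => a)
          (y := ⟨p, h.boundarySet_subset hc hc1 ⟨p, hp, rfl⟩⟩) rfl, hrK.levelEnergy_const]
    | succ n ih =>
      intro u hu
      have hud := hu.mem_finDom hD hr
      rw [h.limForm_eq hD hr hud hud, mul_add, add_comm, Finset.mul_sum]
      refine (hren u hu.2).trans (add_le_add (Finset.sum_le_sum fun i _ => ?_) le_rfl)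
      rw [mul_left_comm]
      exact mul_le_mul_of_nonneg_left (ih _ (hu.1 i)) (inv_nonneg.2 hr.le)
  refine ⟨C' * √C, by positivity, ?_⟩
  rintro n u hu p q ⟨p', hp', hpp⟩ ⟨q', hq', hqq⟩
  have h1 := hP (fun p : K.boundary => h.onBase u p.1) ⟨p', hp'⟩ ⟨q', hq'⟩
  rw [← PCFSet.levelEnergy_zero K.symmLaplacian fun _ => rK] at h1
  simp only [h.onBase_apply u hpp, h.onBase_apply u hqq] at h1
  refine h1.trans ?_
  rw [mul_assoc, ← Real.sqrt_mul hC.le]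
  exact mul_le_mul_of_nonneg_left (Real.sqrt_le_sqrt (key n u hu)) hC'.le

end

end IsHybrid

/-! ### Oscillation of cellwise constant functions -/

namespace IsHybrid

variable {K : SierpinskiLike} {c : ℝ} {B : Type*} {bond : B → PCFSet}
  {att : B → Finset (Fin K.N)} {H : Set Plane} (h : IsHybrid K c bond att H)
  [Fintype B] {D : ∀ b, Matrix (bond b).boundary (bond b).boundary ℝ}
  {ρ : ∀ b, Fin (bond b).N → ℝ} {r : ℝ}

section

variable (hD : ∀ b, (bond b).IsRegularHarmonicStructure (D b) (ρ b)) (hr : 0 < r)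
include hD hr

lemma bondEnergy_le_limForm {u : H → ℝ} (hu : u ∈ h.finDom D ρ r) :
    h.bondEnergy D ρ u u ≤ h.limForm D ρ r u u := by
  rw [h.limForm_eq hD hr hu hu]
  exact le_add_of_nonneg_right (Finset.sum_nonneg fun i _ => mul_nonneg (inv_nonneg.2 hr.le)
    ((h.graphForm_isFormSeq hD hr).lim_nonneg (h.comp_cellMap_mem hD hr hu i).1))

lemma sqrt_limForm_comp_le {u : H → ℝ} (hu : u ∈ h.finDom D ρ r) (i : Fin K.N) :
    √(h.limForm D ρ r (u ∘ h.cellMap i) (u ∘ h.cellMap i)) ≤ √r * √(h.limForm D ρ r u u) :=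
  sqrt_le_mul_sqrt (Real.sqrt_nonneg r) ((h.graphForm_isFormSeq hD hr).lim_nonneg hu)
    (Real.sq_sqrt hr.le).ge (h.comp_cellMap_mem hD hr hu i).2

end

section

variable (hc : 0 < c) (hc1 : c < 1)
  (hD : ∀ b, (bond b).IsRegularHarmonicStructure (D b) (ρ b)) {rK : ℝ}
  (hrK : K.IsHarmonicStructure K.symmLaplacian fun _ => rK) (hr : 0 < r) (hrr : r < rK)
include hc hc1 hD hrK hr hrr

/-- The vertices of all cells of the first level are joined by bounded resistances. -/
lemma exists_level_one_bound : ∃ C > 0, ∀ (n : ℕ) (u : H → ℝ), h.IsCellConst D ρ n u →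
    ∀ i j, ∀ p q : H, (p : Plane) ∈ K.boundarySet → (q : Plane) ∈ K.boundarySet →
      |u (h.cellMap i p) - u (h.cellMap j q)| ≤ C * √(h.limForm D ρ r u u) := by
  obtain ⟨C₁, hC₁, hv⟩ := h.exists_vertex_bound hc hc1 hD hrK hr hrr
  obtain ⟨C₂, hC₂, hj⟩ := h.exists_junction_bound hc hc1 hD
  have hcell : ∀ (n : ℕ) (u : H → ℝ), h.IsCellConst D ρ n u → ∀ i, ∀ p q : H,
      (p : Plane) ∈ K.boundarySet → (q : Plane) ∈ K.boundarySet →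
      |u (h.cellMap i p) - u (h.cellMap i q)| ≤ C₁ * √r * √(h.limForm D ρ r u u) := by
    intro n u hu i p q hp hq
    refine (hv n _ ((hu.succ hD).1 i) p q hp hq).trans ?_
    rw [mul_assoc]
    exact mul_le_mul_of_nonneg_left
      (h.sqrt_limForm_comp_le hD hr (hu.mem_finDom hD hr) i) hC₁.le
  have key : ∀ ij : Fin K.N × Fin K.N, ∃ C : ℝ, ∀ (n : ℕ) (u : H → ℝ), h.IsCellConst D ρ n u →
      ∀ p q : H, (p : Plane) ∈ K.boundarySet → (q : Plane) ∈ K.boundarySet →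
      |u (h.cellMap ij.1 p) - u (h.cellMap ij.2 q)| ≤ C * √(h.limForm D ρ r u u) := by
    rintro ⟨i, j⟩
    induction K.reachable i j with
    | refl => exact ⟨C₁ * √r, fun n u hu p q hp hq => hcell n u hu i p q hp hq⟩
    -- Cells that share a vertex in the base are joined by bonds here, which adds `C₂` to the cost
    -- of crossing.
    | @tail k l _ hkl ih =>
      obtain ⟨C, ih⟩ := ih
      obtain ⟨p', hp', q', hq', heq⟩ := hkl
      have hp'' : (p' : Plane) ∈ K.boundarySet := ⟨p', hp', rfl⟩
      have hq'' : (q' : Plane) ∈ K.boundarySet := ⟨q', hq', rfl⟩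
      refine ⟨C + C₂ + C₁ * √r, fun n u hu p q hp hq => ?_⟩
      have hud := hu.mem_finDom hD hr
      have h1 := ih n u hu p ⟨p', h.boundarySet_subset hc hc1 hp''⟩ hp hp''
      have h2 := hj u (hu.bond_mem hD) k l ⟨p', h.boundarySet_subset hc hc1 hp''⟩
        ⟨q', h.boundarySet_subset hc hc1 hq''⟩ hp'' hq''
        (by rw [← K.map_eq_sim, ← K.map_eq_sim, heq])
      have h3 := hcell n u hu l ⟨q', h.boundarySet_subset hc hc1 hq''⟩ q hq'' hq
      have h4 := mul_le_mul_of_nonneg_left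
        (Real.sqrt_le_sqrt (h.bondEnergy_le_limForm hD hr hud)) hC₂.le
      dsimp only at h1 h2 h3 ⊢
      rw [add_mul, add_mul]
      refine (abs_sub_le _ (u (h.cellMap k ⟨p', h.boundarySet_subset hc hc1 hp''⟩)) _).trans ?_
      have h5 := abs_sub_le (u (h.cellMap k ⟨p', h.boundarySet_subset hc hc1 hp''⟩))
        (u (h.cellMap l ⟨q', h.boundarySet_subset hc hc1 hq''⟩)) (u (h.cellMap l q))
      linarith
  choose C' hC' using key
  obtain ⟨C, hC, hCC⟩ := exists_pos_forall_le C'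
  exact ⟨C, hC, fun n u hu i j p q hp hq => (hC' (i, j) n u hu p q hp hq).trans
    (mul_le_mul_of_nonneg_right (hCC _) (Real.sqrt_nonneg _))⟩

/-- The resistance estimate for cellwise constant functions. -/
lemma IsCellConst.exists_osc_bound : ∃ C > 0, ∀ (n : ℕ) (u : H → ℝ), h.IsCellConst D ρ n u →
    ∀ x y, |u x - u y| ≤ C * √(h.limForm D ρ r u u) := by
  obtain ⟨C₁, hC₁, h1⟩ := h.exists_level_one_bound hc hc1 hD hrK hr hrr
  obtain ⟨C₂, hC₂, h2⟩ := h.exists_bond_bound hD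
  have hr1 : r < 1 := hrr.trans_le (SierpinskiLike.resistance_factor_le_one hrK)
  have hs1 : √r < 1 := by rw [Real.sqrt_lt' one_pos]; simpa using hr1
  obtain ⟨p, hp⟩ := K.boundary_nonempty
  have hpV : (p : Plane) ∈ K.boundarySet := ⟨p, hp, rfl⟩
  obtain ⟨p₀, hp₀⟩ : ∃ p₀ : H, (p₀ : Plane) ∈ K.boundarySet :=
    ⟨⟨p, h.boundarySet_subset hc hc1 hpV⟩, hpV⟩
  obtain ⟨i₀, hi₀⟩ := h.exists_fixing hp₀
  -- Each level costs a move between first level vertices or along a bond, and passing to a cell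
  -- gains `√r`; the constant sums this series.
  set C := (C₁ + C₂) / (1 - √r) with hCdef
  have hCs : C₁ + C₂ + C * √r = C := by
    have : 1 - √r ≠ 0 := by linarith
    rw [hCdef]; field_simp; ring
  have hC : 0 < C := div_pos (by positivity) (by linarith)
  have key : ∀ (n : ℕ) (u : H → ℝ), h.IsCellConst D ρ n u → ∀ x,
      |u x - u p₀| ≤ C * √(h.limForm D ρ r u u) := by
    intro n
    induction n with
    | zero => rintro u ⟨a, rfl⟩ x; simp only [sub_self, abs_zero]; positivity
    | succ n ih =>
      intro u hu x
      have hud := hu.mem_finDom hD hr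
      have hsq := Real.sqrt_nonneg (h.limForm D ρ r u u)
      rw [← hCs, add_mul, add_mul]
      rcases h.cover x with ⟨i, y, rfl⟩ | ⟨b, y, rfl⟩
      · have h3 := ih _ (hu.1 i) y
        have h4 := mul_le_mul_of_nonneg_left (h.sqrt_limForm_comp_le hD hr hud i) hC.le
        have h5 := h1 _ u hu i i₀ p₀ p₀ hp₀ hp₀
        rw [hi₀] at h5
        have h6 := abs_sub_le (u (h.cellMap i y)) (u (h.cellMap i p₀)) (u p₀)
        have h7 := mul_nonneg hC₂.le hsq
        simp only [Function.comp_apply] at h3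
        rw [← mul_assoc] at h4
        linarith
      · obtain ⟨z, hz⟩ := (bond b).boundary_nonempty
        obtain ⟨i, q, hq, hiq⟩ := h.exists_cell_of_boundary hc hc1 hz
        have h3 := h2 u hu.2 b y z
        have h4 := mul_le_mul_of_nonneg_left
          (Real.sqrt_le_sqrt (h.bondEnergy_le_limForm hD hr hud)) hC₂.le
        have h5 := h1 _ u hu i i₀ q p₀ hq hp₀
        rw [hi₀, ← hiq] at h5
        have h6 := abs_sub_le (u (h.bondIncl b y)) (u (h.bondIncl b z)) (u p₀)
        have h7 : 0 ≤ C * √r * √(h.limForm D ρ r u u) := by positivity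
        linarith
  refine ⟨2 * C, by positivity, fun n u hu x y => ?_⟩
  have h3 := key n u hu x
  have h4 := key n u hu y
  rw [abs_le] at *
  constructor <;> linarith

end

/-! ### Uniform density of cellwise constant functions -/

section density

variable (hc : 0 < c) (hc1 : c < 1)
  (hD : ∀ b, (bond b).IsRegularHarmonicStructure (D b) (ρ b))
include hc hc1

omit [Fintype B] hc1 in
lemma dist_wordMap (n : ℕ) : ∀ (α : Fin n → Fin K.N) (x y : H),
    dist (wordMap h.cellMap n α x) (wordMap h.cellMap n α y) = c ^ n * dist x y := by
  induction n with
  | zero => intro α x y; simp [wordMap]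
  | succ n ih =>
    intro α x y
    have h1 : ∀ i (x y : H), dist (h.cellMap i x) (h.cellMap i y) = c * dist x y :=
      fun i x y => K.dist_shrunkSim hc i x y
    rw [wordMap, Function.comp_apply, Function.comp_apply, h1, ih, pow_succ']; ring

omit [Fintype B] in
lemma exists_level_uniform {f : H → ℝ} (hf : Continuous f) {ε : ℝ} (hε : 0 < ε) :
    ∃ n, ∀ (α : Fin n → Fin K.N) (x y : H),
      |f (wordMap h.cellMap n α x) - f (wordMap h.cellMap n α y)| ≤ ε := by
  have := h.compactSpace
  obtain ⟨δ, hδ, hfδ⟩ :=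
    Metric.uniformContinuous_iff.1 (CompactSpace.uniformContinuous_of_continuous hf) ε hε
  obtain ⟨R, hR⟩ := (Metric.isBounded_iff.1 (isCompact_univ (X := H)).isBounded)
  obtain ⟨n, hn⟩ := exists_pow_lt_of_lt_one (div_pos hδ (show 0 < max R 1 by positivity)) hc1
  refine ⟨n, fun α x y => (hfδ ?_).le⟩
  rw [h.dist_wordMap hc]
  have h1 : dist x y ≤ max R 1 := (hR (mem_univ x) (mem_univ y)).trans (le_max_left _ _)
  rw [lt_div_iff₀ (by positivity)] at hn
  exact (mul_le_mul_of_nonneg_left h1 (by positivity)).trans_lt hn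

include hD

/-- Cellwise constant functions are uniformly dense in the continuous functions. -/
lemma exists_isCellConst_approx {f : H → ℝ} (hf : Continuous f) {ε : ℝ} (hε : 0 < ε) :
    ∃ n u, h.IsCellConst D ρ n u ∧ ∀ x, |u x - f x| ≤ ε := by
  obtain ⟨C, hC, hglue⟩ := h.exists_glue_lift hc hc1 hD
  obtain ⟨x₀, hx₀⟩ := h.nonempty
  -- The sharper bound at the vertices keeps the constant independent of `n`: a vertex is fixed by a
  -- cell map, so its error is inherited from a cell unchanged, and only mismatches of size `2 * ε`
  -- are ever repaired on bonds.
  have key : ∀ (n : ℕ) (f : H → ℝ) (ε : ℝ), 0 < ε → Continuous f →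
      (∀ (α : Fin n → Fin K.N) (x y : H),
        |f (wordMap h.cellMap n α x) - f (wordMap h.cellMap n α y)| ≤ ε) →
      ∃ u, h.IsCellConst D ρ n u ∧ (∀ x : H, (x : Plane) ∈ K.boundarySet → |u x - f x| ≤ ε) ∧
        ∀ x, |u x - f x| ≤ (2 * C + 1) * ε := by
    intro n
    induction n with
    | zero =>
      intro f ε hε _ hosc
      refine ⟨fun _ => f ⟨x₀, hx₀⟩, ⟨_, rfl⟩, fun x _ => hosc Fin.elim0 _ x, fun x => ?_⟩
      refine (hosc Fin.elim0 _ x).trans ?_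
      have : 0 ≤ 2 * C * ε := by positivity
      linarith
    | succ n ih =>
      intro f ε hε hf hosc
      choose g hg hgV hgf using fun i => ih (f ∘ h.cellMap i) ε hε
        (hf.comp (h.cellMap_continuous hc i)) fun α x y => hosc (Fin.cons i α) x y
      choose a ha haf using fun b => (hD b).exists_uniform_approx
        (hf.comp (h.bondIncl_continuous b)) hε
      obtain ⟨u, hu1, hu2⟩ := hglue g a (2 * ε) (by positivity) ha fun b x i y hxy hy => by
        have h1 := hgV i y hy
        have h2 := haf b x
        rw [Function.comp_apply] at h1 h2
        rw [hxy] at h2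
        rw [abs_le] at *
        constructor <;> linarith
      have hux : ∀ i y, u (h.cellMap i y) = g i y := fun i y => congrFun (hu1 i) y
      refine ⟨u, ⟨fun i => by rw [hu1]; exact hg i, fun b => (hu2 b).1⟩, fun x hx => ?_,
        fun x => ?_⟩
      · obtain ⟨i, hi⟩ := h.exists_fixing hx
        have := hgV i x hx
        rw [← hux, Function.comp_apply, hi] at this
        exact this
      · rcases h.cover x with ⟨i, y, rfl⟩ | ⟨b, y, rfl⟩
        · rw [hux]; exact hgf i y
        · have h1 := (hu2 b).2.1 y
          have h2 := haf b y
          rw [Function.comp_apply] at h2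
          have h3 := abs_sub_le (u (h.bondIncl b y)) (a b y) (f (h.bondIncl b y))
          linarith
  have hC' : 0 < 2 * C + 1 := by positivity
  obtain ⟨n, hn⟩ := h.exists_level_uniform hc hc1 hf (div_pos hε hC')
  obtain ⟨u, hu, -, huf⟩ := key n f _ (div_pos hε hC') hf hn
  exact ⟨n, u, hu, fun x => (huf x).trans_eq (mul_div_cancel₀ _ hC'.ne')⟩

end density

/-! ### The closure of the cellwise constant functions -/

/-- The functions that are limits, uniformly and in energy, of cellwise constant functions. -/
def closureDom (h : IsHybrid K c bond att H)
    (D : ∀ b, Matrix (bond b).boundary (bond b).boundary ℝ) (ρ : ∀ b, Fin (bond b).N → ℝ)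
    (r : ℝ) : Set (H → ℝ) :=
  {u | ∀ ε > 0, ∃ n w, h.IsCellConst D ρ n w ∧ u - w ∈ h.finDom D ρ r ∧
    h.limForm D ρ r (u - w) (u - w) ≤ ε ∧ ∀ x, |u x - w x| ≤ ε}

section closure

variable (hD : ∀ b, (bond b).IsRegularHarmonicStructure (D b) (ρ b)) (hr : 0 < r)
include hD hr

lemma limForm_lsc {u : H → ℝ} {M : ℝ} (hu : ∀ ε > 0, ∃ w ∈ h.finDom D ρ r,
    h.limForm D ρ r w w ≤ M ∧ ∀ x, |u x - w x| ≤ ε) :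
    u ∈ h.finDom D ρ r ∧ h.limForm D ρ r u u ≤ M := by
  choose w hw hwM hwu using fun n : ℕ => hu (1 / ((n : ℝ) + 1)) Nat.one_div_pos_of_nat
  exact (h.graphForm_isFormSeq hD hr).lim_le_of_tendsto h.tendsto_graphForm
    (tendsto_of_forall_abs_sub_le hwu) hw hwM

lemma closureDom_subset_finDom {u : H → ℝ} (hu : u ∈ h.closureDom D ρ r) :
    u ∈ h.finDom D ρ r := by
  obtain ⟨n, w, hw, h1, -⟩ := hu 1 one_pos
  have := (h.graphForm_isFormSeq hD hr).add_mem h1 (hw.mem_finDom hD hr)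
  rwa [sub_add_cancel] at this

lemma IsCellConst.mem_closureDom {n : ℕ} {u : H → ℝ} (hu : h.IsCellConst D ρ n u) :
    u ∈ h.closureDom D ρ r := by
  intro ε hε
  have := h.const_mem_finDom (r := r) hD hr 0
  refine ⟨n, u, hu, ?_, ?_, fun x => by simpa using hε.le⟩
  · rw [sub_self]; exact this.1
  · rw [sub_self]; exact this.2.trans_le hε.le

lemma closureDom_add {u v : H → ℝ} (hu : u ∈ h.closureDom D ρ r) (hv : v ∈ h.closureDom D ρ r) :
    u + v ∈ h.closureDom D ρ r := by
  have hA := h.graphForm_isFormSeq hD hr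
  intro ε hε
  obtain ⟨n, w, hw, h1, h2, h3⟩ := hu (ε / 4) (by positivity)
  obtain ⟨m, z, hz, h4, h5, h6⟩ := hv (ε / 4) (by positivity)
  refine ⟨_, w + z, hw.add hD hz, ?_, ?_, fun x => ?_⟩
  · rw [add_sub_add_comm]; exact hA.add_mem h1 h4
  · rw [add_sub_add_comm]
    refine (hA.lim_add_le h1 h4).trans ?_
    linarith
  · have h7 := h3 x
    have h8 := h6 x
    simp only [Pi.add_apply]
    rw [abs_le] at *
    constructor <;> linarith

lemma closureDom_smul (a : ℝ) {u : H → ℝ} (hu : u ∈ h.closureDom D ρ r) :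
    a • u ∈ h.closureDom D ρ r := by
  have hA := h.graphForm_isFormSeq hD hr
  intro ε hε
  obtain ⟨n, w, hw, h1, h2, h3⟩ := hu (ε / (a ^ 2 + |a| + 1)) (by positivity)
  rw [le_div_iff₀ (by positivity)] at h2
  have h0 := hA.lim_nonneg h1
  refine ⟨n, a • w, hw.smul hD a, ?_, ?_, fun x => ?_⟩
  · rw [← smul_sub]; exact hA.smul_mem a h1
  · rw [← smul_sub, limForm, hA.lim_smul a h1]
    nlinarith [abs_nonneg a, mul_nonneg h0 (abs_nonneg a)]
  · have h4 := h3 x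
    rw [le_div_iff₀ (by positivity)] at h4
    simp only [Pi.smul_apply, smul_eq_mul]
    rw [← mul_sub, abs_mul]
    nlinarith [abs_nonneg a, abs_nonneg (u x - w x), mul_nonneg (abs_nonneg (u x - w x)) (sq_nonneg a)]

lemma closureDom_sub {u v : H → ℝ} (hu : u ∈ h.closureDom D ρ r) (hv : v ∈ h.closureDom D ρ r) :
    u - v ∈ h.closureDom D ρ r := by
  have := h.closureDom_add hD hr hu (h.closureDom_smul hD hr (-1) hv)
  rwa [neg_one_smul, ← sub_eq_add_neg] at this

lemma closureDom_closed {u : H → ℝ} (hu : ∀ ε > 0, ∃ v ∈ h.closureDom D ρ r,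
    u - v ∈ h.finDom D ρ r ∧ h.limForm D ρ r (u - v) (u - v) ≤ ε ∧ ∀ x, |u x - v x| ≤ ε) :
    u ∈ h.closureDom D ρ r := by
  have hA := h.graphForm_isFormSeq hD hr
  intro ε hε
  obtain ⟨v, hv, h1, h2, h3⟩ := hu (ε / 4) (by positivity)
  obtain ⟨n, w, hw, h4, h5, h6⟩ := hv (ε / 4) (by positivity)
  refine ⟨n, w, hw, ?_, ?_, fun x => ?_⟩
  · rw [← sub_add_sub_cancel u v w]; exact hA.add_mem h1 h4
  · rw [← sub_add_sub_cancel u v w]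
    refine (hA.lim_add_le h1 h4).trans ?_
    linarith
  · have h7 := h3 x
    have h8 := h6 x
    rw [abs_le] at *
    constructor <;> linarith

omit hD hr in
lemma closureDom_continuous (hc : 0 < c) {u : H → ℝ} (hu : u ∈ h.closureDom D ρ r) :
    Continuous u :=
  continuous_of_forall_approx fun ε hε => by
    obtain ⟨n, w, hw, -, -, h3⟩ := hu ε hε
    exact ⟨w, hw.continuous hc, h3⟩

/-- Uniform limits of cellwise constant functions of bounded energy are limits in energy. -/
lemma mem_closureDom_of_bounded {u : H → ℝ} {M : ℝ} (hu : ∀ ε > 0, ∃ n w,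
    h.IsCellConst D ρ n w ∧ h.limForm D ρ r w w ≤ M ∧ ∀ x, |u x - w x| ≤ ε) :
    u ∈ h.closureDom D ρ r := by
  have hA := h.graphForm_isFormSeq hD hr
  -- Approximants with energy close to the infimum of `T` are Cauchy in energy, as in the projection
  -- onto a convex set.
  let T : Set ℝ := {t | ∀ ε > 0, ∃ n w, h.IsCellConst D ρ n w ∧ h.limForm D ρ r w w ≤ t ∧
    ∀ x, |u x - w x| ≤ ε}
  have hTne : T.Nonempty := ⟨M, hu⟩
  have hTbdd : BddBelow T := by
    refine ⟨0, fun t ht => ?_⟩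
    obtain ⟨n, w, hw, hwt, -⟩ := ht 1 one_pos
    exact (hA.lim_nonneg (hw.mem_finDom hD hr)).trans hwt
  intro ε hε
  set η := ε / 8 with hη
  have hη0 : 0 < η := by positivity
  have h1 : sInf T - η ∉ T := fun hmem => by
    have := csInf_le hTbdd hmem
    linarith
  obtain ⟨t, ht, htη⟩ := exists_lt_of_csInf_lt hTne (show sInf T < sInf T + η by linarith)
  -- Since `sInf T - η` is not in `T`, sufficiently close approximants, midpoints included, have
  -- energy above it.
  obtain ⟨ε₀, hε₀, hlow⟩ : ∃ ε₀ > 0, ∀ n w, h.IsCellConst D ρ n w → (∀ x, |u x - w x| ≤ ε₀) →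
      sInf T - η < h.limForm D ρ r w w := by
    by_contra hcon
    push Not at hcon
    refine h1 fun ε hε => ?_
    obtain ⟨n, w, hw, hwu, hle⟩ := hcon ε hε
    exact ⟨n, w, hw, hle, hwu⟩
  obtain ⟨n, w, hw, hwt, hwu⟩ := ht (min ε₀ ε) (by positivity)
  have hwd := hw.mem_finDom (r := r) hD hr
  have hlim : u - w ∈ h.finDom D ρ r ∧ h.limForm D ρ r (u - w) (u - w) ≤ ε := by
    refine h.limForm_lsc hD hr fun δ hδ => ?_
    obtain ⟨m, z, hz, hzt, hzu⟩ := ht (min ε₀ δ) (by positivity)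
    have hzd := hz.mem_finDom (r := r) hD hr
    refine ⟨z - w, hA.sub_mem hzd hwd, ?_, fun x => ?_⟩
    -- The energy of `z - w` is twice the sum of the energies minus four times that of the midpoint,
    -- hence at most `4 * t - 4 * (sInf T - η) < 8 * η = ε`.
    · have h2 := hA.lim_parallelogram hzd hwd
      have h3 := hlow _ _ ((hz.add hD hw).smul hD (2⁻¹ : ℝ)) fun x => by
        have h4 := (hzu x).trans (min_le_left _ _)
        have h5 := (hwu x).trans (min_le_left _ _)
        simp only [Pi.smul_apply, Pi.add_apply, smul_eq_mul]
        rw [abs_le] at *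
        constructor <;> linarith
      rw [limForm, hA.lim_smul _ (hA.add_mem hzd hwd)] at h3
      simp only [limForm] at *
      linarith
    · have h4 := (hzu x).trans (min_le_right _ _)
      simp only [Pi.sub_apply]
      rwa [show u x - w x - (z x - w x) = u x - z x by ring]
  exact ⟨n, w, hw, hlim.1, hlim.2, fun x => (hwu x).trans (min_le_right _ _)⟩

/-- An approximation with controlled energy. -/
lemma exists_approx_of_mem_closureDom {u : H → ℝ} (hu : u ∈ h.closureDom D ρ r) {ε : ℝ}
    (hε : 0 < ε) : ∃ n w, h.IsCellConst D ρ n w ∧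
      h.limForm D ρ r w w ≤ 2 * h.limForm D ρ r u u + ε ∧ ∀ x, |u x - w x| ≤ ε := by
  have hA := h.graphForm_isFormSeq hD hr
  obtain ⟨n, w, hw, h1, h2, h3⟩ := hu (ε / 2) (by positivity)
  refine ⟨n, w, hw, ?_, fun x => (h3 x).trans (by linarith)⟩
  have h4 := hA.lim_sub_le (h.closureDom_subset_finDom hD hr hu) h1
  rw [sub_sub_cancel] at h4
  refine h4.trans ?_
  linarith

/-- Contractions need not be continuous in energy, but they preserve uniform approximation and
energy bounds, which suffices by `mem_closureDom_of_bounded`. -/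
lemma closureDom_contraction {φ : ℝ → ℝ} (hφ : ∀ a b, |φ a - φ b| ≤ |a - b|) {u : H → ℝ}
    (hu : u ∈ h.closureDom D ρ r) : φ ∘ u ∈ h.closureDom D ρ r ∧
      h.limForm D ρ r (φ ∘ u) (φ ∘ u) ≤ h.limForm D ρ r u u := by
  have hA := h.graphForm_isFormSeq hD hr
  have hφc : Continuous φ := continuous_real_iff_eventually.2 fun ε hε a => by
    filter_upwards [Metric.ball_mem_nhds a hε] with b hb
    refine (hφ a b).trans ?_
    rw [abs_sub_comm]
    exact (Metric.mem_ball.1 hb).le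
  have hle : ∀ {w : H → ℝ}, w ∈ h.finDom D ρ r →
      φ ∘ w ∈ h.finDom D ρ r ∧ h.limForm D ρ r (φ ∘ w) (φ ∘ w) ≤ h.limForm D ρ r w w :=
    fun {w} hw => hA.lim_le fun n => (h.graphForm_contraction hD hr hφ n w).trans (hA.le_lim hw n)
  refine ⟨?_, (hle (h.closureDom_subset_finDom hD hr hu)).2⟩
  refine h.mem_closureDom_of_bounded hD hr (M := 2 * h.limForm D ρ r u u + 1) fun ε hε => ?_
  obtain ⟨n, w, hw, h1, h2⟩ := h.exists_approx_of_mem_closureDom hD hr hu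
    (show 0 < min ε 1 by positivity)
  refine ⟨n, φ ∘ w, hw.contraction hD hφc hφ, (hle (hw.mem_finDom hD hr)).2.trans (h1.trans ?_),
    fun x => (hφ _ _).trans ((h2 x).trans (min_le_left _ _))⟩
  have := min_le_right ε 1
  linarith

lemma closureDom_comp {u : H → ℝ} (hu : u ∈ h.closureDom D ρ r) (i : Fin K.N) :
    u ∘ h.cellMap i ∈ h.closureDom D ρ r := by
  have hA := h.graphForm_isFormSeq hD hr
  intro ε hε
  obtain ⟨n, w, hw, h1, h2, h3⟩ := hu (ε / (r + 1)) (by positivity)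
  obtain ⟨h4, h5⟩ := h.comp_cellMap_mem hD hr h1 i
  rw [le_div_iff₀ (by positivity)] at h2
  have h0 := hA.lim_nonneg h1
  refine ⟨n, w ∘ h.cellMap i, (hw.succ hD).1 i, h4, h5.trans ?_, fun x => (h3 _).trans ?_⟩
  · linarith
  · exact div_le_self hε.le (by linarith)

variable (hc : 0 < c) (hc1 : c < 1)
include hc hc1

/-- For the converse, separate approximations on the cells leave small mismatches at the ends of the
bonds. Their repair is uniformly small and keeps the energy bounded, and no more is needed. -/
lemma mem_closureDom_iff {u : H → ℝ} : u ∈ h.closureDom D ρ r ↔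
    (∀ i, u ∘ h.cellMap i ∈ h.closureDom D ρ r) ∧
      ∀ b, u ∘ h.bondIncl b ∈ (bond b).domain (D b) (ρ b) := by
  have hA := h.graphForm_isFormSeq hD hr
  constructor
  · exact fun hu => ⟨h.closureDom_comp hD hr hu, fun b =>
      ⟨(h.closureDom_continuous hc hu).comp (h.bondIncl_continuous b),
        h.comp_bondIncl_mem hD hr (h.closureDom_subset_finDom hD hr hu) b⟩⟩
  · rintro ⟨hcell, hbond⟩
    obtain ⟨C, hC, hglue⟩ := h.exists_glue_lift hc hc1 hD
    refine h.mem_closureDom_of_bounded hD hr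
      (M := ∑ b, (2 * (bond b).energy (D b) (ρ b) (u ∘ h.bondIncl b) (u ∘ h.bondIncl b) + C) +
        ∑ i, r⁻¹ * (2 * h.limForm D ρ r (u ∘ h.cellMap i) (u ∘ h.cellMap i) + 1)) fun ε hε => ?_
    set δ := min (min ε 1) (ε / C) with hδdef
    have hδ : 0 < δ := by positivity
    have hδ1 : δ ≤ 1 := (min_le_left _ _).trans (min_le_right _ _)
    have hδε : δ ≤ ε := (min_le_left _ _).trans (min_le_left _ _)
    have hδC : C * δ ≤ ε := by
      rw [mul_comm, ← le_div_iff₀ hC]; exact min_le_right _ _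
    choose n w hw h1 h2 using fun i => h.exists_approx_of_mem_closureDom hD hr (hcell i) hδ
    obtain ⟨v, hv1, hv2⟩ := hglue w (fun b => u ∘ h.bondIncl b) δ hδ.le hbond
      fun b x i y hxy _ => by
        rw [abs_sub_comm, Function.comp_apply, hxy]; exact h2 i y
    obtain ⟨N, hN⟩ := (Set.finite_range n).bddAbove
    have hv : h.IsCellConst D ρ (N + 1) v :=
      ⟨fun i => by rw [hv1]; exact (hw i).mono hD (hN ⟨i, rfl⟩), fun b => (hv2 b).1⟩
    have hvd := hv.mem_finDom (r := r) hD hr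
    refine ⟨_, v, hv, ?_, fun x => ?_⟩
    · rw [h.limForm_eq hD hr hvd hvd]
      refine add_le_add (Finset.sum_le_sum fun b _ => (hv2 b).2.2.trans ?_)
        (Finset.sum_le_sum fun i _ => mul_le_mul_of_nonneg_left ?_ (inv_nonneg.2 hr.le))
      · have : C * δ ^ 2 ≤ C * 1 := mul_le_mul_of_nonneg_left (pow_le_one₀ hδ.le hδ1) hC.le
        linarith
      · rw [hv1]
        have := h1 i
        linarith
    · rcases h.cover x with ⟨i, y, rfl⟩ | ⟨b, y, rfl⟩
      · rw [show v (h.cellMap i y) = w i y from congrFun (hv1 i) y]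
        exact (h2 i y).trans hδε
      · rw [abs_sub_comm]
        exact ((hv2 b).2.1 y).trans hδC

variable {rK : ℝ} (hrK : K.IsHarmonicStructure K.symmLaplacian fun _ => rK) (hrr : r < rK)
include hrK hrr

/-- The resistance estimate. -/
lemma exists_osc_bound : ∃ C > 0, ∀ u ∈ h.closureDom D ρ r,
    ∀ x y, |u x - u y| ≤ C * √(h.limForm D ρ r u u) := by
  have hA := h.graphForm_isFormSeq hD hr
  obtain ⟨C, hC, hb⟩ := IsCellConst.exists_osc_bound h hc hc1 hD hrK hr hrr
  refine ⟨C * √2, by positivity, fun u hu x y => ?_⟩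
  -- The approximants have at most twice the energy up to `ε`; letting `ε` tend to zero gives the
  -- constant `C * √2`.
  have key : ∀ ε : ℝ, 0 < ε → |u x - u y| ≤ 2 * ε + C * √(2 * h.limForm D ρ r u u + ε) := by
    intro ε hε
    obtain ⟨n, w, hw, h1, h2⟩ := h.exists_approx_of_mem_closureDom hD hr hu hε
    have h3 := hb n w hw x y
    have h4 := mul_le_mul_of_nonneg_left (Real.sqrt_le_sqrt h1) hC.le
    have h5 := h2 x
    have h6 := h2 y
    rw [abs_le] at *
    constructor <;> linarith
  have hlim : Tendsto (fun ε : ℝ => 2 * ε + C * √(2 * h.limForm D ρ r u u + ε)) (𝓝[>] 0)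
      (𝓝 (2 * 0 + C * √(2 * h.limForm D ρ r u u + 0))) := by
    refine Tendsto.mono_left ?_ nhdsWithin_le_nhds
    have : Continuous fun ε : ℝ => 2 * ε + C * √(2 * h.limForm D ρ r u u + ε) := by fun_prop
    exact this.tendsto 0
  have := ge_of_tendsto hlim (eventually_nhdsWithin_of_forall key)
  rwa [mul_zero, zero_add, add_zero, Real.sqrt_mul (by norm_num), ← mul_assoc] at this

end closure

end IsHybrid

lemma exists_lt_one_forall_le {ι : Type*} [Finite ι] {f : ι → ℝ} (hf : ∀ i, f i < 1) {a : ℝ}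
    (ha : a < 1) : ∃ t < 1, a ≤ t ∧ ∀ i, f i ≤ t := by
  cases isEmpty_or_nonempty ι
  · exact ⟨a, ha, le_rfl, isEmptyElim⟩
  · obtain ⟨i, hi⟩ := Finite.exists_max f
    exact ⟨max a (f i), max_lt ha (hf i), le_max_left _ _, fun j => (hi j).trans (le_max_right _ _)⟩

/-! ### Effective resistance and oscillation -/

namespace ResistanceForm

variable {X : Type*} (E : ResistanceForm X)

lemma energy_of_mem {u v : X → ℝ} (hu : u ∈ E.dom) (hv : v ∈ E.dom) :
    E.energy u v = E.form ⟨u, hu⟩ ⟨v, hv⟩ := dif_pos ⟨hu, hv⟩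

lemma energy_nonneg {u : X → ℝ} (hu : u ∈ E.dom) : 0 ≤ E.energy u u := by
  rw [E.energy_of_mem hu hu]; exact E.nonneg _

lemma resistance_nonneg (x y : X) : 0 ≤ E.resistance x y :=
  Real.sSup_nonneg (by rintro _ ⟨u, hu, rfl⟩; positivity)

lemma abs_sub_le_resistance {u : X → ℝ} (hu : u ∈ E.dom) (x y : X) :
    |u x - u y| ≤ √(E.resistance x y) * √(E.energy u u) := by
  rw [E.energy_of_mem hu hu]
  rcases (E.nonneg ⟨u, hu⟩).eq_or_lt' with h0 | hpos
  · have h1 : u x = u y := (E.eq_zero_iff ⟨u, hu⟩).1 h0 x y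
    rw [h1, sub_self, abs_zero]; positivity
  · rw [← Real.sqrt_mul (E.resistance_nonneg x y)]
    apply Real.abs_le_sqrt
    rw [← sq_abs, ← div_le_iff₀ hpos]
    obtain ⟨M, hM⟩ := E.resistance_finite x y
    exact le_csSup ⟨M, by rintro _ ⟨v, hv, rfl⟩; exact hM v hv⟩ ⟨⟨u, hu⟩, hpos, rfl⟩

lemma sqrt_resistance_le {x y : X} {C : ℝ} (hC : 0 ≤ C)
    (h : ∀ u ∈ E.dom, |u x - u y| ≤ C * √(E.energy u u)) : √(E.resistance x y) ≤ C := by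
  rw [Real.sqrt_le_left hC]
  refine Real.sSup_le ?_ (sq_nonneg C)
  rintro _ ⟨u, hu, rfl⟩
  rw [div_le_iff₀ hu]
  have := h u.1 u.2
  rw [E.energy_of_mem u.2 u.2] at this
  calc _ ≤ (C * √(E.form u u)) ^ 2 := pow_le_pow_left₀ (abs_nonneg _) this 2
    _ = _ := by rw [mul_pow, Real.sq_sqrt hu.le]

end ResistanceForm

lemma PCFSet.levelEnergy_eq_zero {K : PCFSet} {D : Matrix K.boundary K.boundary ℝ}
    {ρ : Fin K.N → ℝ} {n : ℕ} {u v : K.carrier → ℝ}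
    (h : ∀ (w : Fin n → Fin K.N) p q, u (wordMap K.map n w p) = 0 ∨ v (wordMap K.map n w q) = 0) :
    K.levelEnergy D ρ n u v = 0 := by
  simp only [levelEnergy, dotProduct, Matrix.mulVec, Finset.mul_sum]
  refine Finset.sum_eq_zero fun w _ => ?_
  rw [Finset.sum_eq_zero fun p _ => Finset.sum_eq_zero fun q _ => ?_, neg_zero, mul_zero]
  rcases h w p.1 q.1 with h | h <;> simp [h]

/-! ### The closure as a local and regular resistance form -/

namespace IsHybrid

variable {K : SierpinskiLike} {c : ℝ} {B : Type*} {bond : B → PCFSet}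
  {att : B → Finset (Fin K.N)} {H : Set Plane} (h : IsHybrid K c bond att H)
  [Fintype B] {D : ∀ b, Matrix (bond b).boundary (bond b).boundary ℝ}
  {ρ : ∀ b, Fin (bond b).N → ℝ} {r : ℝ}

/-- The closure of the cellwise constant functions as a linear space. -/
def closureSubmodule (hD : ∀ b, (bond b).IsRegularHarmonicStructure (D b) (ρ b)) (hr : 0 < r) :
    Submodule ℝ (H → ℝ) where
  carrier := h.closureDom D ρ r
  add_mem' := h.closureDom_add hD hr
  zero_mem' := (IsCellConst.const (h := h) hD 0 0).mem_closureDom h hD hr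
  smul_mem' a _ := h.closureDom_smul hD hr a

section

variable (hD : ∀ b, (bond b).IsRegularHarmonicStructure (D b) (ρ b)) (hr : 0 < r)

/-- The limit form on the closure of the cellwise constant functions. -/
noncomputable def closureBilin :
    h.closureSubmodule hD hr →ₗ[ℝ] h.closureSubmodule hD hr →ₗ[ℝ] ℝ :=
  have hA := h.graphForm_isFormSeq hD hr
  have hm : ∀ u : h.closureSubmodule hD hr, u.1 ∈ h.finDom D ρ r := fun u =>
    h.closureDom_subset_finDom hD hr u.2
  LinearMap.mk₂ ℝ (fun u v => h.limForm D ρ r u.1 v.1)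
    (fun u v w => hA.lim_add_left (hm u) (hm v) (hm w))
    (fun a u v => hA.lim_smul_left a (hm u) (hm v))
    (fun u v w => by
      simp only [limForm, hA.lim_symm u.1]
      exact hA.lim_add_left (hm v) (hm w) (hm u))
    (fun a u v => by
      simp only [limForm, hA.lim_symm u.1]
      exact hA.lim_smul_left a (hm v) (hm u))

variable (hc : 0 < c) (hc1 : c < 1) {rK : ℝ}
  (hrK : K.IsHarmonicStructure K.symmLaplacian fun _ => rK) (hrr : r < rK)
include hD hr hc hc1 hrK hrr

/-- After normalisation at one point the oscillation estimate makes an energy Cauchy sequence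
uniformly Cauchy; lower semicontinuity turns the uniform limit into a limit in energy. -/
lemma closureDom_complete (us : ℕ → h.closureSubmodule hD hr)
    (hus : ∀ ε > 0, ∃ n₀, ∀ m ≥ n₀, ∀ n ≥ n₀,
      h.closureBilin hD hr (us m - us n) (us m - us n) < ε) :
    ∃ u : h.closureSubmodule hD hr,
      Tendsto (fun n => h.closureBilin hD hr (us n - u) (us n - u)) atTop (𝓝 0) := by
  have hA := h.graphForm_isFormSeq hD hr
  obtain ⟨C, hC, hosc⟩ := h.exists_osc_bound hD hr hc hc1 hrK hrr
  obtain ⟨x₀, hx₀⟩ := h.nonempty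
  -- Translations are contractions of the line, so subtracting a constant does not raise the energy.
  have hsh : ∀ (a : ℝ) {u : H → ℝ}, u ∈ h.closureDom D ρ r →
      (fun x => u x - a) ∈ h.closureDom D ρ r ∧
        h.limForm D ρ r (fun x => u x - a) (fun x => u x - a) ≤ h.limForm D ρ r u u :=
    fun a u hu => h.closureDom_contraction hD hr (φ := fun t => t - a) (fun s t => by simp) hu
  let v : ℕ → H → ℝ := fun n x => (us n).1 x - (us n).1 ⟨x₀, hx₀⟩
  have hv : ∀ n, v n ∈ h.closureDom D ρ r := fun n => (hsh _ (us n).2).1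
  have hvS : ∀ m n, h.limForm D ρ r (v m - v n) (v m - v n)
      ≤ h.closureBilin hD hr (us m - us n) (us m - us n) := fun m n => by
    have := (hsh ((us m).1 ⟨x₀, hx₀⟩ - (us n).1 ⟨x₀, hx₀⟩) (us m - us n).2).2
    refine le_of_eq_of_le ?_ this
    congr 1 <;> (funext x; simp [v]; ring)
  have hvC : ∀ m n x, |v m x - v n x|
      ≤ C * √(h.closureBilin hD hr (us m - us n) (us m - us n)) := fun m n x => by
    have := hosc _ (us m - us n).2 x ⟨x₀, hx₀⟩
    refine le_of_eq_of_le ?_ this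
    congr 1
    simp [v]; ring
  have hunif : ∀ ε > 0, ∃ n₀, ∀ m ≥ n₀, ∀ n ≥ n₀, ∀ x, |v m x - v n x| ≤ ε := by
    intro ε hε
    obtain ⟨n₀, hn₀⟩ := hus ((ε / C) ^ 2) (by positivity)
    refine ⟨n₀, fun m hm n hn x => (hvC m n x).trans ?_⟩
    rw [mul_comm, ← le_div_iff₀ hC, ← Real.sqrt_sq (show 0 ≤ ε / C by positivity)]
    exact Real.sqrt_le_sqrt (hn₀ m hm n hn).le
  have hlim : ∀ x, ∃ l, Tendsto (fun n => v n x) atTop (𝓝 l) := fun x =>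
    cauchySeq_tendsto_of_complete (Metric.cauchySeq_iff.2 fun ε hε => by
      obtain ⟨n₀, hn₀⟩ := hunif (ε / 2) (by positivity)
      refine ⟨n₀, fun m hm n hn => ?_⟩
      rw [Real.dist_eq]
      linarith [hn₀ m hm n hn x])
  choose l hl using hlim
  have hlu : ∀ ε > 0, ∃ n₀, ∀ n ≥ n₀, ∀ x, |l x - v n x| ≤ ε := by
    intro ε hε
    obtain ⟨n₀, hn₀⟩ := hunif ε hε
    refine ⟨n₀, fun n hn x => ?_⟩
    exact le_of_tendsto ((hl x).sub_const _).abs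
      (eventually_atTop.2 ⟨n₀, fun m hm => hn₀ m hm n hn x⟩)
  have hlS : ∀ ε > 0, ∃ n₀, ∀ n ≥ n₀, l - v n ∈ h.finDom D ρ r ∧
      h.limForm D ρ r (l - v n) (l - v n) ≤ ε := by
    intro ε hε
    obtain ⟨n₀, hn₀⟩ := hus ε hε
    refine ⟨n₀, fun n hn => h.limForm_lsc hD hr fun δ hδ => ?_⟩
    obtain ⟨n₁, hn₁⟩ := hlu δ hδ
    refine ⟨v (max n₀ n₁) - v n, hA.sub_mem (h.closureDom_subset_finDom hD hr (hv _))
      (h.closureDom_subset_finDom hD hr (hv _)),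
      (hvS _ _).trans (hn₀ _ (le_max_left _ _) n hn).le, fun x => ?_⟩
    have := hn₁ _ (le_max_right n₀ n₁) x
    simp only [Pi.sub_apply]
    rwa [sub_sub_sub_cancel_right]
  have hlD : l ∈ h.closureDom D ρ r := h.closureDom_closed hD hr fun ε hε => by
    obtain ⟨n₀, hn₀⟩ := hlu ε hε
    obtain ⟨n₁, hn₁⟩ := hlS ε hε
    have h1 := hn₁ (max n₀ n₁) (le_max_right _ _)
    exact ⟨_, hv (max n₀ n₁), h1.1, h1.2, hn₀ _ (le_max_left _ _)⟩
  refine ⟨⟨l, hlD⟩, Metric.tendsto_atTop.2 fun ε hε => ?_⟩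
  obtain ⟨n₀, hn₀⟩ := hlS (ε / 2) (by positivity)
  refine ⟨n₀, fun n hn => ?_⟩
  have h1 : 0 ≤ h.closureBilin hD hr (us n - ⟨l, hlD⟩) (us n - ⟨l, hlD⟩) :=
    hA.lim_nonneg (h.closureDom_subset_finDom hD hr (h.closureDom_sub hD hr (us n).2 hlD))
  rw [Real.dist_eq, sub_zero, abs_of_nonneg h1]
  have h2 := (hsh (-(us n).1 ⟨x₀, hx₀⟩) (h.closureDom_sub hD hr (hv n) hlD)).2
  have h3 : h.limForm D ρ r (v n - l) (v n - l) = h.limForm D ρ r (l - v n) (l - v n) := by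
    rw [← neg_sub l, ← neg_one_smul ℝ (l - v n), limForm, hA.lim_smul _ (hn₀ n hn).1]
    ring
  rw [h3] at h2
  have h4 : h.closureBilin hD hr (us n - ⟨l, hlD⟩) (us n - ⟨l, hlD⟩)
      ≤ h.limForm D ρ r (l - v n) (l - v n) := by
    refine le_of_eq_of_le ?_ h2
    change h.limForm D ρ r _ _ = _
    congr 1 <;> (funext x; simp [v]; ring)
  have := (hn₀ n hn).2
  linarith

omit hr hrK hrr in
lemma exists_mem_separating {x y : H} (hxy : x ≠ y) :
    ∃ n u, h.IsCellConst D ρ n u ∧ u x ≠ u y := by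
  have hd : 0 < dist y x := dist_pos.2 hxy.symm
  obtain ⟨n, u, hu, huf⟩ := h.exists_isCellConst_approx hc hc1 hD
    (f := fun z => dist z x) (by fun_prop) (show 0 < dist y x / 3 by positivity)
  refine ⟨n, u, hu, fun heq => ?_⟩
  have h1 := huf x
  have h2 := huf y
  rw [dist_self] at h1
  rw [heq] at h1
  rw [abs_le] at *
  linarith

/-- The resistance form on the hybrid whose domain is the closure of the cellwise constant
functions. -/
noncomputable def closureResistanceForm : ResistanceForm H where
  dom := h.closureSubmodule hD hr
  form := h.closureBilin hD hr
  const_mem a := (IsCellConst.const (h := h) hD 0 a).mem_closureDom h hD hr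
  symm u v := (h.graphForm_isFormSeq hD hr).lim_symm u.1 v.1
  nonneg u := (h.graphForm_isFormSeq hD hr).lim_nonneg (h.closureDom_subset_finDom hD hr u.2)
  eq_zero_iff u := by
    constructor
    · intro h0 x y
      obtain ⟨C, hC, hosc⟩ := h.exists_osc_bound hD hr hc hc1 hrK hrr
      have h1 := hosc u.1 u.2 x y
      rw [show h.limForm D ρ r u.1 u.1 = 0 from h0, Real.sqrt_zero, mul_zero] at h1
      exact sub_eq_zero.1 (abs_nonpos_iff.1 h1)
    · intro hu
      obtain ⟨x₀, hx₀⟩ := h.nonempty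
      have h1 : u.1 = fun _ => u.1 ⟨x₀, hx₀⟩ := funext fun x => hu x _
      change h.limForm D ρ r u.1 u.1 = 0
      rw [h1]
      exact (h.const_mem_finDom hD hr _).2
  complete := h.closureDom_complete hD hr hc hc1 hrK hrr
  separates x y hxy := by
    obtain ⟨n, u, hu, hne⟩ := h.exists_mem_separating hD hc hc1 hxy
    exact ⟨⟨u, hu.mem_closureDom h hD hr⟩, hne⟩
  resistance_finite x y := by
    obtain ⟨C, hC, hosc⟩ := h.exists_osc_bound hD hr hc hc1 hrK hrr
    refine ⟨C ^ 2, fun u hu => ?_⟩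
    rw [div_le_iff₀ hu]
    calc _ ≤ (C * √(h.limForm D ρ r u.1 u.1)) ^ 2 :=
          pow_le_pow_left₀ (abs_nonneg _) (hosc u.1 u.2 x y) 2
      _ = _ := by
        rw [mul_pow, Real.sq_sqrt (show 0 ≤ h.limForm D ρ r u.1 u.1 from le_of_lt hu)]; rfl
  markov u :=
    have h1 := h.closureDom_contraction hD hr (φ := fun t => min (max 0 t) 1) (fun a b => by
      refine (abs_min_sub_min_le_max _ _ _ _).trans ?_
      rw [sub_self, abs_zero, max_eq_left (abs_nonneg _)]
      refine (abs_max_sub_max_le_max _ _ _ _).trans ?_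
      rw [sub_self, abs_zero, max_eq_right (abs_nonneg _)]) u.2
    ⟨h1.1, h1.2⟩

lemma closureResistanceForm_energy {u v : H → ℝ} (hu : u ∈ h.closureDom D ρ r)
    (hv : v ∈ h.closureDom D ρ r) :
    (h.closureResistanceForm hD hr hc hc1 hrK hrr).energy u v = h.limForm D ρ r u v :=
  ResistanceForm.energy_of_mem _ hu hv

/-- Bonds have this property for every `ε`, and `n` passages to cells reduce the global bound `C` to
`C * √r ^ n`. It says that points close in the plane have small resistance. -/
lemma closureDom_equicontinuous {ε : ℝ} (hε : 0 < ε) (x : H) : ∀ᶠ y in 𝓝 x,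
    ∀ u ∈ h.closureDom D ρ r, |u x - u y| ≤ ε * √(h.limForm D ρ r u u) := by
  obtain ⟨C, hC, hosc⟩ := h.exists_osc_bound hD hr hc hc1 hrK hrr
  have hr1 : r < 1 := hrr.trans_le (SierpinskiLike.resistance_factor_le_one hrK)
  have hs1 : √r < 1 := by rw [Real.sqrt_lt' one_pos]; simpa using hr1
  have hs0 := Real.sqrt_nonneg r
  have key : ∀ (n : ℕ) (ε : ℝ), 0 < ε → ∀ x : H, ∀ᶠ y in 𝓝 x,
      ∀ u ∈ h.closureDom D ρ r, |u x - u y| ≤ (ε + C * √r ^ n) * √(h.limForm D ρ r u u) := by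
    intro n
    induction n with
    | zero =>
      intro ε hε x
      filter_upwards with y u hu
      refine (hosc u hu x y).trans (mul_le_mul_of_nonneg_right ?_ (Real.sqrt_nonneg _))
      linarith
    | succ n ih =>
      intro ε hε
      refine h.eventually_of_pieces hc (fun i y => ?_) fun b y => ?_
      · filter_upwards [ih ε hε y] with y' hy' u hu
        refine (hy' _ (h.closureDom_comp hD hr hu i)).trans ?_
        refine (mul_le_mul_of_nonneg_left (h.sqrt_limForm_comp_le hD hr
          (h.closureDom_subset_finDom hD hr hu) i) (by positivity)).trans ?_
        rw [← mul_assoc]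
        refine mul_le_mul_of_nonneg_right ?_ (Real.sqrt_nonneg _)
        rw [add_mul, mul_assoc, ← pow_succ]
        exact add_le_add (mul_le_of_le_one_right hε.le hs1.le) le_rfl
      · filter_upwards [(hD b).equicontinuous hε y] with y' hy' u hu
        have hub := ((h.mem_closureDom_iff hD hr hc hc1).1 hu).2
        refine (hy' _ (hub b)).trans ?_
        have h1 := (h.energy_le_bondEnergy hD hub b).trans
          (h.bondEnergy_le_limForm hD hr (h.closureDom_subset_finDom hD hr hu))
        refine mul_le_mul ?_ (Real.sqrt_le_sqrt h1) (Real.sqrt_nonneg _) (by positivity)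
        have : 0 ≤ C * √r ^ (n + 1) := by positivity
        linarith
  obtain ⟨n, hn⟩ := exists_pow_lt_of_lt_one (show 0 < ε / 2 / C by positivity) hs1
  filter_upwards [key n (ε / 2) (by positivity) x] with y hy u hu
  refine (hy u hu).trans (mul_le_mul_of_nonneg_right ?_ (Real.sqrt_nonneg _))
  rw [lt_div_iff₀ hC] at hn
  linarith

/-- The topology of the resistance metric is the Euclidean one. -/
lemma closureResistanceForm_topology :
    (h.closureResistanceForm hD hr hc hc1 hrK hrr).topology = instTopologicalSpaceSubtype := by
  set E := h.closureResistanceForm hD hr hc hc1 hrK hrr with hE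
  have hen : ∀ u ∈ h.closureDom D ρ r, E.energy u u = h.limForm D ρ r u u := fun u hu =>
    h.closureResistanceForm_energy hD hr hc hc1 hrK hrr hu hu
  refine TopologicalSpace.ext_iff.2 fun U => ⟨fun hU => ?_, fun hU x hx => ?_⟩
  · rw [isOpen_iff_mem_nhds]
    intro x hx
    obtain ⟨ε, hε, hεU⟩ := hU x hx
    have hε' : 0 < √(ε / 2) := by positivity
    filter_upwards [h.closureDom_equicontinuous hD hr hc hc1 hrK hrr hε' x] with y hy
    refine hεU y ?_
    have h1 : √(E.resistance x y) ≤ √(ε / 2) :=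
      E.sqrt_resistance_le hε'.le fun u hu => by rw [hen u hu]; exact hy u hu
    rw [Real.sqrt_le_sqrt_iff (by positivity)] at h1
    linarith
  -- A function `u` of finite energy within `δ / 4` of the distance to `x` differs by at least `δ /
  -- 2` between `x` and any point outside the Euclidean ball, so that point has resistance bounded
  -- below.
  · obtain ⟨δ, hδ, hδU⟩ := Metric.isOpen_iff.1 hU x hx
    obtain ⟨n, u, hu, huf⟩ := h.exists_isCellConst_approx hc hc1 hD
      (f := fun z => dist z x) (by fun_prop) (show 0 < δ / 4 by positivity)
    have hud : u ∈ E.dom := hu.mem_closureDom h hD hr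
    have hu0 := E.energy_nonneg hud
    refine ⟨(δ / 2) ^ 2 / (E.energy u u + 1), by positivity, fun y hy => ?_⟩
    by_contra hyU
    have hd : δ ≤ dist y x := not_lt.1 fun hlt => hyU (hδU hlt)
    have h1 := E.abs_sub_le_resistance hud x y
    have h2 : √(E.resistance x y) * √(E.energy u u) < δ / 2 := by
      rw [← Real.sqrt_mul (E.resistance_nonneg x y), Real.sqrt_lt' (by positivity)]
      rw [lt_div_iff₀ (by positivity)] at hy
      have := E.resistance_nonneg x y
      linarith
    have h3 := huf x
    have h4 := huf y
    rw [dist_self] at h3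
    rw [abs_le] at h1 h3 h4
    linarith

lemma closureResistanceForm_isRegular :
    (h.closureResistanceForm hD hr hc hc1 hrK hrr).IsRegular := by
  have hcomp := h.compactSpace
  unfold ResistanceForm.IsRegular
  rw [h.closureResistanceForm_topology hD hr hc hc1 hrK hrr]
  refine ⟨inferInstance, fun f hf _ ε hε => ?_⟩
  obtain ⟨n, u, hu, huf⟩ := h.exists_isCellConst_approx hc hc1 hD hf (half_pos hε)
  refine ⟨⟨u, hu.mem_closureDom h hD hr⟩, hu.continuous hc, .of_compactSpace _, fun x => ?_⟩
  rw [abs_sub_comm]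
  have := huf x
  dsimp only
  linarith

/-- Here `t` is a distance in the scale of root resistance below which `u` and `v` have no pair of
points where both are non-zero. The graph cells of index `n` have diameter at most `C * t₀ ^ n` in
this scale, so none of them sees both functions. -/
lemma graphForm_eventually_zero : ∃ C t₀ : ℝ, 0 < t₀ ∧ t₀ < 1 ∧ ∀ (n : ℕ) (t : ℝ) (u v : H → ℝ),
    (∀ x y, (∀ w ∈ h.closureDom D ρ r, |w x - w y| ≤ t * √(h.limForm D ρ r w w)) →
      u x = 0 ∨ v y = 0) → C * t₀ ^ n ≤ t → h.graphForm D ρ r n u v = 0 := by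
  choose C' σ hC' hσ0 hσ1 hb using fun b => (hD b).exists_cell_bound
  obtain ⟨C, hC, hCC⟩ := exists_pos_forall_le C'
  have hr1 : r < 1 := hrr.trans_le (SierpinskiLike.resistance_factor_le_one hrK)
  have hs1 : √r < 1 := by rw [Real.sqrt_lt' one_pos]; simpa using hr1
  have hs0 : 0 < √r := Real.sqrt_pos.2 hr
  obtain ⟨t₀, ht1, hst, hσt⟩ := exists_lt_one_forall_le hσ1 hs1
  have ht0 : 0 < t₀ := hs0.trans_le hst
  refine ⟨C / t₀, t₀, ht0, ht1, fun n => ?_⟩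
  induction n with
  | zero => intro t u v _ _; rfl
  | succ n ih =>
    intro t u v huv hnt
    have hCn : C * t₀ ^ n ≤ t := by
      rw [pow_succ', ← mul_assoc, div_mul_cancel₀ _ ht0.ne'] at hnt; exact hnt
    rw [graphForm, Finset.sum_eq_zero fun b _ => ?_, Finset.sum_eq_zero fun i _ => ?_, add_zero]
    -- Cell maps contract root resistance by `√r`, so inside a cell the separation grows to `t /
    -- √r`.
    · rw [ih (t / √r) (u ∘ h.cellMap i) (v ∘ h.cellMap i) (fun x y hxy => huv _ _ fun w hw => ?_)
        ?_, mul_zero]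
      · rw [le_div_iff₀ hs0]
        refine (mul_le_mul_of_nonneg_left hst (by positivity)).trans ?_
        rwa [mul_assoc, ← pow_succ]
      · refine (hxy _ (h.closureDom_comp hD hr hw i)).trans ?_
        refine (mul_le_mul_of_nonneg_left (h.sqrt_limForm_comp_le hD hr
          (h.closureDom_subset_finDom hD hr hw) i) ?_).trans_eq ?_
        · have : 0 ≤ t := le_trans (by positivity) hCn
          positivity
        · rw [← mul_assoc, div_mul_cancel₀ _ hs0.ne']
    · refine PCFSet.levelEnergy_eq_zero fun α p q => huv _ _ fun w hw => ?_
      have hwb := ((h.mem_closureDom_iff hD hr hc hc1).1 hw).2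
      refine (hb b n α _ (hwb b) p q).trans ?_
      have h1 := (h.energy_le_bondEnergy hD hwb b).trans
        (h.bondEnergy_le_limForm hD hr (h.closureDom_subset_finDom hD hr hw))
      refine mul_le_mul ?_ (Real.sqrt_le_sqrt h1) (Real.sqrt_nonneg _)
        (le_trans (by positivity) hCn)
      refine le_trans ?_ hCn
      exact mul_le_mul (hCC b) (pow_le_pow_left₀ (hσ0 b).le (hσt b) n) (pow_nonneg (hσ0 b).le n)
        hC.le

lemma closureResistanceForm_isLocal :
    (h.closureResistanceForm hD hr hc hc1 hrK hrr).IsLocal := by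
  set E := h.closureResistanceForm hD hr hc hc1 hrK hrr with hE
  unfold ResistanceForm.IsLocal
  let := E.topology
  intro u v ⟨ε, hε, huv⟩
  obtain ⟨C, t₀, ht0, ht1, hz⟩ := h.graphForm_eventually_zero hD hr hc hc1 hrK hrr
  have hA := h.graphForm_isFormSeq hD hr
  have hpos : 0 < √(ε / 2) := by positivity
  have h1 : ∀ᶠ n in atTop, h.graphForm D ρ r n u.1 v.1 = 0 := by
    have hlim : Tendsto (fun n : ℕ => C * t₀ ^ n) atTop (𝓝 0) := by
      simpa using (tendsto_pow_atTop_nhds_zero_of_lt_one ht0.le ht1).const_mul C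
    filter_upwards [hlim.eventually_lt_const hpos] with n hn
    refine hz n _ u.1 v.1 (fun x y hxy => ?_) hn.le
    by_contra hne
    push Not at hne
    have h2 := huv x (subset_tsupport _ hne.1) y (subset_tsupport _ hne.2)
    have h3 : √(E.resistance x y) ≤ √(ε / 2) := E.sqrt_resistance_le hpos.le fun w hw => by
      rw [h.closureResistanceForm_energy hD hr hc hc1 hrK hrr hw hw]
      exact hxy w hw
    rw [Real.sqrt_le_sqrt_iff (by positivity)] at h3
    linarith
  refine tendsto_nhds_unique (hA.tendsto (h.closureDom_subset_finDom hD hr u.2)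
    (h.closureDom_subset_finDom hD hr v.2)) ?_
  exact tendsto_const_nhds.congr' (h1.mono fun n hn => hn.symm)

lemma closureResistanceForm_selfSimilar :
    h.SelfSimilar D ρ r (h.closureResistanceForm hD hr hc hc1 hrK hrr) where
  mem_dom_iff _ := h.mem_closureDom_iff hD hr hc hc1
  energy_eq u hu v hv := by
    rw [h.closureResistanceForm_energy hD hr hc hc1 hrK hrr hu hv,
      h.limForm_eq hD hr (h.closureDom_subset_finDom hD hr hu)
        (h.closureDom_subset_finDom hD hr hv), add_comm, bondEnergy]
    congr 1
    refine Finset.sum_congr rfl fun i _ => ?_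
    rw [h.closureResistanceForm_energy hD hr hc hc1 hrK hrr (h.closureDom_comp hD hr hu i)
      (h.closureDom_comp hD hr hv i)]

end

end IsHybrid

/-! ### Algebra and topology of general resistance forms -/

namespace ResistanceForm

variable {X : Type*} (E : ResistanceForm X)

lemma ext_energy {E F : ResistanceForm X} (hdom : E.dom = F.dom)
    (hen : ∀ u ∈ E.dom, ∀ v ∈ E.dom, E.energy u v = F.energy u v) : E = F := by
  have key : ∀ (u v : X → ℝ) (hu : u ∈ E.dom) (hv : v ∈ E.dom) (hu' : u ∈ F.dom) (hv' : v ∈ F.dom),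
      E.form ⟨u, hu⟩ ⟨v, hv⟩ = F.form ⟨u, hu'⟩ ⟨v, hv'⟩ := fun u v hu hv hu' hv' => by
    rw [← energy_of_mem, ← energy_of_mem, hen u hu v hv]
  obtain ⟨domE, formE⟩ := E
  obtain ⟨domF, formF⟩ := F
  dsimp only at hdom
  subst hdom
  obtain rfl : formE = formF := LinearMap.ext₂ fun u v => key u.1 v.1 u.2 v.2 u.2 v.2
  rfl

lemma energy_add {u v : X → ℝ} (hu : u ∈ E.dom) (hv : v ∈ E.dom) :
    E.energy (u + v) (u + v) = E.energy u u + 2 * E.energy u v + E.energy v v := by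
  rw [E.energy_of_mem (E.dom.add_mem hu hv) (E.dom.add_mem hu hv), E.energy_of_mem hu hu,
    E.energy_of_mem hu hv, E.energy_of_mem hv hv]
  change E.form (⟨u, hu⟩ + ⟨v, hv⟩) (⟨u, hu⟩ + ⟨v, hv⟩) = _
  simp only [map_add, LinearMap.add_apply, E.symm ⟨v, hv⟩ ⟨u, hu⟩]
  ring

lemma energy_smul_right (a : ℝ) {u v : X → ℝ} (hu : u ∈ E.dom) (hv : v ∈ E.dom) :
    E.energy u (a • v) = a * E.energy u v := by
  rw [E.energy_of_mem hu (E.dom.smul_mem a hv), E.energy_of_mem hu hv]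
  change E.form ⟨u, hu⟩ (a • ⟨v, hv⟩) = _
  rw [map_smul, smul_eq_mul]

lemma energy_comm (u v : X → ℝ) : E.energy u v = E.energy v u := by
  by_cases h : u ∈ E.dom ∧ v ∈ E.dom
  · rw [E.energy_of_mem h.1 h.2, E.energy_of_mem h.2 h.1, E.symm]
  · rw [energy, energy, dif_neg h, dif_neg fun h' => h h'.symm]

lemma energy_smul (a : ℝ) {u : X → ℝ} (hu : u ∈ E.dom) :
    E.energy (a • u) (a • u) = a ^ 2 * E.energy u u := by
  rw [E.energy_smul_right a (E.dom.smul_mem a hu) hu, E.energy_comm, E.energy_smul_right a hu hu]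
  ring

lemma energy_sub {u v : X → ℝ} (hu : u ∈ E.dom) (hv : v ∈ E.dom) :
    E.energy (u - v) (u - v) = E.energy u u - 2 * E.energy u v + E.energy v v := by
  rw [sub_eq_add_neg, ← neg_one_smul ℝ v, E.energy_add hu (E.dom.smul_mem _ hv),
    E.energy_smul_right _ hu hv, E.energy_smul _ hv]
  ring

lemma energy_sub_le {u v : X → ℝ} (hu : u ∈ E.dom) (hv : v ∈ E.dom) :
    E.energy (u - v) (u - v) ≤ 2 * E.energy u u + 2 * E.energy v v := by
  have h1 := E.energy_nonneg (E.dom.add_mem hu hv)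
  rw [E.energy_add hu hv] at h1
  rw [E.energy_sub hu hv]
  linarith

lemma energy_const_right {u : X → ℝ} (hu : u ∈ E.dom) (a : ℝ) :
    E.energy u (fun _ => a) = 0 := by
  have ha := E.const_mem a
  have h0 : E.energy (fun _ => a) (fun _ => a) = 0 := by
    rw [E.energy_of_mem ha ha, E.eq_zero_iff]; exact fun _ _ => rfl
  by_contra hb
  -- If the mixed term were non-zero, this multiple of the constant would bring the energy down to
  -- `-1`.
  have h1 := E.energy_nonneg (E.dom.add_mem hu (E.dom.smul_mem
    (-(E.energy u u + 1) / (2 * E.energy u fun _ => a)) ha))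
  rw [E.energy_add hu (E.dom.smul_mem _ ha), E.energy_smul_right _ hu ha, E.energy_smul _ ha, h0]
    at h1
  have h2 : 2 * (-(E.energy u u + 1) / (2 * E.energy u fun _ => a) * E.energy u fun _ => a)
      = -(E.energy u u + 1) := by field_simp
  rw [h2] at h1
  linarith

lemma energy_const (a : ℝ) : E.energy (fun _ => a) (fun _ => a) = 0 :=
  E.energy_const_right (E.const_mem a) a

lemma energy_sub_const {u : X → ℝ} (hu : u ∈ E.dom) (a : ℝ) :
    E.energy (u - fun _ => a) (u - fun _ => a) = E.energy u u := by
  rw [E.energy_sub hu (E.const_mem a), E.energy_const_right hu, E.energy_const]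
  ring

lemma resistance_self (x : X) : E.resistance x x = 0 := by
  have := E.sqrt_resistance_le (x := x) (y := x) le_rfl fun u _ => by simp
  exact (Real.sqrt_eq_zero (E.resistance_nonneg x x)).1 (this.antisymm (Real.sqrt_nonneg _))

/-- For the root of the resistance the triangle inequality is immediate from that for `|u x - u z|`,
and the root yields the same topology. -/
lemma sqrt_resistance_triangle (x y z : X) :
    √(E.resistance x z) ≤ √(E.resistance x y) + √(E.resistance y z) :=
  E.sqrt_resistance_le (by positivity) fun u hu => by
    rw [add_mul]
    exact (abs_sub_le _ _ _).trans
      (add_le_add (E.abs_sub_le_resistance hu x y) (E.abs_sub_le_resistance hu y z))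

lemma isOpen_ball (x : X) (ε : ℝ) : IsOpen[E.topology] {y | √(E.resistance x y) < ε} := by
  intro y hy
  have hy' : 0 < ε - √(E.resistance x y) := sub_pos.2 hy
  refine ⟨(ε - √(E.resistance x y)) ^ 2, by positivity, fun z hz => ?_⟩
  have h1 : √(E.resistance y z) < ε - √(E.resistance x y) := (Real.sqrt_lt' hy').2 hz
  have h2 := E.sqrt_resistance_triangle x y z
  change √(E.resistance x z) < ε
  linarith

lemma isOpen_lt {u : X → ℝ} (hu : u ∈ E.dom) (a : ℝ) : IsOpen[E.topology] {x | a < u x} := by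
  intro x hx
  have hx' : 0 < u x - a := sub_pos.2 hx
  have hE := E.energy_nonneg hu
  refine ⟨(u x - a) ^ 2 / (E.energy u u + 1), by positivity, fun y hy => ?_⟩
  have h1 := E.abs_sub_le_resistance hu x y
  have h2 : √(E.resistance x y) * √(E.energy u u) < u x - a := by
    rw [← Real.sqrt_mul (E.resistance_nonneg x y), Real.sqrt_lt' hx']
    rw [lt_div_iff₀ (by positivity)] at hy
    have := E.resistance_nonneg x y
    linarith
  rw [abs_le] at h1
  change a < u y
  linarith

end ResistanceForm

/-! ### The domain of an arbitrary self-similar form -/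

namespace IsHybrid

variable {K : SierpinskiLike} {c : ℝ} {B : Type*} {bond : B → PCFSet}
  {att : B → Finset (Fin K.N)} {H : Set Plane} {h : IsHybrid K c bond att H}
  [Fintype B] {D : ∀ b, Matrix (bond b).boundary (bond b).boundary ℝ}
  {ρ : ∀ b, Fin (bond b).N → ℝ} {r : ℝ}

namespace SelfSimilar

variable {E : ResistanceForm H} (hE : h.SelfSimilar D ρ r E)
  (hD : ∀ b, (bond b).IsRegularHarmonicStructure (D b) (ρ b)) (hr : 0 < r)
include hE hD hr

lemma energy_comp_le {u : H → ℝ} (hu : u ∈ E.dom) (i : Fin K.N) :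
    E.energy (u ∘ h.cellMap i) (u ∘ h.cellMap i) ≤ r * E.energy u u := by
  obtain ⟨h1, h2⟩ := (hE.mem_dom_iff u).1 hu
  rw [← inv_mul_le_iff₀ hr, hE.energy_eq u hu u hu]
  have h3 := Finset.single_le_sum (f := fun i =>
    r⁻¹ * E.energy (u ∘ h.cellMap i) (u ∘ h.cellMap i))
    (fun i _ => mul_nonneg (inv_nonneg.2 hr.le) (E.energy_nonneg (h1 i))) (Finset.mem_univ i)
  have h4 := h.bondEnergy_nonneg hD h2
  rw [bondEnergy] at h4
  linarith

lemma sqrt_energy_comp_le {u : H → ℝ} (hu : u ∈ E.dom) (i : Fin K.N) :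
    √(E.energy (u ∘ h.cellMap i) (u ∘ h.cellMap i)) ≤ √r * √(E.energy u u) :=
  sqrt_le_mul_sqrt (Real.sqrt_nonneg r) (E.energy_nonneg hu) (Real.sq_sqrt hr.le).ge
    (hE.energy_comp_le hD hr hu i)

/-- On cellwise constant functions the energy is determined. -/
lemma energy_isCellConst {n : ℕ} : ∀ {u : H → ℝ}, h.IsCellConst D ρ n u →
    u ∈ E.dom ∧ E.energy u u = h.limForm D ρ r u u := by
  induction n with
  | zero =>
    rintro u ⟨a, rfl⟩
    exact ⟨E.const_mem a, by rw [E.energy_const, (h.const_mem_finDom hD hr a).2]⟩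
  | succ n ih =>
    intro u hu
    have hud : u ∈ E.dom := (hE.mem_dom_iff u).2 ⟨fun i => (ih (hu.1 i)).1, hu.2⟩
    have huf := hu.mem_finDom (r := r) hD hr
    refine ⟨hud, ?_⟩
    rw [hE.energy_eq u hud u hud, h.limForm_eq hD hr huf huf, add_comm, bondEnergy]
    congr 1
    exact Finset.sum_congr rfl fun i _ => by rw [(ih (hu.1 i)).2]

-- There are finitely many vertices, and each pair has finite resistance by the axioms; no bound
-- over all of `H` is available at this stage.
omit [Fintype B] hE hD hr in
lemma exists_vertex_bound : ∃ C > 0, ∀ u ∈ E.dom, ∀ p q : H,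
    (p : Plane) ∈ K.boundarySet → (q : Plane) ∈ K.boundarySet →
      |u p - u q| ≤ C * √(E.energy u u) := by
  have hfin : K.boundarySet.Finite := K.boundary.finite_toSet.image _
  have : Finite {p : H | (p : Plane) ∈ K.boundarySet} :=
    (hfin.preimage Subtype.val_injective.injOn).to_subtype
  obtain ⟨C, hC, hCC⟩ := exists_pos_forall_le
    fun pq : {p : H | (p : Plane) ∈ K.boundarySet} × {p : H | (p : Plane) ∈ K.boundarySet} =>
      √(E.resistance pq.1.1 pq.2.1)
  exact ⟨C, hC, fun u hu p q hp hq => (E.abs_sub_le_resistance hu p q).trans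
    (mul_le_mul_of_nonneg_right (hCC (⟨p, hp⟩, ⟨q, hq⟩)) (Real.sqrt_nonneg _))⟩

variable (hc : 0 < c) (hc1 : c < 1)
include hc hc1

/-- Resistances to a fixed point do not decrease too much under the cell map. -/
lemma exists_resistance_le_comp {p : H} (hp : (p : Plane) ∈ K.boundarySet) {i : Fin K.N}
    (hi : h.cellMap i p = p) : ∃ C : ℝ, 1 ≤ C ∧ ∀ x,
      √(E.resistance p x) ≤ C * √(E.resistance p (h.cellMap i x)) := by
  classical
  obtain ⟨C₁, hC₁, hv⟩ := exists_vertex_bound (K := K) (E := E)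
  obtain ⟨C₂, hC₂, hglue⟩ := h.exists_glue_lift hc hc1 hD
  set C := √(1 + r⁻¹ + ∑ _b : B, C₂ * C₁ ^ 2) with hCdef
  have hsum : 0 ≤ ∑ _b : B, C₂ * C₁ ^ 2 := Finset.sum_nonneg fun _ _ => by positivity
  have hri : 0 < r⁻¹ := inv_pos.2 hr
  refine ⟨C, Real.one_le_sqrt.2 (by linarith), fun x =>
    E.sqrt_resistance_le (by positivity) fun u hu => ?_⟩
  have hE0 := E.energy_nonneg hu
  -- A competitor for `p` and the image of `x`: `u - u p` is planted in the cell `i`, zero in the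
  -- others, and the mismatch at vertices, at most `C₁ * √(E.energy u u)`, is repaired on the bonds.
  let g : Fin K.N → H → ℝ := fun j => if j = i then u - fun _ => u p else fun _ => 0
  have hg : ∀ j, g j ∈ E.dom := fun j => by
    by_cases hj : j = i
    · simp only [g, if_pos hj]; exact E.dom.sub_mem hu (E.const_mem _)
    · simp only [g, if_neg hj]; exact E.const_mem 0
  obtain ⟨v, hv1, hv2⟩ := hglue g (fun b _ => 0) (C₁ * √(E.energy u u)) (by positivity)
    (fun b => (hD b).const_mem 0) fun b x j y _ hy => by
      by_cases hj : j = i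
      · simp only [g, if_pos hj, sub_zero, Pi.sub_apply]; exact hv u hu y p hy hp
      · simp only [g, if_neg hj, sub_zero, abs_zero]; positivity
  have hvd : v ∈ E.dom := (hE.mem_dom_iff v).2
    ⟨fun j => by rw [hv1]; exact hg j, fun b => (hv2 b).1⟩
  have hvx : ∀ x, v (h.cellMap i x) = u x - u p := fun x => by
    have := congrFun (hv1 i) x
    simpa [g] using this
  have hve : E.energy v v ≤ (1 + r⁻¹ + ∑ _b : B, C₂ * C₁ ^ 2) * E.energy u u := by
    rw [hE.energy_eq v hvd v hvd]
    have h1 : ∑ j, r⁻¹ * E.energy (v ∘ h.cellMap j) (v ∘ h.cellMap j) = r⁻¹ * E.energy u u := by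
      rw [Finset.sum_eq_single i]
      · rw [hv1]; simp only [g, if_true]; rw [E.energy_sub_const hu]
      · intro j _ hj
        rw [hv1]; simp only [g, if_neg hj]; rw [E.energy_const, mul_zero]
      · simp
    have h2 : ∑ b, (bond b).energy (D b) (ρ b) (v ∘ h.bondIncl b) (v ∘ h.bondIncl b)
        ≤ (∑ _b : B, C₂ * C₁ ^ 2) * E.energy u u := by
      rw [Finset.sum_mul]
      refine Finset.sum_le_sum fun b _ => ((hv2 b).2.2).trans_eq ?_
      rw [(hD b).energy_const, mul_pow, Real.sq_sqrt hE0]; ring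
    rw [h1, add_mul, add_mul]
    linarith
  have h3 := E.abs_sub_le_resistance hvd p (h.cellMap i x)
  have h4 : v p = 0 := by rw [← hi, hvx, sub_self]
  rw [h4, hvx, zero_sub, neg_sub] at h3
  refine h3.trans ?_
  rw [mul_comm C, mul_assoc]
  refine mul_le_mul_of_nonneg_left ?_ (Real.sqrt_nonneg _)
  rw [hCdef, ← Real.sqrt_mul (by positivity)]
  exact Real.sqrt_le_sqrt hve

omit hc hc1 in
lemma resistance_comp_le {p : H} {i : Fin K.N} (hi : h.cellMap i p = p) (x : H) :
    √(E.resistance p (h.cellMap i x)) ≤ √r * √(E.resistance p x) :=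
  E.sqrt_resistance_le (by positivity) fun u hu => by
    have h1 := E.abs_sub_le_resistance ((hE.mem_dom_iff u).1 hu |>.1 i) p x
    have h2 := mul_le_mul_of_nonneg_left (hE.sqrt_energy_comp_le hD hr hu i)
      (Real.sqrt_nonneg (E.resistance p x))
    rw [Function.comp_apply, hi] at h1
    rw [Function.comp_apply] at h1
    refine h1.trans (h2.trans_eq (by ring))

/-- The range of an iterated cell map is eventually away from any point but the fixed point, in
the sense of the topology of the resistance metric. -/
lemma exists_mem_interior_compl {p : H} {i : Fin K.N} (hi : h.cellMap i p = p) {x : H}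
    (hx : x ≠ p) : ∃ n, ∃ U : Set H, IsOpen[E.topology] U ∧ x ∈ U ∧
      ∀ y, (h.cellMap i)^[n] y ∉ U := by
  have hd : 0 < dist x p := dist_pos.2 hx
  obtain ⟨m, u, hu, huf⟩ := h.exists_isCellConst_approx hc hc1 hD
    (f := fun z => dist z p) (by fun_prop) (show 0 < dist x p / 4 by positivity)
  have hdist : ∀ (n : ℕ) (y : H), dist ((h.cellMap i)^[n] y) p = c ^ n * dist y p := by
    intro n y
    induction n with
    | zero => simp
    | succ n ih =>
      rw [Function.iterate_succ_apply']
      nth_rewrite 1 [← hi]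
      rw [show dist (h.cellMap i ((h.cellMap i)^[n] y)) (h.cellMap i p)
        = c * dist ((h.cellMap i)^[n] y) p from K.dist_shrunkSim hc i _ _, ih, pow_succ']
      ring
  have := h.compactSpace
  obtain ⟨R, hR⟩ := (Metric.isBounded_iff.1 (isCompact_univ (X := H)).isBounded)
  obtain ⟨n, hn⟩ := exists_pow_lt_of_lt_one
    (show 0 < dist x p / 4 / max R 1 by positivity) hc1
  rw [lt_div_iff₀ (by positivity)] at hn
  refine ⟨n, {z | dist x p / 2 < u z}, E.isOpen_lt (hE.energy_isCellConst hD hr hu).1 _, ?_, ?_⟩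
  · have h1 := huf x
    rw [abs_le] at h1
    change dist x p / 2 < u x
    linarith
  · intro y hy
    have h1 := huf ((h.cellMap i)^[n] y)
    have h2 : dist y p ≤ max R 1 := (hR (mem_univ y) (mem_univ p)).trans (le_max_left _ _)
    have h3 := mul_le_mul_of_nonneg_left h2 (pow_nonneg hc.le n)
    rw [hdist, abs_le] at h1
    change dist x p / 2 < _ at hy
    linarith

/-- If the resistance metric is locally compact, then it is bounded. -/
lemma exists_resistance_bound (hr1 : r < 1) (hreg : E.IsRegular) :
    ∃ M > 0, ∀ u ∈ E.dom, ∀ x y, |u x - u y| ≤ M * √(E.energy u u) := by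
  obtain ⟨p', hp'⟩ := K.boundary_nonempty
  have hpV : (p' : Plane) ∈ K.boundarySet := ⟨p', hp', rfl⟩
  obtain ⟨p, hp⟩ : ∃ p : H, (p : Plane) ∈ K.boundarySet :=
    ⟨⟨p', h.boundarySet_subset hc hc1 hpV⟩, hpV⟩
  obtain ⟨i, hi⟩ := h.exists_fixing hp
  obtain ⟨C, hC1, hC⟩ := hE.exists_resistance_le_comp hD hr hc hc1 hp hi
  have hC0 : 0 < C := by linarith
  have hs1 : √r < 1 := by rw [Real.sqrt_lt' one_pos]; simpa using hr1
  let f : H → ℝ := fun x => √(E.resistance p x)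
  have hf0 : ∀ x, 0 ≤ f x := fun x => Real.sqrt_nonneg _
  -- A gap: on deep images of the cell map the root resistance to `p` takes no value between `ε / C`
  -- and `ε`.
  obtain ⟨ε, hε, n₀, hgap⟩ : ∃ ε > 0, ∃ n₀, ∀ n ≥ n₀, ∀ y,
      f ((h.cellMap i)^[n] y) < ε → f ((h.cellMap i)^[n] y) < ε / C := by
    let := E.topology
    have hlc : LocallyCompactSpace H := hreg.1
    obtain ⟨N, hN, hNp⟩ := exists_compact_mem_nhds p
    obtain ⟨U, hUN, hU, hpU⟩ := mem_nhds_iff.1 hNp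
    obtain ⟨ε₀, hε₀, hball⟩ := hU p hpU
    have hε : 0 < √ε₀ := Real.sqrt_pos.2 hε₀
    refine ⟨√ε₀, hε, ?_⟩
    -- Every point other than `p` is eventually interior to the complement of the deep images, so
    -- these sets exhaust the compact neighbourhood; a deep image point in it must lie in the ball
    -- of radius `√ε₀ / C`.
    let V : ℕ → Set H := fun n =>
      {y | √(E.resistance p y) < √ε₀ / C} ∪ interior (range (h.cellMap i)^[n])ᶜ
    have hVopen : ∀ n, IsOpen (V n) := fun n => (E.isOpen_ball p _).union isOpen_interior
    have hVmono : Monotone V := monotone_nat_of_le_succ fun n => by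
      refine union_subset_union_right _ (interior_mono (compl_subset_compl.2 ?_))
      rintro _ ⟨y, rfl⟩
      exact ⟨h.cellMap i y, (Function.iterate_succ_apply _ _ _).symm⟩
    have hcov : N ⊆ ⋃ n, V n := by
      intro x _
      by_cases hx : x = p
      · refine mem_iUnion.2 ⟨0, Or.inl ?_⟩
        change √(E.resistance p x) < _
        rw [hx, E.resistance_self, Real.sqrt_zero]
        positivity
      · obtain ⟨n, W, hW, hxW, hWn⟩ := hE.exists_mem_interior_compl hD hr hc hc1 hi hx
        refine mem_iUnion.2 ⟨n, Or.inr (mem_interior.2 ⟨W, ?_, hW, hxW⟩)⟩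
        rintro z hz ⟨y, rfl⟩
        exact hWn y hz
    obtain ⟨n₀, hn₀⟩ := hN.elim_directed_cover V hVopen hcov hVmono.directed_le
    refine ⟨n₀, fun n hn y hy => ?_⟩
    have hyN : (h.cellMap i)^[n] y ∈ N := hUN (hball _ ((Real.sqrt_lt_sqrt_iff
      (E.resistance_nonneg _ _)).1 hy))
    rcases hVmono hn (hn₀ hyN) with h1 | h1
    · exact h1
    · exact absurd ⟨y, rfl⟩ (interior_subset h1)
  have hsmall : ∀ y, f ((h.cellMap i)^[n₀] y) < ε / C := by
    intro y
    by_contra hlarge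
    -- One application of the cell map reduces `f` by at most the factor `C`, so an orbit beyond the
    -- gap can never cross it. But `f` tends to zero along orbits, a contradiction.
    have hall : ∀ k, ε ≤ f ((h.cellMap i)^[n₀ + k] y) := by
      intro k
      induction k with
      | zero => exact not_lt.1 fun hlt => hlarge (hgap n₀ le_rfl y hlt)
      | succ k ih =>
        refine not_lt.1 fun hlt => ?_
        have h1 := hgap (n₀ + (k + 1)) (by omega) y hlt
        have h2 := hC ((h.cellMap i)^[n₀ + k] y)
        rw [← Function.iterate_succ_apply' (h.cellMap i)] at h2
        rw [lt_div_iff₀ hC0] at h1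
        have h3 : f ((h.cellMap i)^[n₀ + k] y) ≤ C * f ((h.cellMap i)^[n₀ + (k + 1)] y) := h2
        linarith
    have hdec : ∀ k, f ((h.cellMap i)^[n₀ + k] y) ≤ √r ^ k * f ((h.cellMap i)^[n₀] y) := by
      intro k
      induction k with
      | zero => simp
      | succ k ih =>
        have h1 := hE.resistance_comp_le hD hr hi ((h.cellMap i)^[n₀ + k] y)
        rw [← Function.iterate_succ_apply' (h.cellMap i)] at h1
        refine h1.trans ((mul_le_mul_of_nonneg_left ih (Real.sqrt_nonneg r)).trans_eq ?_)
        rw [pow_succ']; ring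
    have hlim : Tendsto (fun k => √r ^ k * f ((h.cellMap i)^[n₀] y)) atTop (𝓝 0) := by
      simpa using (tendsto_pow_atTop_nhds_zero_of_lt_one (Real.sqrt_nonneg r) hs1).mul_const
        (f ((h.cellMap i)^[n₀] y))
    have := ge_of_tendsto' hlim fun k => (hall k).trans (hdec k)
    linarith
  have hiter : ∀ n y, f y ≤ C ^ n * f ((h.cellMap i)^[n] y) := by
    intro n y
    induction n with
    | zero => simp
    | succ n ih =>
      have h1 := hC ((h.cellMap i)^[n] y)
      rw [← Function.iterate_succ_apply' (h.cellMap i)] at h1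
      refine ih.trans ((mul_le_mul_of_nonneg_left h1 (by positivity)).trans_eq ?_)
      rw [pow_succ]; ring
  have hb : ∀ y, f y ≤ C ^ n₀ * (ε / C) := fun y =>
    (hiter n₀ y).trans (mul_le_mul_of_nonneg_left (hsmall y).le (by positivity))
  refine ⟨2 * (C ^ n₀ * (ε / C)), by positivity, fun u hu x y => ?_⟩
  have h1 := E.abs_sub_le_resistance hu p x
  have h2 := E.abs_sub_le_resistance hu p y
  have h3 := mul_le_mul_of_nonneg_right (hb x) (Real.sqrt_nonneg (E.energy u u))
  have h4 := mul_le_mul_of_nonneg_right (hb y) (Real.sqrt_nonneg (E.energy u u))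
  simp only [f] at h3 h4
  rw [abs_le] at *
  constructor <;> linarith

/-- The domain is contained in the closure of the cellwise constant functions. -/
lemma mem_closureDom (hr1 : r < 1) (hreg : E.IsRegular) {u : H → ℝ} (hu : u ∈ E.dom) :
    u ∈ h.closureDom D ρ r := by
  obtain ⟨M, hM, hosc⟩ := hE.exists_resistance_bound hD hr hc hc1 hr1 hreg
  obtain ⟨C, hC, hglue⟩ := h.exists_glue_lift hc hc1 hD
  have hs0 := Real.sqrt_nonneg r
  have hs1 : √r < 1 := by rw [Real.sqrt_lt' one_pos]; simpa using hr1
  obtain ⟨x₀, hx₀⟩ := h.nonempty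
  have key : ∀ (n : ℕ) (u : H → ℝ), u ∈ E.dom → ∃ w, h.IsCellConst D ρ n w ∧
      (∀ x : H, (x : Plane) ∈ K.boundarySet → |w x - u x| ≤ M * √r ^ n * √(E.energy u u)) ∧
      (∀ x, |w x - u x| ≤ (1 + C) * M * √r ^ n * √(E.energy u u)) ∧
      h.limForm D ρ r w w ≤
        (2 + (∑ _b : B, C * M ^ 2) * ∑ k ∈ Finset.range n, r ^ (k + 1)) * E.energy u u := by
    intro n
    induction n with
    | zero =>
      intro u hu
      have h1 : ∀ x, |u ⟨x₀, hx₀⟩ - u x| ≤ M * √(E.energy u u) := fun x => hosc u hu _ x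
      refine ⟨fun _ => u ⟨x₀, hx₀⟩, ⟨_, rfl⟩, fun x _ => by simpa using h1 x, fun x => ?_, ?_⟩
      · refine (h1 x).trans ?_
        rw [pow_zero, mul_one]
        refine mul_le_mul_of_nonneg_right ?_ (Real.sqrt_nonneg _)
        nlinarith
      · rw [(h.const_mem_finDom hD hr _).2]
        have := E.energy_nonneg hu
        simp only [Finset.range_zero, Finset.sum_empty, mul_zero, add_zero]
        positivity
    | succ n ih =>
      intro u hu
      have hu0 := E.energy_nonneg hu
      obtain ⟨hui, hub⟩ := (hE.mem_dom_iff u).1 hu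
      choose g hg hgV hgA hgE using fun i => ih _ (hui i)
      have hscale : ∀ i, ∀ A : ℝ, 0 ≤ A → A * √r ^ n *
          √(E.energy (u ∘ h.cellMap i) (u ∘ h.cellMap i)) ≤ A * √r ^ (n + 1) * √(E.energy u u) := by
        intro i A hA
        refine (mul_le_mul_of_nonneg_left (hE.sqrt_energy_comp_le hD hr hu i)
          (by positivity)).trans_eq ?_
        rw [pow_succ]; ring
      obtain ⟨v, hv1, hv2⟩ := hglue g (fun b => u ∘ h.bondIncl b)
        (M * √r ^ (n + 1) * √(E.energy u u)) (by positivity) hub fun b x i y hxy hy => by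
          have := (hgV i y hy).trans (hscale i M hM.le)
          rw [Function.comp_apply] at this
          rwa [Function.comp_apply, hxy]
      have hvx : ∀ i y, v (h.cellMap i y) = g i y := fun i y => congrFun (hv1 i) y
      have hv : h.IsCellConst D ρ (n + 1) v :=
        ⟨fun i => by rw [hv1]; exact hg i, fun b => (hv2 b).1⟩
      have hvd := hv.mem_finDom (r := r) hD hr
      refine ⟨v, hv, fun x hx => ?_, fun x => ?_, ?_⟩
      · obtain ⟨i, hi⟩ := h.exists_fixing hx
        have := (hgV i x hx).trans (hscale i M hM.le)
        rwa [← hvx, Function.comp_apply, hi] at this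
      · rcases h.cover x with ⟨i, y, rfl⟩ | ⟨b, y, rfl⟩
        · rw [hvx]
          exact (hgA i y).trans (hscale i ((1 + C) * M) (by positivity))
        · refine ((hv2 b).2.1 y).trans ?_
          have : 0 ≤ M * √r ^ (n + 1) * √(E.energy u u) := by positivity
          linarith
      · rw [h.limForm_eq hD hr hvd hvd, hE.energy_eq u hu u hu, Finset.sum_range_succ]
        set A := 2 + (∑ _b : B, C * M ^ 2) * ∑ k ∈ Finset.range n, r ^ (k + 1) with hA
        have hA2 : 2 ≤ A := by
          rw [hA]
          have : 0 ≤ (∑ _b : B, C * M ^ 2) * ∑ k ∈ Finset.range n, r ^ (k + 1) := by positivity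
          linarith
        have h1 : ∑ i, r⁻¹ * h.limForm D ρ r (v ∘ h.cellMap i) (v ∘ h.cellMap i)
            ≤ A * ∑ i, r⁻¹ * E.energy (u ∘ h.cellMap i) (u ∘ h.cellMap i) := by
          rw [Finset.mul_sum]
          refine Finset.sum_le_sum fun i _ => ?_
          rw [hv1, mul_left_comm]
          exact mul_le_mul_of_nonneg_left (hgE i) (inv_nonneg.2 hr.le)
        have h2 : h.bondEnergy D ρ v v ≤ 2 * h.bondEnergy D ρ u u +
            (∑ _b : B, C * M ^ 2) * r ^ (n + 1) * E.energy u u := by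
          rw [bondEnergy, bondEnergy, Finset.mul_sum, Finset.sum_mul, Finset.sum_mul,
            ← Finset.sum_add_distrib]
          refine Finset.sum_le_sum fun b _ => ((hv2 b).2.2).trans_eq ?_
          rw [mul_pow, mul_pow, Real.sq_sqrt hu0, ← pow_mul, mul_comm (n + 1), pow_mul,
            Real.sq_sqrt hr.le]
          ring
        have h3 := mul_le_mul_of_nonneg_right hA2 (h.bondEnergy_nonneg hD hub)
        have h4 : 2 + (∑ _b : B, C * M ^ 2) * (∑ k ∈ Finset.range n, r ^ (k + 1) + r ^ (n + 1))
            = A + (∑ _b : B, C * M ^ 2) * r ^ (n + 1) := by rw [hA]; ring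
        rw [h4, add_mul, ← hE.energy_eq u hu u hu]
        have h5 : E.energy u u = ∑ i, r⁻¹ * E.energy (u ∘ h.cellMap i) (u ∘ h.cellMap i) +
          h.bondEnergy D ρ u u := hE.energy_eq u hu u hu
        have h6 := congrArg (A * ·) h5
        simp only [mul_add] at h6
        linarith
  have hu0 := E.energy_nonneg hu
  refine h.mem_closureDom_of_bounded hD hr
    (M := (2 + (∑ _b : B, C * M ^ 2) * (1 - r)⁻¹) * E.energy u u) fun ε hε => ?_
  have hlim : Tendsto (fun n => (1 + C) * M * √r ^ n * √(E.energy u u)) atTop (𝓝 0) := by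
    simpa using ((tendsto_pow_atTop_nhds_zero_of_lt_one hs0 hs1).const_mul
      ((1 + C) * M)).mul_const √(E.energy u u)
  obtain ⟨n, hn⟩ := (hlim.eventually_lt_const hε).exists
  obtain ⟨w, hw, -, h1, h2⟩ := key n u hu
  refine ⟨n, w, hw, h2.trans (mul_le_mul_of_nonneg_right (add_le_add le_rfl
    (mul_le_mul_of_nonneg_left ?_ (by positivity))) hu0), fun x => ?_⟩
  · calc ∑ k ∈ Finset.range n, r ^ (k + 1) ≤ ∑ k ∈ Finset.range n, r ^ k :=
          Finset.sum_le_sum fun k _ => pow_le_pow_of_le_one hr.le hr1.le (Nat.le_succ k)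
      _ ≤ ∑' k, r ^ k := (summable_geometric_of_lt_one hr.le hr1).sum_le_tsum _
          fun k _ => pow_nonneg hr.le k
      _ = (1 - r)⁻¹ := tsum_geometric_of_lt_one hr.le hr1
  · rw [abs_sub_comm]
    exact (h1 x).trans hn.le

omit hc hc1 in
/-- Functions in the closure are in the domain and are limits in energy, and uniformly, of
cellwise constant functions. -/
lemma exists_approx_of_mem_closureDom {u : H → ℝ} (hu : u ∈ h.closureDom D ρ r) : u ∈ E.dom ∧
    ∀ ε > 0, ∃ n w, h.IsCellConst D ρ n w ∧ E.energy (u - w) (u - w) ≤ ε ∧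
      ∀ x, |u x - w x| ≤ ε := by
  have hA := h.graphForm_isFormSeq hD hr
  choose N w hw h1 h2 h3 using fun n : ℕ => hu (1 / ((n : ℝ) + 1)) Nat.one_div_pos_of_nat
  have hwE : ∀ n, w n ∈ E.dom := fun n => (hE.energy_isCellConst hD hr (hw n)).1
  have hcau : ∀ m n, E.energy (w m - w n) (w m - w n)
      ≤ 2 * (1 / ((n : ℝ) + 1)) + 2 * (1 / ((m : ℝ) + 1)) := by
    intro m n
    rw [(hE.energy_isCellConst hD hr ((hw m).sub hD (hw n))).2]
    have h4 := hA.lim_sub_le (h1 n) (h1 m)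
    rw [sub_sub_sub_cancel_left] at h4
    have h5 := h2 n
    have h6 := h2 m
    simp only [limForm] at *
    linarith
  have hsmall : ∀ ε > 0, ∃ n₀ : ℕ, ∀ n ≥ n₀, 1 / ((n : ℝ) + 1) < ε := fun ε hε =>
    eventually_atTop.1 (tendsto_one_div_add_atTop_nhds_zero_nat.eventually_lt_const hε)
  obtain ⟨⟨v, hv⟩, hlim⟩ := E.complete (fun n => ⟨w n, hwE n⟩) fun ε hε => by
    obtain ⟨n₀, hn₀⟩ := hsmall (ε / 4) (by positivity)
    refine ⟨n₀, fun m hm n hn => ?_⟩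
    have h4 := hcau m n
    rw [E.energy_of_mem (E.dom.sub_mem (hwE m) (hwE n)) (E.dom.sub_mem (hwE m) (hwE n))] at h4
    have h5 := hn₀ m hm
    have h6 := hn₀ n hn
    change E.form ⟨w m - w n, _⟩ ⟨w m - w n, _⟩ < ε
    linarith
  have hlim' : Tendsto (fun n => E.energy (w n - v) (w n - v)) atTop (𝓝 0) :=
    hlim.congr fun n => by
      rw [E.energy_of_mem (E.dom.sub_mem (hwE n) hv) (E.dom.sub_mem (hwE n) hv)]; rfl
  have hpt := fun x => tendsto_of_forall_abs_sub_le h3 x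
  -- The energy limit `v` given by completeness and the uniform limit `u` differ by a constant,
  -- because convergence in energy implies convergence of differences of values.
  have hdiff : ∀ x y, u x - v x = u y - v y := by
    intro x y
    have h4 : Tendsto (fun n => (w n x - v x) - (w n y - v y)) atTop
        (𝓝 ((u x - v x) - (u y - v y))) :=
      ((hpt x).sub_const _).sub ((hpt y).sub_const _)
    have h5 : Tendsto (fun n => (w n x - v x) - (w n y - v y)) atTop (𝓝 0) := by
      refine squeeze_zero_norm (a := fun n => √(E.resistance x y) *
        √(E.energy (w n - v) (w n - v))) (fun n => ?_) ?_
      · exact E.abs_sub_le_resistance (E.dom.sub_mem (hwE n) hv) x y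
      · simpa using hlim'.sqrt.const_mul √(E.resistance x y)
    exact sub_eq_zero.1 (tendsto_nhds_unique h4 h5)
  obtain ⟨x₀, hx₀⟩ := h.nonempty
  have huv : u = v + fun _ => u ⟨x₀, hx₀⟩ - v ⟨x₀, hx₀⟩ := by
    funext x
    rw [Pi.add_apply, ← hdiff x]; ring
  refine ⟨huv ▸ E.dom.add_mem hv (E.const_mem _), fun ε hε => ?_⟩
  obtain ⟨n₀, hn₀⟩ := hsmall ε hε
  obtain ⟨n, hn1, hn2⟩ := ((hlim'.eventually_lt_const hε).and (eventually_ge_atTop n₀)).exists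
  refine ⟨N n, w n, hw n, ?_, fun x => (h3 n x).trans (hn₀ n hn2).le⟩
  have h4 : u - w n = (-1 : ℝ) • ((w n - v) - fun _ => u ⟨x₀, hx₀⟩ - v ⟨x₀, hx₀⟩) := by
    nth_rewrite 1 [huv]
    funext x
    simp only [Pi.sub_apply, Pi.add_apply, Pi.smul_apply, smul_eq_mul]
    ring
  have hd := E.dom.sub_mem (hwE n) hv
  rw [h4, E.energy_smul _ (E.dom.sub_mem hd (E.const_mem _)), E.energy_sub_const hd]
  linarith

lemma mem_dom_iff_mem_closureDom (hr1 : r < 1) (hreg : E.IsRegular) {u : H → ℝ} :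
    u ∈ E.dom ↔ u ∈ h.closureDom D ρ r :=
  ⟨hE.mem_closureDom hD hr hc hc1 hr1 hreg, fun hu =>
    (hE.exists_approx_of_mem_closureDom hD hr hu).1⟩

end SelfSimilar

/-! ### The energy as a series over the bonds -/

/-- The energy on the bonds of level `k`. -/
noncomputable def bondLevelEnergy (h : IsHybrid K c bond att H)
    (D : ∀ b, Matrix (bond b).boundary (bond b).boundary ℝ) (ρ : ∀ b, Fin (bond b).N → ℝ)
    (r : ℝ) (k : ℕ) (u v : H → ℝ) : ℝ :=
  ∑ α : Fin k → Fin K.N, ∑ b, (r ^ k)⁻¹ * (bond b).energy (D b) (ρ b)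
    (u ∘ wordMap h.cellMap k α ∘ h.bondIncl b) (v ∘ wordMap h.cellMap k α ∘ h.bondIncl b)

lemma bondLevelEnergy_zero (u v : H → ℝ) :
    h.bondLevelEnergy D ρ r 0 u v = h.bondEnergy D ρ u v := by
  simp [bondLevelEnergy, bondEnergy, wordMap]

lemma bondLevelEnergy_succ (k : ℕ) (u v : H → ℝ) : h.bondLevelEnergy D ρ r (k + 1) u v =
    ∑ i, r⁻¹ * h.bondLevelEnergy D ρ r k (u ∘ h.cellMap i) (v ∘ h.cellMap i) := by
  simp only [bondLevelEnergy, Finset.mul_sum]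
  rw [← (Fin.consEquiv fun _ => Fin K.N).sum_comp, Fintype.sum_prod_type]
  refine Finset.sum_congr rfl fun i _ => Finset.sum_congr rfl fun α _ =>
    Finset.sum_congr rfl fun b _ => ?_
  rw [← mul_assoc, ← mul_inv, ← pow_succ']
  rfl

namespace SelfSimilar

variable {E : ResistanceForm H} (hE : h.SelfSimilar D ρ r E)
include hE

/-- The part of the energy that is carried by the cells of level `n`. -/
lemma exists_remainder (hD : ∀ b, (bond b).IsRegularHarmonicStructure (D b) (ρ b)) (hr : 0 < r) :
    ∃ rem : ℕ → (H → ℝ) → ℝ,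
      (∀ n, ∀ u ∈ E.dom, E.energy u u =
        ∑ k ∈ Finset.range n, h.bondLevelEnergy D ρ r k u u + rem n u) ∧
      (∀ n, ∀ u ∈ E.dom, 0 ≤ rem n u ∧ rem n u ≤ E.energy u u) ∧
      (∀ n, ∀ u ∈ E.dom, ∀ v ∈ E.dom, rem n (u - v) ≤ 2 * rem n u + 2 * rem n v) ∧
      ∀ m n u, m ≤ n → h.IsCellConst D ρ m u → rem n u = 0 := by
  have hrec : ∀ u ∈ E.dom, E.energy u u = ∑ i, r⁻¹ *
      E.energy (u ∘ h.cellMap i) (u ∘ h.cellMap i) + h.bondEnergy D ρ u u :=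
    fun u hu => hE.energy_eq u hu u hu
  have hcomp : ∀ u ∈ E.dom, ∀ i, u ∘ h.cellMap i ∈ E.dom := fun u hu =>
    ((hE.mem_dom_iff u).1 hu).1
  have hri : 0 ≤ r⁻¹ := inv_nonneg.2 hr.le
  -- Unfolded, this is the sum of `r ^ (-n)` times the energies of `u ∘ φ_α` over words `α` of
  -- length `n`.
  let rem : ℕ → (H → ℝ) → ℝ := fun n => Nat.rec (fun u => E.energy u u)
    (fun _ f u => ∑ i, r⁻¹ * f (u ∘ h.cellMap i)) n
  have hrem : ∀ n u, rem (n + 1) u = ∑ i, r⁻¹ * rem n (u ∘ h.cellMap i) := fun _ _ => rfl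
  have hnn : ∀ n, ∀ u ∈ E.dom, 0 ≤ rem n u := by
    intro n
    induction n with
    | zero => exact fun u hu => E.energy_nonneg hu
    | succ n ih =>
      exact fun u hu => Finset.sum_nonneg fun i _ => mul_nonneg hri (ih _ (hcomp u hu i))
  have hcst : ∀ n a, rem n (fun _ => a) = 0 := by
    intro n
    induction n with
    | zero => exact fun a => E.energy_const a
    | succ n ih =>
      exact fun a => Finset.sum_eq_zero fun i _ => (congrArg (r⁻¹ * ·) (ih a)).trans (mul_zero _)
  refine ⟨rem, fun n => ?_, fun n u hu => ⟨hnn n u hu, ?_⟩, fun n => ?_, fun m => ?_⟩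
  · induction n with
    | zero => intro u _; simp [rem]
    | succ n ih =>
      intro u hu
      rw [hrec u hu, Finset.sum_range_succ', bondLevelEnergy_zero, hrem]
      simp only [bondLevelEnergy_succ]
      rw [Finset.sum_comm, add_right_comm, ← Finset.sum_add_distrib]
      congr 1
      refine Finset.sum_congr rfl fun i _ => ?_
      rw [ih _ (hcomp u hu i), ← Finset.mul_sum, mul_add]
  · induction n generalizing u with
    | zero => exact le_rfl
    | succ n ih =>
      rw [hrec u hu, hrem]
      refine le_add_of_le_of_nonneg (Finset.sum_le_sum fun i _ =>
        mul_le_mul_of_nonneg_left (ih _ (hcomp u hu i)) hri) ?_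
      exact h.bondEnergy_nonneg hD ((hE.mem_dom_iff u).1 hu).2
  · induction n with
    | zero => exact fun u hu v hv => E.energy_sub_le hu hv
    | succ n ih =>
      intro u hu v hv
      rw [hrem, hrem, hrem, Finset.mul_sum, Finset.mul_sum, ← Finset.sum_add_distrib]
      refine Finset.sum_le_sum fun i _ => ?_
      have h1 := mul_le_mul_of_nonneg_left (ih _ (hcomp u hu i) _ (hcomp v hv i)) hri
      refine h1.trans_eq (by ring)
  · induction m with
    | zero => rintro n u - ⟨a, rfl⟩; exact hcst n a
    | succ m ih =>
      rintro (_ | n) u hmn hu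
      · omega
      · exact Finset.sum_eq_zero fun i _ =>
          (congrArg (r⁻¹ * ·) (ih n _ (by omega) (hu.1 i))).trans (mul_zero _)

lemma comp_wordMap_mem (k : ℕ) : ∀ (α : Fin k → Fin K.N) {u : H → ℝ}, u ∈ E.dom →
    u ∘ wordMap h.cellMap k α ∈ E.dom := by
  induction k with
  | zero => exact fun α u hu => hu
  | succ k ih => exact fun α u hu => ih (fun j => α j.succ) (((hE.mem_dom_iff u).1 hu).1 (α 0))

lemma bondLevelEnergy_nonneg (hD : ∀ b, (bond b).IsRegularHarmonicStructure (D b) (ρ b))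
    (hr : 0 < r) (k : ℕ) {u : H → ℝ} (hu : u ∈ E.dom) : 0 ≤ h.bondLevelEnergy D ρ r k u u :=
  Finset.sum_nonneg fun α _ => Finset.sum_nonneg fun b _ => mul_nonneg (by positivity)
    ((hD b).energy_nonneg (((hE.mem_dom_iff _).1 (hE.comp_wordMap_mem k α hu)).2 b))

lemma bondLevelEnergy_polarization
    (hD : ∀ b, (bond b).IsRegularHarmonicStructure (D b) (ρ b)) (k : ℕ) {u v : H → ℝ}
    (hu : u ∈ E.dom) (hv : v ∈ E.dom) : h.bondLevelEnergy D ρ r k u v =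
      4⁻¹ * (h.bondLevelEnergy D ρ r k (u + v) (u + v) -
        h.bondLevelEnergy D ρ r k (u - v) (u - v)) := by
  simp only [bondLevelEnergy, ← Finset.sum_sub_distrib, Finset.mul_sum]
  refine Finset.sum_congr rfl fun α _ => Finset.sum_congr rfl fun b _ => ?_
  have hu' : u ∘ wordMap h.cellMap k α ∘ h.bondIncl b ∈ (bond b).domain (D b) (ρ b) :=
    ((hE.mem_dom_iff _).1 (hE.comp_wordMap_mem k α hu)).2 b
  have hv' : v ∘ wordMap h.cellMap k α ∘ h.bondIncl b ∈ (bond b).domain (D b) (ρ b) :=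
    ((hE.mem_dom_iff _).1 (hE.comp_wordMap_mem k α hv)).2 b
  have hA := (hD b).isFormSeq
  have h1 : (bond b).energy (D b) (ρ b)
      (u ∘ wordMap h.cellMap k α ∘ h.bondIncl b) (v ∘ wordMap h.cellMap k α ∘ h.bondIncl b) =
      4⁻¹ * ((bond b).energy (D b) (ρ b) ((u + v) ∘ wordMap h.cellMap k α ∘ h.bondIncl b)
          ((u + v) ∘ wordMap h.cellMap k α ∘ h.bondIncl b) -
        (bond b).energy (D b) (ρ b) ((u - v) ∘ wordMap h.cellMap k α ∘ h.bondIncl b)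
          ((u - v) ∘ wordMap h.cellMap k α ∘ h.bondIncl b)) := by
    refine tendsto_nhds_unique (hA.tendsto hu'.2 hv'.2) ?_
    refine (((hA.tendsto_diag (hA.add_mem hu'.2 hv'.2)).sub
      (hA.tendsto_diag (hA.sub_mem hu'.2 hv'.2))).const_mul (4⁻¹ : ℝ)).congr fun n => ?_
    rw [hA.diag_add, hA.diag_sub]; ring
  rw [h1]; ring

/-- The energy is the sum of the energies on the bonds. -/
lemma hasSum_bondLevelEnergy (hD : ∀ b, (bond b).IsRegularHarmonicStructure (D b) (ρ b))
    (hr : 0 < r) (hr1 : r < 1) (hc : 0 < c) (hc1 : c < 1) (hreg : E.IsRegular) {u v : H → ℝ}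
    (hu : u ∈ E.dom) (hv : v ∈ E.dom) :
    HasSum (fun k => h.bondLevelEnergy D ρ r k u v) (E.energy u v) := by
  have hdiag : ∀ u ∈ E.dom, HasSum (fun k => h.bondLevelEnergy D ρ r k u u) (E.energy u u) := by
    intro u hu
    obtain ⟨rem, hrem, hrle, hrsub, hrcc⟩ := hE.exists_remainder hD hr
    rw [hasSum_iff_tendsto_nat_of_nonneg fun k => hE.bondLevelEnergy_nonneg hD hr k hu]
    -- For a cellwise constant `w` the remainder vanishes from some level on, and that of `u - w`
    -- never exceeds the energy of `u - w`.
    have hlim : Tendsto (fun n => rem n u) atTop (𝓝 0) := by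
      refine Metric.tendsto_atTop.2 fun ε hε => ?_
      obtain ⟨n₀, w, hw, hwE, -⟩ := (hE.exists_approx_of_mem_closureDom hD hr
        (hE.mem_closureDom hD hr hc hc1 hr1 hreg hu)).2 (ε / 4) (by positivity)
      refine ⟨n₀, fun n hn => ?_⟩
      have hwd := (hE.energy_isCellConst hD hr hw).1
      have hd := E.dom.sub_mem hu hwd
      rw [Real.dist_eq, sub_zero, abs_of_nonneg (hrle n u hu).1]
      have h1 := hrsub n _ hd _ (E.dom.smul_mem (-1) hwd)
      have h2 := (hrle n _ hd).2
      -- The remainder inequality is available for differences, so `u` is written as `u - w` minus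
      -- `-w`.
      rw [hrcc n₀ n _ hn (hw.smul hD (-1)), show u - w - (-1 : ℝ) • w = u by
        rw [neg_one_smul, sub_neg_eq_add, sub_add_cancel]] at h1
      linarith
    have h1 : Tendsto (fun n => E.energy u u - rem n u) atTop (𝓝 (E.energy u u - 0)) :=
      hlim.const_sub _
    rw [sub_zero] at h1
    refine h1.congr fun n => ?_
    rw [hrem n u hu]; ring
  have h1 := ((hdiag _ (E.dom.add_mem hu hv)).sub (hdiag _ (E.dom.sub_mem hu hv))).mul_left 4⁻¹
  have h2 : E.energy u v = 4⁻¹ * (E.energy (u + v) (u + v) - E.energy (u - v) (u - v)) := by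
    rw [E.energy_add hu hv, E.energy_sub hu hv]; ring
  rw [h2]
  simpa only [← hE.bondLevelEnergy_polarization hD _ hu hv] using h1

end SelfSimilar

omit [Fintype B] in
lemma IsCellConst.apply_wordMap {n : ℕ} : ∀ {u : H → ℝ}, h.IsCellConst D ρ n u →
    ∀ (α : Fin n → Fin K.N) (x y : H),
      u (wordMap h.cellMap n α x) = u (wordMap h.cellMap n α y) := by
  induction n with
  | zero => rintro u ⟨a, rfl⟩ α x y; rfl
  | succ n ih => exact fun hu α x y => ih (hu.1 (α 0)) (fun j => α j.succ) x y

end IsHybrid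

theorem theorem3p2 (K : SierpinskiLike) (c : ℝ) (hc : 0 < c) (hcK : c < K.ratio)
    {B : Type*} [Fintype B] (bond : B → PCFSet) (att : B → Finset (Fin K.N)) (H : Set Plane)
    (hH : IsHybrid K c bond att H)
    (D : ∀ b, Matrix (bond b).boundary (bond b).boundary ℝ) (ρ : ∀ b, Fin (bond b).N → ℝ)
    (hD : ∀ b, (bond b).IsRegularHarmonicStructure (D b) (ρ b))
    (rK r : ℝ) (hrK : K.IsHarmonicStructure K.symmLaplacian fun _ => rK)
    (hr : 0 < r) (hrr : r < rK) :
    (∃! E : ResistanceForm H, E.IsLocal ∧ E.IsRegular ∧ hH.SelfSimilar D ρ r E) ∧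
    ∀ E : ResistanceForm H, E.IsLocal → E.IsRegular → hH.SelfSimilar D ρ r E →
      (∀ u : H → ℝ, u ∈ E.dom ↔ Continuous u ∧ ∃ us : ℕ → H → ℝ,
        (∀ n, ∃ m, 1 ≤ m ∧ us n ∈ hH.cellConstant E m) ∧
        (∀ n, u - us n ∈ E.dom) ∧
        Tendsto (fun n => E.energy (u - us n) (u - us n)) atTop (𝓝 0) ∧
        ∀ x, Tendsto (fun n => us n x) atTop (𝓝 (u x))) ∧
      ∀ u ∈ E.dom, ∀ v ∈ E.dom,
        HasSum (fun k : ℕ => ∑ α : Fin k → Fin K.N, ∑ b,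
          (r ^ k)⁻¹ * (bond b).energy (D b) (ρ b)
            (u ∘ wordMap hH.cellMap k α ∘ hH.bondIncl b)
            (v ∘ wordMap hH.cellMap k α ∘ hH.bondIncl b))
          (E.energy u v) := by
  have hc1 : c < 1 := hcK.trans K.ratio_lt_one
  have hr1 : r < 1 := hrr.trans_le (SierpinskiLike.resistance_factor_le_one hrK)
  refine ⟨⟨hH.closureResistanceForm hD hr hc hc1 hrK hrr,
    ⟨hH.closureResistanceForm_isLocal hD hr hc hc1 hrK hrr,
      hH.closureResistanceForm_isRegular hD hr hc hc1 hrK hrr,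
      hH.closureResistanceForm_selfSimilar hD hr hc hc1 hrK hrr⟩, ?_⟩, ?_⟩
  · rintro E ⟨-, hreg, hE⟩
    have hreg' := hH.closureResistanceForm_isRegular hD hr hc hc1 hrK hrr
    have hE' := hH.closureResistanceForm_selfSimilar hD hr hc hc1 hrK hrr
    have hdom : ∀ u : H → ℝ, u ∈ E.dom ↔
        u ∈ (hH.closureResistanceForm hD hr hc hc1 hrK hrr).dom := fun u =>
      hE.mem_dom_iff_mem_closureDom hD hr hc hc1 hr1 hreg
    -- Both domains are the closure of the cellwise constant functions, and both energies are the
    -- sum of the same bond series.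
    refine ResistanceForm.ext_energy (SetLike.ext hdom) fun u hu v hv => ?_
    exact (hE.hasSum_bondLevelEnergy hD hr hr1 hc hc1 hreg hu hv).unique
      (hE'.hasSum_bondLevelEnergy hD hr hr1 hc hc1 hreg' ((hdom u).1 hu) ((hdom v).1 hv))
  · intro E _ hreg hE
    refine ⟨fun u => ⟨fun hu => ?_, ?_⟩, fun u hu v hv =>
      hE.hasSum_bondLevelEnergy hD hr hr1 hc hc1 hreg hu hv⟩
    · have huD := hE.mem_closureDom hD hr hc hc1 hr1 hreg hu
      choose N w hw h1 h2 using fun n : ℕ => (hE.exists_approx_of_mem_closureDom hD hr huD).2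
        (1 / ((n : ℝ) + 1)) Nat.one_div_pos_of_nat
      have hwE := fun n => (hE.energy_isCellConst hD hr (hw n)).1
      -- The level is raised by one since `N n` may be zero, while levels are required to be
      -- positive.
      refine ⟨hH.closureDom_continuous hc huD, w, fun n => ⟨N n + 1, by omega, hwE n,
        ((hw n).succ hD).apply_wordMap⟩, fun n => E.dom.sub_mem hu (hwE n), ?_,
        tendsto_of_forall_abs_sub_le h2⟩
      exact squeeze_zero (fun n => E.energy_nonneg (E.dom.sub_mem hu (hwE n))) h1
        tendsto_one_div_add_atTop_nhds_zero_nat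
    · rintro ⟨-, us, hus, hsub, -, -⟩
      -- A single index suffices: `u` is the sum of `u - us 0` and `us 0`, both in the domain.
      obtain ⟨m, -, hm, -⟩ := hus 0
      have := E.dom.add_mem (hsub 0) hm
      rwa [sub_add_cancel] at this
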